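/- **Setting.** Let $(E_n)_{n\ge 0}$ be measurable spaces and consider the following spatial branching point process. At time $0$ the targets form a Poisson point process with finite non-zero intensity measure $\mu_0$ on $E_0$. Given the configuration at time $n$, each target, in state $x\in E_n$, independently survives with probability $e_n(x)\in[0,1]$; if it survives it is replaced by a random number $\geq 1$ of offspring with mean $H_n(x)$, where $H_n$ is bounded and measurable; the offspring move independently to $E_{n+1}$ according to a Markov transition $M_{n+1}(x,dy)$; and an independent Poisson process of new targets with finite (possibly zero) intensity measure $\mu_{n+1}$ on $E_{n+1}$ is added. Let $\gamma_n$ be the intensity measure of the point process at time $n$, and $\eta_n=\gamma_n/\gamma_n(1)$. Put $G_n=e_nH_n$ and assume $0<\inf G_n\le\sup G_n<\infty$ for every $n$. Let $Q_{n+1}(x,dy)=G_n(x)M_{n+1}(x,dy)$, $Q_{p,n}=Q_{p+1}\cdots Q_n$, $Q_{n,n}=\mathrm{Id}$, $P_{p,n}(x,dy)=Q_{p,n}(x,dy)/Q_{p,n}(1)(x)$, $$q_{p,n}=\sup_{x,y}\frac{Q_{p,n}(1)(x)}{Q_{p,n}(1)(y)},\qquad \beta(P_{p,n})=\sup_{x,y}\|P_{p,n}(x,\cdot)-P_{p,n}(y,\cdot)\|_{\rm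 tv},\qquad c_{p,n}=\mu_pQ_{p,n}(1),$$ where $\|\nu\|_{\rm tv}=\sup\{|\nu(f)| : f\in \mathrm{Osc}_1\}$ and $\mathrm{Osc}_1(E)$ is the set of measurable $f:E\to\mathbb R$ with $\sup_{x,y}|f(x)-f(y)|\le 1$. Let $g_-(n)=\inf_{0\le p<n}\inf_{E_p} G_p$, $g_+(n)=\sup_{0\le p<n}\sup_{E_p} G_p$, $m_{\mp}(n)=\sum_{p=0}^n\mu_p(1)\,g_{\mp}(n)^{n-p}$, $I_n=[m_-(n),m_+(n)]$ (for $n=0$ only the exponent $0$ occurs, so $I_0=\{\mu_0(1)\}$), and $$b_{p,n}=2\,(1\wedge m_{p,n})\,q_{p,n}\Big[q_{p,n}\,\beta(P_{p,n})+\sum_{p<q\le n}\frac{c_{q,n}}{\sum_{p<r\le n}c_{r,n}}\,\beta(P_{q,n})\Big],\qquad m_{p,n}=\frac{m_+(p)\,\|Q_{p,n}(1)\|}{\sum_{p<q\le n}c_{q,n}},$$ where $\|\cdot\|$ is the uniform norm, with the conventions $m_{p,n}=\infty$ and $\sum_{p<q\le n}(\cdots)=0$ when $\sum_{p<q\le n}c_{q,n}=0$.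 *Particle model.* For $m>0$ and a probability measure $\eta$ on $E_n$ let $$\Gamma^2_{n+1}(m,\eta)=\Psi_{G_n}(\eta)\,\big[\alpha\,M_{n+1}+(1-\alpha)\,\mu_{n+1}/\mu_{n+1}(1)\big],\qquad \alpha=\frac{m\,\eta(G_n)}{m\,\eta(G_n)+\mu_{n+1}(1)},$$ with $\Psi_{G}(\eta)(dx)=G(x)\eta(dx)/\eta(G)$. Let $K_{n+1,(m,\eta)}$, indexed by $m\geq 0$ and probability measures $\eta$ on $E_n$, be any Markov kernels from $E_n$ to $E_{n+1}$ such that $\eta K_{n+1,(m,\eta)}=\Gamma^2_{n+1}(m,\eta)$ for all $m>0$ and $\eta$, and such that $(m,(x^j)_{j\le N})\mapsto K_{n+1,(m,\frac1N\sum_j\delta_{x^j})}(x^i,A)$ is measurable for all $N\ge1$, $i\le N$ and measurable $A\subset E_{n+1}$. For $N\ge 1$ let $\xi_n=(\xi_n^i)_{1\le i\le N}$, with occupation measures $\eta_n^N=\frac1N\sum_{i}\delta_{\xi^i_n}$, be such that $\xi_0^1,\dots,\xi_0^N$ are i.i.d. with law $\eta_0$ and, given $\xi_0,\dots,\xi_n$,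 the $\xi_{n+1}^i$ are independent with laws $K_{n+1,(\gamma_n^N(1),\eta_n^N)}(\xi_n^i,\cdot)$, where $\gamma_0^N(1)=\gamma_0(1)$, $\gamma^N_{n+1}(1)=\gamma^N_n(1)\,\eta^N_n(G_n)+\mu_{n+1}(1)$ and $\gamma_n^N=\gamma_n^N(1)\,\eta_n^N$. **Theorem.** There are finite constants $a_r\ge 0$ $(r\ge1)$, depending only on $r$, such that the following holds. 1. For all $n\ge0$ and $N\geq 1$, $\gamma_n(1)\in I_n$ and $\gamma_n^N(1)\in I_n$. 2. There are constants $0\le b_n\le\sum_{p=0}^n b_{p,n}$, depending only on the model (not on $N$, $r$, $f$ or the choice of $K$), such that for all $n\ge0$, $N\ge1$, real $r\ge1$ and $f\in\mathrm{Osc}_1(E_n)$, $$\sqrt N\;\mathbb E\big(|[\eta_n^N-\eta_n](f)|^r\big)^{1/r}\le a_r\,b_n .$$ 3. The measures $\gamma_n^N$ are unbiased: $\mathbb E(\gamma_n^N(f))=\gamma_n(f)$ for all $n\geq 0$, $N\geq 1$ and all bounded measurable $f$ on $E_n$. 4. Suppose that the model is time homogeneous ($E_n=E$, $G_n=G$,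 $M_{n+1}=M$ for $n\ge 0$, and $\mu_n=\mu$ for $n\ge1$, with $\mu_0$ arbitrary), that either $G\equiv1$, or $\sup_E G<1$, or $\inf_E G>1$, and that for some $k\ge1$ and $\epsilon>0$, $M^k(x,\cdot)\ge\epsilon M^k(y,\cdot)$ for all $x,y\in E$. Then the constants $b_n$ in 2 can be chosen so that $\sup_{n\ge0}b_n<\infty$, and there is a constant $d<\infty$ (depending only on the model) such that for all $n\ge1$ and $N>1$, $$\mathbb E\Big(\Big[\frac{\gamma^N_n(1)}{\gamma_n(1)}-1\Big]^2\Big)\le d\,\frac{n+1}{N-1}\Big(1+\frac d{N-1}\Big)^{n-1}.$$ -/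

import Mathlib

open MeasureTheory ProbabilityTheory
open scoped NNReal ENNReal

universe u v

namespace SpatialBranching

noncomputable section

/-! ### Point configurations and laws of point processes -/

/-- A finite configuration of points of `S`: a number of points together with their states. -/
abbrev Config (S : Type u) : Type u := Σ k : ℕ, (Fin k → S)

/-- The empty configuration. -/
def Config.empty (S : Type u) : Config S := ⟨0, Fin.elim0⟩

/-- Juxtaposition of two configurations. -/
def Config.append {S : Type u} (c d : Config S) : Config S :=
  ⟨c.1 + d.1, Fin.append c.2 d.2⟩

/-- The law of `k` independent points with common distribution `ν`. -/
def iidConfig {S : Type u} [MeasurableSpace S] (k : ℕ) (ν : Measure S) : Measure (Config S) :=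
  (Measure.pi fun _ : Fin k => ν).map (Sigma.mk k)

/-- The law of the superposition of two independent point processes with laws `ρ` and `σ`. -/
def superpose {S : Type u} [MeasurableSpace S] (ρ σ : Measure (Config S)) :
    Measure (Config S) :=
  (ρ.prod σ).map fun z => z.1.append z.2

/-- The law of the superposition of `k` independent point processes with laws `ρ i`. -/
def superposeAll {S : Type u} [MeasurableSpace S] {k : ℕ} (ρ : Fin k → Measure (Config S)) :
    Measure (Config S) :=
  (List.ofFn ρ).foldr superpose (Measure.dirac (Config.empty S))

/-- The normalization `ν / ν(1)` of a measure. -/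
def normalize {S : Type u} [MeasurableSpace S] (ν : Measure S) : Measure S :=
  (ν Set.univ)⁻¹ • ν

/-- The law of a spatial Poisson process with (finite) intensity measure `ν`: a Poisson number,
with parameter `ν(1)`, of independent points with common distribution `ν / ν(1)`. -/
def poissonConfig {S : Type u} [MeasurableSpace S] (ν : Measure S) : Measure (Config S) :=
  (poissonMeasure (ν Set.univ).toNNReal).bind fun k => iidConfig k (normalize ν)

/-- The intensity measure `A ↦ 𝔼[#{i | Xⁱ ∈ A}]` of a point process with law `ρ`. -/
def intensity {S : Type u} [MeasurableSpace S] (ρ : Measure (Config S)) : Measure S :=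
  ρ.bind fun c => ∑ i : Fin c.1, Measure.dirac (c.2 i)

/-- The occupation measure `N⁻¹ ∑ δ_{xⁱ}` of a tuple of `N` points. -/
def empirical {S : Type u} [MeasurableSpace S] {N : ℕ} (x : Fin N → S) : Measure S :=
  (N : ℝ≥0∞)⁻¹ • ∑ i : Fin N, Measure.dirac (x i)

/-- `f ∈ Osc₁(S)`: measurable functions with oscillation at most one. -/
def IsOscOne {S : Type u} [MeasurableSpace S] (f : S → ℝ) : Prop :=
  Measurable f ∧ ∀ x y, |f x - f y| ≤ 1

/-- The total variation norm `‖ν - ν'‖_tv = sup_{f ∈ Osc₁} |ν(f) - ν'(f)|` (for probability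
measures). -/
def tvDist {S : Type u} [MeasurableSpace S] (ν ν' : Measure S) : ℝ :=
  ⨆ f : {f : S → ℝ // IsOscOne f}, |∫ x, f.1 x ∂ν - ∫ x, f.1 x ∂ν'|

/-- `Ψ_G(η)(dx) = G(x) η(dx) / η(G)`. -/
def boltzmannGibbs {S : Type u} [MeasurableSpace S] (G : S → ℝ) (η : Measure S) : Measure S :=
  (∫⁻ x, ENNReal.ofReal (G x) ∂η)⁻¹ • η.withDensity fun x => ENNReal.ofReal (G x)

/-! ### The spatial branching point process -/

/-- The data of a spatial branching point process on the state spaces `E n`. -/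
structure Model (E : ℕ → Type u) [∀ n, MeasurableSpace (E n)] where
  /-- the survival probabilities `e n` -/
  e : ∀ n, E n → ℝ
  measurable_e : ∀ n, Measurable (e n)
  e_mem : ∀ n x, e n x ∈ Set.Icc (0 : ℝ) 1
  /-- the law of the number of offspring at time `n` of the `i`-th target, if it survives and
  is in state `x` -/
  offspring : ∀ n, ℕ → Kernel (E n) ℕ
  markov_offspring : ∀ n i, IsMarkovKernel (offspring n i)
  offspring_pos : ∀ n i x, offspring n i x {0} = 0
  /-- the mean number of offspring of a surviving target -/
  H : ∀ n, E n → ℝ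
  measurable_H : ∀ n, Measurable (H n)
  bounded_H : ∀ n, ∃ C : ℝ, ∀ x, H n x ≤ C
  mean_offspring : ∀ n i x, ∫⁻ j, (j : ℝ≥0∞) ∂(offspring n i x) = ENNReal.ofReal (H n x)
  /-- `G n = e n * H n` is bounded away from zero and from above. -/
  bounds_G : ∀ n, ∃ gminus gplus : ℝ, 0 < gminus ∧ ∀ x, gminus ≤ e n x * H n x ∧
    e n x * H n x ≤ gplus
  /-- `M n` is the Markov transition from `E n` into `E (n + 1)` (it has index `n + 1` in the
  usual notation). -/
  M : ∀ n, Kernel (E n) (E (n + 1))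
  markov_M : ∀ n, IsMarkovKernel (M n)
  /-- `μ 0` is the intensity of the initial configuration, `μ n` for `n ≥ 1` is the intensity of
  the spontaneous births at time `n`. -/
  μ : ∀ n, Measure (E n)
  finite_μ : ∀ n, IsFiniteMeasure (μ n)
  μ_zero_ne : μ 0 ≠ 0

namespace Model

variable {E : ℕ → Type u} [∀ n, MeasurableSpace (E n)] (𝓜 : Model E)

/-- The potential functions `G n = e n * H n`. -/
def G (n : ℕ) (x : E n) : ℝ := 𝓜.e n x * 𝓜.H n x

/-- The law of the descendants at time `n + 1` of the `i`-th target of time `n`, which is in state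
`x`: it dies with probability `1 - e n x`, and otherwise has a random number of offspring, which
move independently according to `M n x`. -/
def descendants (n i : ℕ) (x : E n) : Measure (Config (E (n + 1))) :=
  ENNReal.ofReal (1 - 𝓜.e n x) • Measure.dirac (Config.empty (E (n + 1))) +
    ENNReal.ofReal (𝓜.e n x) • (𝓜.offspring n i x).bind fun j => iidConfig j (𝓜.M n x)

/-- The conditional law of the configuration at time `n + 1`, given the configuration `c` at
time `n`: the superposition of the independent descendants of the targets and of an independent
Poisson process of new targets. -/
def next (n : ℕ) (c : Config (E n)) : Measure (Config (E (n + 1))) :=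
  superpose (superposeAll fun i : Fin c.1 => 𝓜.descendants n i (c.2 i))
    (poissonConfig (𝓜.μ (n + 1)))

/-- The law of the configuration of the targets at time `n`. -/
def law : ∀ n, Measure (Config (E n))
  | 0 => poissonConfig (𝓜.μ 0)
  | n + 1 => (law n).bind (𝓜.next n)

/-- The intensity measure `γ n` of the point process at time `n`. -/
def γ (n : ℕ) : Measure (E n) := intensity (𝓜.law n)

/-- The total mass `γ n (1)`. -/
def mass (n : ℕ) : ℝ := (𝓜.γ n).real Set.univ

/-- The normalized intensity measure `η n = γ n / γ n (1)`. -/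
def η (n : ℕ) : Measure (E n) := normalize (𝓜.γ n)

/-! ### Feynman–Kac semigroups and the constants of the error bounds -/

theorem measurable_G (n : ℕ) : Measurable (𝓜.G n) :=
  (𝓜.measurable_e n).mul (𝓜.measurable_H n)

/-- The integral operator `Q_{n+1}(x, dy) = G n x * M_{n+1}(x, dy)`. -/
def Qstep (n : ℕ) : Kernel (E n) (E (n + 1)) where
  toFun x := ENNReal.ofReal (𝓜.G n x) • 𝓜.M n x
  measurable' := by
    refine Measure.measurable_of_measurable_coe _ fun s hs => ?_
    simp only [Measure.smul_apply, smul_eq_mul]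
    exact (𝓜.measurable_G n).ennreal_ofReal.mul (Kernel.measurable_coe _ hs)

/-- The semigroup `Q_{p,p+k} = Q_{p+1} ⋯ Q_{p+k}`, with `Q_{p,p} = Id`. -/
def Q (p : ℕ) : ∀ k, Kernel (E p) (E (p + k))
  | 0 => Kernel.id
  | k + 1 => 𝓜.Qstep (p + k) ∘ₖ Q p k

/-- The function `Q_{p,p+k}(1)`. -/
def Qone (p k : ℕ) (x : E p) : ℝ := (𝓜.Q p k x).real Set.univ

/-- The probability measure `P_{p,p+k}(x, dy) = Q_{p,p+k}(x, dy) / Q_{p,p+k}(1)(x)`. -/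
def P (p k : ℕ) (x : E p) : Measure (E (p + k)) := normalize (𝓜.Q p k x)

/-- `q_{p,n} = sup_{x,y} Q_{p,n}(1)(x) / Q_{p,n}(1)(y)`, for `p ≤ n`. -/
def q (p n : ℕ) : ℝ := ⨆ x, ⨆ y, 𝓜.Qone p (n - p) x / 𝓜.Qone p (n - p) y

/-- The Dobrushin coefficient `β(P_{p,n}) = sup_{x,y} ‖P_{p,n}(x, ·) - P_{p,n}(y, ·)‖_tv`, for
`p ≤ n`. -/
def β (p n : ℕ) : ℝ := ⨆ x, ⨆ y, tvDist (𝓜.P p (n - p) x) (𝓜.P p (n - p) y)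

/-- `‖Q_{p,n}(1)‖`, for `p ≤ n`. -/
def normQ (p n : ℕ) : ℝ := ⨆ x, 𝓜.Qone p (n - p) x

/-- `c_{p,n} = μ_p Q_{p,n}(1)`, for `p ≤ n`. -/
def c (p n : ℕ) : ℝ := ∫ x, 𝓜.Qone p (n - p) x ∂(𝓜.μ p)

/-- `g_-(n) = inf_{0 ≤ p < n} inf G p` (only used with exponent zero when `n = 0`). -/
def gMinus (n : ℕ) : ℝ := ⨅ p : Fin n, ⨅ x, 𝓜.G p x

/-- `g_+(n) = sup_{0 ≤ p < n} sup G p` (only used with exponent zero when `n = 0`). -/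
def gPlus (n : ℕ) : ℝ := ⨆ p : Fin n, ⨆ x, 𝓜.G p x

/-- `m_-(n) = ∑_{p ≤ n} μ_p(1) g_-(n)^(n-p)`. -/
def mMinus (n : ℕ) : ℝ :=
  ∑ p ∈ Finset.range (n + 1), (𝓜.μ p).real Set.univ * 𝓜.gMinus n ^ (n - p)

/-- `m_+(n) = ∑_{p ≤ n} μ_p(1) g_+(n)^(n-p)`. -/
def mPlus (n : ℕ) : ℝ :=
  ∑ p ∈ Finset.range (n + 1), (𝓜.μ p).real Set.univ * 𝓜.gPlus n ^ (n - p)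

/-- `m_{p,n} = m_+(p) ‖Q_{p,n}(1)‖ / ∑_{p < q ≤ n} c_{q,n}`, which is infinite when the
denominator vanishes. -/
def mRatio (p n : ℕ) : ℝ≥0∞ :=
  ENNReal.ofReal (𝓜.mPlus p * 𝓜.normQ p n) /
    ENNReal.ofReal (∑ q ∈ Finset.Ioc p n, 𝓜.c q n)

/-- The constants `b_{p,n} = 2 (1 ∧ m_{p,n}) q_{p,n} [q_{p,n} β(P_{p,n}) +
∑_{p < q ≤ n} (c_{q,n} / ∑_{p < r ≤ n} c_{r,n}) β(P_{q,n})]`; the last sum is zero when all the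
`c_{r,n}` vanish. -/
def bConst (p n : ℕ) : ℝ :=
  2 * (min 1 (𝓜.mRatio p n)).toReal * 𝓜.q p n *
    (𝓜.q p n * 𝓜.β p n +
      ∑ q ∈ Finset.Ioc p n, 𝓜.c q n / (∑ r ∈ Finset.Ioc p n, 𝓜.c r n) * 𝓜.β q n)

/-! ### McKean transitions and the mean field particle model -/

/-- `α_n(m, η) = m η(G n) / (m η(G n) + μ_{n+1}(1))`. -/
def α (n : ℕ) (m : ℝ≥0) (η : Measure (E n)) : ℝ :=
  m * (∫ x, 𝓜.G n x ∂η) / (m * (∫ x, 𝓜.G n x ∂η) + (𝓜.μ (n + 1)).real Set.univ)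

/-- The second component `Ψ_{G n}(η) M_{n+1,(m,η)}` of the evolution map of the pair
`(γ n (1), η n)`, with
`M_{n+1,(m,η)}(x, dy) = α_n(m, η) M_{n+1}(x, dy) + (1 - α_n(m, η)) μ_{n+1}(dy) / μ_{n+1}(1)`. -/
def Γ₂ (n : ℕ) (m : ℝ≥0) (η : Measure (E n)) : Measure (E (n + 1)) :=
  (boltzmannGibbs (𝓜.G n) η).bind fun x =>
    ENNReal.ofReal (𝓜.α n m η) • 𝓜.M n x +
      ENNReal.ofReal (1 - 𝓜.α n m η) • normalize (𝓜.μ (n + 1))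

/-- A choice of McKean transitions: Markov kernels `K n m η` from `E n` into `E (n + 1)`
(with index `n + 1` in the usual notation) such that `η K n m η` is the second component of the
evolution map. -/
structure McKean where
  K : ∀ n, ℝ≥0 → Measure (E n) → Kernel (E n) (E (n + 1))
  markov : ∀ n m (η : Measure (E n)), IsProbabilityMeasure η → IsMarkovKernel (K n m η)
  measurable : ∀ (n N : ℕ) (i : Fin N) (A : Set (E (n + 1))), MeasurableSet A →
    Measurable fun z : ℝ≥0 × (Fin N → E n) => K n z.1 (empirical z.2) (z.2 i) A
  transport : ∀ n (m : ℝ≥0) (η : Measure (E n)), 0 < m → IsProbabilityMeasure η →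
    η.bind (K n m η) = 𝓜.Γ₂ n m η

/-- The particle mass `γ^N n (1)` along a trajectory `x` of the particle system:
`γ^N_{n+1}(1) = γ^N_n(1) η^N_n(G n) + μ_{n+1}(1)`, with `γ^N_0(1) = γ_0(1) = μ_0(1)`. -/
def particleMass {N : ℕ} (x : ∀ n, Fin N → E n) : ℕ → ℝ
  | 0 => (𝓜.μ 0).real Set.univ
  | n + 1 => particleMass x n * (∫ y, 𝓜.G n y ∂(empirical (x n))) + (𝓜.μ (n + 1)).real Set.univ

/-- `(ξ n)` is the mean field `N`-particle model, on the probability space `(Ω, Pr)`, associated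
with the McKean transitions `𝓚`: the initial particles are independent with common law `η 0`,
and given the trajectory up to time `n`, the particles at time `n + 1` are independent, the
`i`-th one with law `K_{n+1,(γ^N_n(1), η^N_n)}(ξ n i, ·)`. -/
structure IsParticleModel (𝓚 : 𝓜.McKean) (N : ℕ) {Ω : Type v} [MeasurableSpace Ω]
    (Pr : Measure Ω) (ξ : ∀ n, Ω → Fin N → E n) : Prop where
  measurable : ∀ n, Measurable (ξ n)
  init : Pr.map (ξ 0) = Measure.pi fun _ => 𝓜.η 0
  step : ∀ n (A : Set (Fin N → E (n + 1))), MeasurableSet A →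
    Pr⟦ξ (n + 1) ⁻¹' A | ⨆ p : Fin (n + 1), MeasurableSpace.comap (ξ p) inferInstance⟧ =ᵐ[Pr]
      fun ω => (Measure.pi fun i : Fin N =>
        𝓚.K n (𝓜.particleMass (fun k => ξ k ω) n).toNNReal (empirical (ξ n ω)) (ξ n ω i)).real A

/-- The mean error estimates with constants `a r` and `b n`, for all McKean transitions, all
numbers of particles, all times, all `r ≥ 1` and all `f ∈ Osc₁(E n)`. -/
def MeanErrorBound (a : ℝ → ℝ) (b : ℕ → ℝ) : Prop :=
  ∀ (𝓚 : 𝓜.McKean) (N : ℕ), 1 ≤ N →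
  ∀ (Ω : Type v) [MeasurableSpace Ω] (Pr : Measure Ω) [IsProbabilityMeasure Pr]
    (ξ : ∀ n, Ω → Fin N → E n), 𝓜.IsParticleModel 𝓚 N Pr ξ →
  ∀ (n : ℕ) (r : ℝ), 1 ≤ r → ∀ f : E n → ℝ, IsOscOne f →
    √N * (∫ ω, |(∫ x, f x ∂(empirical (ξ n ω))) - ∫ x, f x ∂(𝓜.η n)| ^ r ∂Pr) ^ (1 / r) ≤
      a r * b n

/-! ### Time homogeneous models -/

/-- Time homogeneous models: `G`, `M` and, for the spontaneous births, `μ` do not depend on time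
(the initial intensity measure `μ 0` is arbitrary). -/
def IsHomogeneous {S : Type u} [MeasurableSpace S] (𝓜 : Model fun _ : ℕ => S) : Prop :=
  ∀ n, 𝓜.G n = 𝓜.G 0 ∧ 𝓜.M n = 𝓜.M 0 ∧ 𝓜.μ (n + 1) = 𝓜.μ 1

/-- The three scenarios: `G = 1`, `g_+ < 1`, or `g_- > 1`. -/
def IsScenario {S : Type u} [MeasurableSpace S] (𝓜 : Model fun _ : ℕ => S) : Prop :=
  (∀ x, 𝓜.G 0 x = 1) ∨ (⨆ x, 𝓜.G 0 x) < 1 ∨ 1 < ⨅ x, 𝓜.G 0 x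

/-- The mixing condition: for some `k ≥ 1` and `ε > 0`, `M^k(x, ·) ≥ ε M^k(y, ·)` for all `x`
and `y`. -/
def IsMixing {S : Type u} [MeasurableSpace S] (𝓜 : Model fun _ : ℕ => S) : Prop :=
  ∃ (k : ℕ) (ε : ℝ≥0), 1 ≤ k ∧ 0 < ε ∧
    ∀ x y (A : Set S), MeasurableSet A →
      ε * ((𝓜.M 0 : Kernel S S) ^ k) y A ≤ ((𝓜.M 0 : Kernel S S) ^ k) x A

end Model

end

end SpatialBranching

/-!
The first moments of the branching process determine everything: since a target in state `x` has on
average `G n x` offspring with law `M n x`, and the new targets have intensity `μ (n + 1)`, the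
intensity measures solve the affine equation `γ (n + 1) = γ n Q + μ (n + 1)` (`γ_succ`). The total
masses of `γ n` and of the particle model satisfy the same kind of scalar recursion, whence the
bounds by `m_-` and `m_+` (`mem_Icc_of_recursion`).

*Error propagation.* The affine equation defines a flow `γ_p ↦ γ_p Q_{p,n} + ∑_{p<q≤n} μ_q Q_{q,n}`
(`flow`) and, after division by the total mass, a normalized flow (`nflow`). The occupation measure
at time `p` differs from its prediction, the image of the particle measures at time `p - 1` under
one step of the flow, only by the sampling error of `N` conditionally independent particles; by the
choice of the McKean transitions the prediction is exactly the conditional mean. The error at time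
`n` is the telescoping sum of these local errors, propagated by the normalized flow
(`sum_nflow_sub`). Since the total mass at time `p` is already known at time `p - 1`, a local error
is an empirical mean of centred variables, divided by a total mass. Hoeffding's exponential bound
controls its moments (`lintegral_rpow_mean_pi_le`), and its size is measured by the oscillations of
the normalized semigroup, hence by the Dobrushin coefficients `β` (`abs_nflow_sub_nflow_le`,
`abs_centred_le`). The resulting constants `localConst p n` are at most `bConst p n`. They are also
kept finer: the masses due to the targets at time `p` and to the later births appear together in
the denominators.

*Unbiasedness and variance.* Testing the particle measures against the (unnormalized) flow gives a
martingale in `p`, whose increments have conditional mean zero (`integral_mul_flow_sub`). Its mean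
is `γ_n(f)`, and for `f = 1` the orthogonality of its increments bounds the variance of the
particle mass (`integral_sq_particleMass_sub_le`).

*Uniform estimates.* In the time homogeneous case the mixing condition, together with the bounds of
`G`, compares the measures `Q_{p,n}(x, ·)` for different `x` (`IsMixingRate`). Hence the Dobrushin
coefficients decrease geometrically and the ratios `q_{p,n}` are bounded. What remains is the error
due to the births after time `p`. If `sup G < 1`, the targets of time `p` are exponentially
outnumbered by later births. If `inf G > 1`, most targets descend from old births and have been
mixed. If `G = 1`, the total mass at time `n` is of order `n` (or constant), and each time `p ≤ n`
contributes an error of order `1 / n`; here the combined denominators matter, because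
those of `bConst` would give a logarithmic growth. Finally the relative variance of the particle
mass satisfies a discrete Gronwall inequality (`le_of_le_mul_sum`).
-/

namespace SpatialBranching

noncomputable section

/-! ### First moments of point processes -/

section PointProcesses

variable {S X : Type*} [MeasurableSpace S] [MeasurableSpace X]

theorem measurable_sigma_iff {ι : Type*} {β : ι → Type*} [∀ i, MeasurableSpace (β i)]
    {f : (Σ i, β i) → X} : Measurable f ↔ ∀ i, Measurable fun x => f ⟨i, x⟩ := by
  simp only [Measurable, MeasurableSpace.measurableSet_iInf]
  exact ⟨fun h i t ht => h ht i, fun h t ht i => h i ht⟩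

theorem measurable_sigmaMk {ι : Type*} {β : ι → Type*} [∀ i, MeasurableSpace (β i)] (i : ι) :
    Measurable (Sigma.mk i : β i → Σ i, β i) :=
  measurable_sigma_iff.1 measurable_id i

theorem measurableEmbedding_sigmaMk {ι : Type*} {β : ι → Type*} [∀ i, MeasurableSpace (β i)]
    (i : ι) : MeasurableEmbedding (Sigma.mk i : β i → Σ i, β i) where
  injective := sigma_mk_injective
  measurable := measurable_sigmaMk i
  measurableSet_image' := by
    intro s hs
    rw [Sigma.instMeasurableSpace, MeasurableSpace.measurableSet_iInf]
    intro j
    rw [MeasurableSpace.map_def]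
    by_cases h : i = j
    · subst h
      rwa [Set.preimage_image_eq _ sigma_mk_injective]
    · convert MeasurableSet.empty
      ext x
      simp only [Set.mem_preimage, Set.mem_image, Sigma.mk.injEq, Set.mem_empty_iff_false,
        iff_false, not_exists, not_and]
      exact fun _ _ hij => absurd hij h

theorem measurable_append :
    Measurable fun z : Config S × Config S => z.1.append z.2 := by
  intro A hA
  have h : (fun z : Config S × Config S => z.1.append z.2) ⁻¹' A =
      ⋃ (k : ℕ) (l : ℕ), Prod.map (Sigma.mk k) (Sigma.mk l) ''
        {z : (Fin k → S) × (Fin l → S) |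
          (⟨k + l, Fin.append z.1 z.2⟩ : Config S) ∈ A} := by
    ext ⟨⟨k, x⟩, ⟨l, y⟩⟩
    simp only [Set.mem_preimage, Set.mem_iUnion, Set.mem_image, Set.mem_ofPred_eq]
    constructor
    · exact fun h => ⟨k, l, (x, y), h, rfl⟩
    · rintro ⟨k', l', ⟨x', y'⟩, h, he⟩
      simp only [Prod.map, Prod.mk.injEq] at he
      rw [← he.1, ← he.2]
      exact h
  rw [h]
  refine MeasurableSet.iUnion fun k => MeasurableSet.iUnion fun l =>
    ((measurableEmbedding_sigmaMk k).prodMap (measurableEmbedding_sigmaMk l)).measurableSet_image.2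
      ?_
  refine (measurable_sigmaMk (k + l)).comp (measurable_pi_lambda _ fun i => ?_) hA
  refine Fin.addCases (fun i => ?_) (fun i => ?_) i
  · simp only [Fin.append_left]; fun_prop
  · simp only [Fin.append_right]; fun_prop

/-- The sum `∑ᵢ g(xᵢ)` over the points of a configuration. -/
def pointSum (g : S → ℝ≥0∞) (c : Config S) : ℝ≥0∞ := ∑ i : Fin c.1, g (c.2 i)

theorem measurable_pointSum {g : S → ℝ≥0∞} (hg : Measurable g) : Measurable (pointSum g) :=
  measurable_sigma_iff.2 fun _ =>
    Finset.measurable_sum Finset.univ fun i _ => hg.comp (measurable_pi_apply i)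

theorem pointSum_append {T : Type*} (g : T → ℝ≥0∞) (c d : Config T) :
    pointSum g (c.append d) = pointSum g c + pointSum g d := by
  change ∑ i : Fin (c.1 + d.1), g (Fin.append c.2 d.2 i) = _
  simp [Fin.sum_univ_add, pointSum]

/-- Campbell's formula. -/
theorem lintegral_intensity (ρ : Measure (Config S)) {g : S → ℝ≥0∞} (hg : Measurable g) :
    ∫⁻ x, g x ∂(intensity ρ) = ∫⁻ c, pointSum g c ∂ρ := by
  have hm : Measurable fun c : Config S => ∑ i : Fin c.1, Measure.dirac (c.2 i) := by
    refine measurable_sigma_iff.2 fun k => ?_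
    refine Measure.measurable_of_measurable_coe _ fun s hs => ?_
    simp only [Measure.coe_finsetSum, Finset.sum_apply]
    exact Finset.measurable_sum Finset.univ fun i _ =>
      (Measure.measurable_coe hs).comp (Measure.measurable_dirac.comp (measurable_pi_apply i))
  rw [intensity, Measure.lintegral_bind hm.aemeasurable hg.aemeasurable]
  refine lintegral_congr fun c => ?_
  simp [pointSum, lintegral_dirac' _ hg]

instance isProbabilityMeasure_superpose (ρ σ : Measure (Config S)) [IsProbabilityMeasure ρ]
    [IsProbabilityMeasure σ] : IsProbabilityMeasure (superpose ρ σ) :=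
  Measure.isProbabilityMeasure_map measurable_append.aemeasurable

theorem lintegral_pointSum_superpose (ρ σ : Measure (Config S)) [IsProbabilityMeasure ρ]
    [IsProbabilityMeasure σ] {g : S → ℝ≥0∞} (hg : Measurable g) :
    ∫⁻ c, pointSum g c ∂(superpose ρ σ) =
      ∫⁻ c, pointSum g c ∂ρ + ∫⁻ c, pointSum g c ∂σ := by
  have hp := measurable_pointSum hg
  rw [superpose, lintegral_map hp measurable_append]
  simp only [pointSum_append]
  rw [lintegral_add_left (by fun_prop), lintegral_prod _ (by fun_prop),
    lintegral_prod _ (by fun_prop)]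
  simp

theorem measurable_superpose {ρ σ : X → Measure (Config S)} (hρ : Measurable ρ)
    (hσ : Measurable σ) [∀ x, IsProbabilityMeasure (ρ x)] [∀ x, IsProbabilityMeasure (σ x)] :
    Measurable fun x => superpose (ρ x) (σ x) := by
  let κ : Kernel X (Config S) := ⟨ρ, hρ⟩
  let κ' : Kernel X (Config S) := ⟨σ, hσ⟩
  have : IsMarkovKernel κ := ⟨fun x => ‹∀ x, IsProbabilityMeasure (ρ x)› x⟩
  have : IsMarkovKernel κ' := ⟨fun x => ‹∀ x, IsProbabilityMeasure (σ x)› x⟩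
  have h : (fun x => superpose (ρ x) (σ x)) =
      ⇑((κ ×ₖ κ').map fun z : Config S × Config S => z.1.append z.2) := by
    ext1 x
    rw [Kernel.map_apply _ measurable_append, Kernel.prod_apply]
    rfl
  rw [h]
  exact Kernel.measurable _

theorem superposeAll_zero (ρ : Fin 0 → Measure (Config S)) :
    superposeAll ρ = Measure.dirac (Config.empty S) := by simp [superposeAll]

theorem superposeAll_succ {k : ℕ} (ρ : Fin (k + 1) → Measure (Config S)) :
    superposeAll ρ = superpose (ρ 0) (superposeAll fun i => ρ i.succ) := by
  simp [superposeAll, List.ofFn_succ]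

instance isProbabilityMeasure_superposeAll {k : ℕ} (ρ : Fin k → Measure (Config S))
    [∀ i, IsProbabilityMeasure (ρ i)] : IsProbabilityMeasure (superposeAll ρ) := by
  induction k with
  | zero => rw [superposeAll_zero]; infer_instance
  | succ k ih => rw [superposeAll_succ]; infer_instance

/-- First moments are additive under superposition; independence is not needed for this. -/
theorem lintegral_pointSum_superposeAll {k : ℕ} (ρ : Fin k → Measure (Config S))
    [∀ i, IsProbabilityMeasure (ρ i)] {g : S → ℝ≥0∞} (hg : Measurable g) :
    ∫⁻ c, pointSum g c ∂(superposeAll ρ) = ∑ i, ∫⁻ c, pointSum g c ∂(ρ i) := by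
  induction k with
  | zero =>
    rw [superposeAll_zero, lintegral_dirac' _ (measurable_pointSum hg)]
    simp [pointSum, Config.empty]
  | succ k ih =>
    rw [superposeAll_succ, lintegral_pointSum_superpose _ _ hg, ih, Fin.sum_univ_succ]

theorem measurable_superposeAll {k : ℕ} {ρ : Fin k → X → Measure (Config S)}
    (hρ : ∀ i, Measurable (ρ i)) [∀ i x, IsProbabilityMeasure (ρ i x)] :
    Measurable fun x => superposeAll fun i => ρ i x := by
  induction k with
  | zero => simp only [superposeAll_zero]; exact measurable_const
  | succ k ih =>
    simp only [superposeAll_succ]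
    exact measurable_superpose (hρ 0) (ih fun i => hρ i.succ)

theorem measurable_measure_pi {ι : Type*} [Fintype ι] {ν : ι → X → Measure S}
    (hν : ∀ i, Measurable (ν i)) [∀ i x, IsProbabilityMeasure (ν i x)] :
    Measurable fun x => Measure.pi fun i => ν i x := by
  refine Measurable.measure_of_isPiSystem_of_isProbabilityMeasure
    generateFrom_pi.symm isPiSystem_pi ?_
  rintro _ ⟨s, hs, rfl⟩
  simp only [Measure.pi_pi]
  exact Finset.measurable_fun_prod _ fun i _ =>
    (Measure.measurable_coe (hs i (Set.mem_univ i))).comp (hν i)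

instance isProbabilityMeasure_iidConfig (k : ℕ) (ν : Measure S) [IsProbabilityMeasure ν] :
    IsProbabilityMeasure (iidConfig k ν) :=
  Measure.isProbabilityMeasure_map (measurable_sigmaMk k).aemeasurable

theorem measurable_iidConfig (k : ℕ) {ν : X → Measure S} (hν : Measurable ν)
    [∀ x, IsProbabilityMeasure (ν x)] : Measurable fun x => iidConfig k (ν x) :=
  (Measure.measurable_map _ (measurable_sigmaMk k)).comp (measurable_measure_pi fun _ => hν)

theorem lintegral_pointSum_iidConfig (k : ℕ) (ν : Measure S) [IsProbabilityMeasure ν]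
    {g : S → ℝ≥0∞} (hg : Measurable g) :
    ∫⁻ c, pointSum g c ∂(iidConfig k ν) = k * ∫⁻ x, g x ∂ν := by
  rw [iidConfig, lintegral_map (measurable_pointSum hg) (measurable_sigmaMk k)]
  change ∫⁻ x : Fin k → S, ∑ i : Fin k, g (x i) ∂_ = _
  rw [lintegral_finsetSum _ fun i _ => by fun_prop]
  have h : ∀ i : Fin k, ∫⁻ x : Fin k → S, g (x i) ∂(Measure.pi fun _ => ν) = ∫⁻ x, g x ∂ν :=
    fun i => (measurePreserving_eval (fun _ : Fin k => ν) i).lintegral_comp hg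
  simp [h]

theorem lintegral_bind_nat (ρ : Measure ℕ) (σ : ℕ → Measure X) {g : X → ℝ≥0∞}
    (hg : Measurable g) :
    ∫⁻ x, g x ∂(ρ.bind σ) = ∫⁻ k, ∫⁻ x, g x ∂(σ k) ∂ρ :=
  Measure.lintegral_bind (Measurable.of_discrete).aemeasurable hg.aemeasurable

theorem lintegral_natCast_poissonMeasure (r : ℝ≥0) :
    ∫⁻ k, (k : ℝ≥0∞) ∂(poissonMeasure r) = r := by
  have hP : ∑' k, poissonMeasure r {k} = 1 := by
    have h := lintegral_countable' (μ := poissonMeasure r) fun _ => (1 : ℝ≥0∞)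
    simpa using h.symm
  rw [lintegral_countable', tsum_eq_zero_add' ENNReal.summable]
  have h : ∀ k : ℕ, ((k + 1 : ℕ) : ℝ≥0∞) * poissonMeasure r {k + 1} =
      r * poissonMeasure r {k} := by
    intro k
    rw [poissonMeasure_singleton, poissonMeasure_singleton, ← ENNReal.ofReal_natCast,
      ← ENNReal.ofReal_coe_nnreal, ← ENNReal.ofReal_mul (by positivity),
      ← ENNReal.ofReal_mul (by positivity)]
    congr 1
    push_cast [Nat.factorial_succ]
    field_simp
    ring
  simp only [h, ENNReal.tsum_mul_left, hP]
  simp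

/-- The normalization of the zero measure is the junk value zero, hence the alternative. -/
theorem normalize_eq_zero_or (ν : Measure S) [IsFiniteMeasure ν] :
    ν = 0 ∨ IsProbabilityMeasure (normalize ν) := by
  by_cases h : ν = 0
  · exact Or.inl h
  · refine Or.inr ⟨?_⟩
    rw [normalize, Measure.smul_apply, smul_eq_mul]
    exact ENNReal.inv_mul_cancel (by simpa using h) (measure_ne_top _ _)

theorem measure_univ_smul_normalize (ν : Measure S) [IsFiniteMeasure ν] :
    ν Set.univ • normalize ν = ν := by
  by_cases h : ν = 0
  · simp [h, normalize]
  · rw [normalize, smul_smul, ENNReal.mul_inv_cancel (by simpa using h) (measure_ne_top _ _),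
      one_smul]

/-- A Poisson variable with parameter zero vanishes. Hence a Poisson process of intensity zero has
no points, whatever the (junk) law of its points. -/
theorem poissonMeasure_zero_ae : ∀ᵐ k ∂(poissonMeasure 0), k = 0 := by
  have h := lintegral_natCast_poissonMeasure 0
  rw [ENNReal.coe_zero, lintegral_eq_zero_iff Measurable.of_discrete] at h
  filter_upwards [h] with k hk
  simpa using hk

instance isProbabilityMeasure_poissonConfig (ν : Measure S) [IsFiniteMeasure ν] :
    IsProbabilityMeasure (poissonConfig ν) := by
  refine ⟨?_⟩
  rw [← lintegral_one, poissonConfig, lintegral_bind_nat _ _ measurable_const]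
  rcases normalize_eq_zero_or ν with rfl | h
  · have : ∀ᵐ k ∂(poissonMeasure ((0 : Measure S) Set.univ).toNNReal),
        ∫⁻ _, 1 ∂(iidConfig k (normalize (0 : Measure S))) = 1 := by
      filter_upwards [show ∀ᵐ k ∂(poissonMeasure ((0 : Measure S) Set.univ).toNNReal), k = 0 by
        simpa using poissonMeasure_zero_ae] with k hk
      subst hk
      simp [iidConfig, Measure.map_apply (measurable_sigmaMk 0) MeasurableSet.univ]
    rw [lintegral_congr_ae this]
    simp
  · simp

theorem lintegral_pointSum_poissonConfig (ν : Measure S) [IsFiniteMeasure ν]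
    {g : S → ℝ≥0∞} (hg : Measurable g) :
    ∫⁻ c, pointSum g c ∂(poissonConfig ν) = ∫⁻ x, g x ∂ν := by
  rw [poissonConfig, lintegral_bind_nat _ _ (measurable_pointSum hg)]
  rcases normalize_eq_zero_or ν with rfl | h
  · rw [lintegral_zero_measure, lintegral_eq_zero_iff Measurable.of_discrete]
    filter_upwards [show ∀ᵐ k ∂(poissonMeasure ((0 : Measure S) Set.univ).toNNReal), k = 0 by
        simpa using poissonMeasure_zero_ae] with k hk
    subst hk
    rw [iidConfig, lintegral_map (measurable_pointSum hg) (measurable_sigmaMk 0)]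
    simp [pointSum]
  · simp only [lintegral_pointSum_iidConfig _ _ hg]
    rw [lintegral_mul_const _ Measurable.of_discrete, lintegral_natCast_poissonMeasure,
      ENNReal.coe_toNNReal (measure_ne_top _ _)]
    conv_rhs => rw [← measure_univ_smul_normalize ν]
    rw [lintegral_smul_measure, smul_eq_mul]

end PointProcesses

/-! ### The evolution equation of the intensity measures -/

namespace Model

variable {E : ℕ → Type u} [∀ n, MeasurableSpace (E n)] (𝓜 : Model E)

instance (n i : ℕ) : IsMarkovKernel (𝓜.offspring n i) := 𝓜.markov_offspring n i
instance (n : ℕ) : IsMarkovKernel (𝓜.M n) := 𝓜.markov_M n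
instance (n : ℕ) : IsFiniteMeasure (𝓜.μ n) := 𝓜.finite_μ n

theorem lintegral_descendants (n i : ℕ) (x : E n) {g : Config (E (n + 1)) → ℝ≥0∞}
    (hg : Measurable g) :
    ∫⁻ c, g c ∂(𝓜.descendants n i x) =
      ENNReal.ofReal (1 - 𝓜.e n x) * g (Config.empty _) +
        ENNReal.ofReal (𝓜.e n x) *
          ∑' j, (∫⁻ c, g c ∂(iidConfig j (𝓜.M n x))) * 𝓜.offspring n i x {j} := by
  rw [descendants, lintegral_add_measure, lintegral_smul_measure, lintegral_smul_measure,
    lintegral_dirac' _ hg, lintegral_bind_nat _ _ hg, lintegral_countable', smul_eq_mul,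
    smul_eq_mul]

instance isProbabilityMeasure_descendants (n i : ℕ) (x : E n) :
    IsProbabilityMeasure (𝓜.descendants n i x) := by
  refine ⟨?_⟩
  have h := 𝓜.lintegral_descendants n i x measurable_one
  simp only [Pi.one_apply, lintegral_one, measure_univ, mul_one, one_mul] at h
  have h1 := lintegral_countable' (μ := 𝓜.offspring n i x) fun _ => (1 : ℝ≥0∞)
  simp only [lintegral_one, measure_univ, one_mul] at h1
  rw [h, ← h1, mul_one, ← ENNReal.ofReal_add (by linarith [(𝓜.e_mem n x).2]) (𝓜.e_mem n x).1]
  simp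

theorem measurable_descendants (n i : ℕ) : Measurable (𝓜.descendants n i) := by
  refine Measure.measurable_of_measurable_coe _ fun s hs => ?_
  have h : ∀ x, 𝓜.descendants n i x s = _ := fun x => by
    rw [← lintegral_indicator_one hs, 𝓜.lintegral_descendants n i x (measurable_one.indicator hs)]
  simp only [h, lintegral_indicator_one hs]
  have he := 𝓜.measurable_e n
  refine ((measurable_const.sub he).ennreal_ofReal.mul_const _).add
    (he.ennreal_ofReal.mul (Measurable.tsum fun j => ?_))
  exact ((Measure.measurable_coe hs).comp (measurable_iidConfig j (𝓜.M n).measurable)).mul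
    (Kernel.measurable_coe _ (measurableSet_singleton j))

/-- The mean number of descendants of a target in state `x`, counted with the weight `g`: the two
factors `e n x` and `H n x` combine into `G n x`. -/
theorem lintegral_pointSum_descendants (n i : ℕ) (x : E n) {g : E (n + 1) → ℝ≥0∞}
    (hg : Measurable g) :
    ∫⁻ c, pointSum g c ∂(𝓜.descendants n i x) = ∫⁻ y, g y ∂(𝓜.Qstep n x) := by
  have hm := 𝓜.mean_offspring n i x
  rw [lintegral_countable'] at hm
  rw [𝓜.lintegral_descendants n i x (measurable_pointSum hg)]
  simp only [lintegral_pointSum_iidConfig _ _ hg, mul_right_comm _ _ (𝓜.offspring n i x _)]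
  rw [ENNReal.tsum_mul_right, hm, ← mul_assoc, ← ENNReal.ofReal_mul (𝓜.e_mem n x).1]
  have h0 : pointSum g (Config.empty _) = 0 := Finset.sum_empty
  simp [h0, Qstep, G]

instance isProbabilityMeasure_next (n : ℕ) (c : Config (E n)) :
    IsProbabilityMeasure (𝓜.next n c) := by
  unfold next; infer_instance

theorem measurable_next (n : ℕ) : Measurable (𝓜.next n) := by
  refine measurable_sigma_iff.2 fun k => ?_
  simp only [next]
  have h : Measurable fun x : Fin k → E n =>
      superposeAll fun i : Fin k => 𝓜.descendants n i (x i) :=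
    measurable_superposeAll (ρ := fun (i : Fin k) (x : Fin k → E n) => 𝓜.descendants n i (x i))
      fun i => (𝓜.measurable_descendants n i).comp (measurable_pi_apply i)
  exact measurable_superpose h measurable_const

theorem lintegral_pointSum_next (n : ℕ) (c : Config (E n)) {g : E (n + 1) → ℝ≥0∞}
    (hg : Measurable g) :
    ∫⁻ d, pointSum g d ∂(𝓜.next n c) =
      pointSum (fun x => ∫⁻ y, g y ∂(𝓜.Qstep n x)) c + ∫⁻ y, g y ∂(𝓜.μ (n + 1)) := by
  rw [next, lintegral_pointSum_superpose _ _ hg, lintegral_pointSum_superposeAll _ hg,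
    lintegral_pointSum_poissonConfig _ hg]
  simp only [𝓜.lintegral_pointSum_descendants _ _ _ hg]
  rfl

instance isProbabilityMeasure_law (n : ℕ) : IsProbabilityMeasure (𝓜.law n) := by
  induction n with
  | zero => unfold law; infer_instance
  | succ n ih =>
    refine ⟨?_⟩
    rw [law, ← lintegral_one, Measure.lintegral_bind (𝓜.measurable_next n).aemeasurable
      measurable_const.aemeasurable]
    simp

theorem γ_zero : 𝓜.γ 0 = 𝓜.μ 0 := by
  refine Measure.ext_of_lintegral _ fun g hg => ?_
  rw [γ, lintegral_intensity _ hg, law, lintegral_pointSum_poissonConfig _ hg]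

/-- The evolution equation of the intensity measures: a target in state `x` has on average
`G n x` offspring, distributed according to `M n x`. -/
theorem γ_succ (n : ℕ) : 𝓜.γ (n + 1) = (𝓜.γ n).bind (𝓜.Qstep n) + 𝓜.μ (n + 1) := by
  refine Measure.ext_of_lintegral _ fun g hg => ?_
  rw [γ, lintegral_intensity _ hg, law, Measure.lintegral_bind (𝓜.measurable_next n).aemeasurable
    (measurable_pointSum hg).aemeasurable]
  simp only [𝓜.lintegral_pointSum_next n _ hg]
  have hQ : Measurable fun x => ∫⁻ y, g y ∂(𝓜.Qstep n x) := hg.lintegral_kernel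
  rw [lintegral_add_right _ measurable_const, ← lintegral_intensity _ hQ, lintegral_add_measure,
    Measure.lintegral_bind (Kernel.measurable _).aemeasurable hg.aemeasurable]
  simp [γ]

end Model

/-! ### Moments of empirical means of conditionally independent variables -/

section MeanError

variable {S Z : Type*} [MeasurableSpace S] [MeasurableSpace Z] {N : ℕ}

theorem rpow_le_rpow_mul_exp {u r : ℝ} (hu : 0 ≤ u) (hr : 1 ≤ r) :
    u ^ r ≤ r ^ r * Real.exp u := by
  have hr0 : 0 < r := by linarith
  have h : u ≤ r * Real.exp (u / r) := by
    have h1 : u / r ≤ Real.exp (u / r) := by linarith [Real.add_one_le_exp (u / r)]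
    calc u = r * (u / r) := by field_simp
      _ ≤ _ := by gcongr
  calc u ^ r ≤ (r * Real.exp (u / r)) ^ r := by gcongr
    _ = r ^ r * Real.exp u := by
      rw [Real.mul_rpow hr0.le (Real.exp_pos _).le, ← Real.exp_mul, div_mul_cancel₀ _ hr0.ne']

/-- Hoeffding's lemma for sums of independent centred variables with values in `[-C, C]`. -/
theorem hasSubgaussianMGF_sum_pi (ν : Fin N → Measure S) [∀ i, IsProbabilityMeasure (ν i)]
    {g : S → ℝ} (hg : Measurable g) {C : ℝ} (hC : ∀ y, |g y| ≤ C) :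
    HasSubgaussianMGF (fun y : Fin N → S => ∑ i, (g (y i) - ∫ x, g x ∂(ν i)))
      (N * (‖C‖₊ ^ 2)) (Measure.pi ν) := by
  have hsub : ∀ i, HasSubgaussianMGF (fun x => g x - ∫ x, g x ∂(ν i)) (‖C‖₊ ^ 2) (ν i) := by
    intro i
    have h := hasSubgaussianMGF_of_mem_Icc (μ := ν i) (a := -C) (b := C) hg.aemeasurable
      (Filter.Eventually.of_forall fun y => abs_le.1 (hC y))
    convert h using 2
    rw [sub_neg_eq_add, ← two_mul, nnnorm_mul]
    simp
  have hind : iIndepFun (fun i (y : Fin N → S) => g (y i) - ∫ x, g x ∂(ν i)) (Measure.pi ν) :=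
    iIndepFun_pi (X := fun i x => g x - ∫ x, g x ∂(ν i)) fun i => by fun_prop
  have h := HasSubgaussianMGF.sum_of_iIndepFun hind (c := fun _ => ‖C‖₊ ^ 2) (s := Finset.univ)
    fun i _ => by
      have hmap := (measurePreserving_eval ν i).map_eq
      have h1 : HasSubgaussianMGF (fun x => g x - ∫ x, g x ∂(ν i)) (‖C‖₊ ^ 2)
          ((Measure.pi ν).map (Function.eval i)) := by rw [hmap]; exact hsub i
      exact HasSubgaussianMGF.of_map (measurePreserving_eval ν i).aemeasurable h1
  simpa using h

/-- The `r`-th moment of the empirical mean of `N` independent centred variables bounded by `C`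
has the order `(C / √N) ^ r`: a consequence of Hoeffding's bound for the exponential moments. -/
theorem lintegral_rpow_mean_pi_le (hN : 1 ≤ N) (ν : Fin N → Measure S)
    [∀ i, IsProbabilityMeasure (ν i)] {g : S → ℝ} (hg : Measurable g) {C : ℝ} (hC0 : 0 ≤ C)
    (hC : ∀ y, |g y| ≤ C) {r : ℝ} (hr : 1 ≤ r) :
    ∫⁻ y, ENNReal.ofReal (|(N : ℝ)⁻¹ * ∑ i, (g (y i) - ∫ x, g x ∂(ν i))| ^ r) ∂(Measure.pi ν) ≤
      ENNReal.ofReal ((4 * r * C / √N) ^ r) := by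
  have hN0 : (0 : ℝ) < N := by exact_mod_cast hN
  have hsN : 0 < √(N : ℝ) := Real.sqrt_pos.2 hN0
  have hr0 : 0 < r := by linarith
  rcases hC0.eq_or_lt with rfl | hCpos
  · have hz : ∀ y, g y = 0 := fun y => abs_nonpos_iff.1 (hC y)
    simp [hz, Real.zero_rpow hr0.ne']
  set Y : (Fin N → S) → ℝ := fun y => ∑ i, (g (y i) - ∫ x, g x ∂(ν i)) with hY
  have hsub : HasSubgaussianMGF Y (N * (‖C‖₊ ^ 2)) (Measure.pi ν) :=
    hasSubgaussianMGF_sum_pi ν hg hC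
  -- At this scale, both exponential moments of the sum are at most `exp (1 / 2)`.
  set t : ℝ := (C * √N)⁻¹ with ht
  have ht0 : 0 < t := by positivity
  have hmgf : ∀ s : ℝ, s ^ 2 = t ^ 2 →
      ∫ y, Real.exp (s * Y y) ∂(Measure.pi ν) ≤ Real.exp (1 / 2) := by
    intro s hs
    refine (hsub.mgf_le s).trans (Real.exp_le_exp.2 (le_of_eq ?_))
    rw [hs, ht]
    push_cast
    rw [Real.norm_of_nonneg hC0, inv_pow, mul_pow, Real.sq_sqrt hN0.le]
    field_simp
  have hint : Integrable (fun y => r ^ r * (Real.exp (t * Y y) + Real.exp (-t * Y y)))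
      (Measure.pi ν) :=
    ((hsub.integrable_exp_mul t).add (hsub.integrable_exp_mul (-t))).const_mul _
  have hexp : 2 * Real.exp (1 / 2) ≤ 4 := by
    have h1 : Real.exp (1 / 2) ^ 2 < 4 := by
      rw [← Real.exp_nat_mul]
      norm_num
      linarith [Real.exp_one_lt_d9]
    nlinarith [Real.exp_pos (1 / 2)]
  calc ∫⁻ y, ENNReal.ofReal (|(N : ℝ)⁻¹ * Y y| ^ r) ∂(Measure.pi ν)
      ≤ ∫⁻ y, ENNReal.ofReal (C / √N) ^ r *
          ENNReal.ofReal (r ^ r * (Real.exp (t * Y y) + Real.exp (-t * Y y))) ∂(Measure.pi ν) := by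
        refine lintegral_mono fun y => ?_
        rw [ENNReal.ofReal_rpow_of_nonneg (by positivity) hr0.le, ← ENNReal.ofReal_mul
          (by positivity)]
        refine ENNReal.ofReal_le_ofReal ?_
        have he : |(N : ℝ)⁻¹ * Y y| = C / √N * |t * Y y| := by
          rw [abs_mul, abs_mul, abs_of_pos ht0, abs_of_pos (by positivity : (0 : ℝ) < (N : ℝ)⁻¹),
            ht]
          field_simp
          rw [Real.sq_sqrt hN0.le, mul_comm]
        rw [he, Real.mul_rpow (by positivity) (abs_nonneg _)]
        gcongr
        refine (rpow_le_rpow_mul_exp (abs_nonneg _) hr).trans ?_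
        gcongr
        rw [neg_mul]
        exact Real.exp_abs_le _
    _ = ENNReal.ofReal (C / √N) ^ r *
          ENNReal.ofReal (∫ y, r ^ r * (Real.exp (t * Y y) + Real.exp (-t * Y y))
            ∂(Measure.pi ν)) := by
        rw [lintegral_const_mul _ (by fun_prop), ofReal_integral_eq_lintegral_ofReal hint
          (Filter.Eventually.of_forall fun y => by positivity)]
    _ ≤ ENNReal.ofReal (C / √N) ^ r * ENNReal.ofReal ((4 * r) ^ r) := by
        gcongr
        rw [integral_const_mul, integral_add (hsub.integrable_exp_mul t)
          (hsub.integrable_exp_mul (-t)), Real.mul_rpow (by norm_num) hr0.le, mul_comm]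
        gcongr
        calc _ ≤ Real.exp (1 / 2) + Real.exp (1 / 2) :=
              add_le_add (hmgf t rfl) (hmgf (-t) (by ring))
          _ ≤ 4 ^ (1 : ℝ) := by rw [Real.rpow_one]; linarith
          _ ≤ _ := Real.rpow_le_rpow_of_exponent_le (by norm_num) hr
    _ = _ := by
        rw [ENNReal.ofReal_rpow_of_nonneg (by positivity) hr0.le, ← ENNReal.ofReal_mul
          (by positivity), ← Real.mul_rpow (by positivity) (by positivity)]
        congr 2
        ring

/-- The kernel `z ↦ κ₁(z, ·) ⊗ ⋯ ⊗ κ_N(z, ·)` of `N` variables which are independent given `z`. -/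
def piKernel (κ : Fin N → Kernel Z S) [∀ i, IsMarkovKernel (κ i)] : Kernel Z (Fin N → S) where
  toFun z := Measure.pi fun i => κ i z
  measurable' := measurable_measure_pi fun i => (κ i).measurable

variable {Ω : Type*} [MeasurableSpace Ω] {Pr : Measure Ω} [IsProbabilityMeasure Pr]
  {z : Ω → Z} {ξ : Ω → Fin N → S} {κ : Fin N → Kernel Z S} [∀ i, IsMarkovKernel (κ i)]

instance : IsMarkovKernel (piKernel κ) :=
  ⟨fun z => by
    change IsProbabilityMeasure (Measure.pi fun i => κ i z)
    infer_instance⟩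

/-- Given `z`, the variables `ξ i` are independent with respective laws `κ i z`. -/
structure HasCondLaw (Pr : Measure Ω) (z : Ω → Z) (ξ : Ω → Fin N → S)
    (κ : Fin N → Kernel Z S) [∀ i, IsMarkovKernel (κ i)] : Prop where
  measurable_fst : Measurable z
  measurable_snd : Measurable ξ
  map_eq : Pr.map (fun ω => (z ω, ξ ω)) = (Pr.map z) ⊗ₘ (piKernel κ)

theorem HasCondLaw.lintegral_eq (h : HasCondLaw Pr z ξ κ) {F : Z × (Fin N → S) → ℝ≥0∞}
    (hF : Measurable F) :
    ∫⁻ ω, F (z ω, ξ ω) ∂Pr = ∫⁻ ω, ∫⁻ y, F (z ω, y) ∂(Measure.pi fun i => κ i (z ω)) ∂Pr := by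
  have h1 := h.measurable_fst
  have h2 := h.measurable_snd
  rw [← lintegral_map (μ := Pr) (f := F) (g := fun ω => (z ω, ξ ω)) hF (by fun_prop), h.map_eq,
    Measure.lintegral_compProd hF, lintegral_map (Measurable.lintegral_kernel_prod_right' hF) h1]
  rfl

/-- The conditional form of `lintegral_rpow_mean_pi_le`, for a random bounded function `g (z, ·)`
and a random weight `W z`. -/
theorem HasCondLaw.lintegral_rpow_mean_le (h : HasCondLaw Pr z ξ κ) (hN : 1 ≤ N) {g : Z × S → ℝ}
    (hg : Measurable g) {C : ℝ} (hC0 : 0 ≤ C) (hC : ∀ ω y, |g (z ω, y)| ≤ C) {r : ℝ}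
    (hr : 1 ≤ r) {W : Z → ℝ≥0∞} (hW : Measurable W) :
    ∫⁻ ω, W (z ω) * ENNReal.ofReal (|(N : ℝ)⁻¹ * ∑ i, (g (z ω, ξ ω i) -
      ∫ x, g (z ω, x) ∂(κ i (z ω)))| ^ r) ∂Pr ≤
      ENNReal.ofReal ((4 * r * C / √N) ^ r) * ∫⁻ ω, W (z ω) ∂Pr := by
  have hm : ∀ i, Measurable fun z => ∫ x, g (z, x) ∂(κ i z) := fun i =>
    (StronglyMeasurable.integral_kernel_prod_right' hg.stronglyMeasurable).measurable
  have hmean : ∀ ω, Measurable fun y : Fin N → S => |(N : ℝ)⁻¹ * ∑ i, (g (z ω, y i) -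
      ∫ x, g (z ω, x) ∂(κ i (z ω)))| ^ r := fun ω => by fun_prop
  have hF : Measurable fun p : Z × (Fin N → S) => W p.1 *
      ENNReal.ofReal (|(N : ℝ)⁻¹ * ∑ i, (g (p.1, p.2 i) - ∫ x, g (p.1, x) ∂(κ i p.1))| ^ r) := by
    have h1 : ∀ i, Measurable fun p : Z × (Fin N → S) => ∫ x, g (p.1, x) ∂(κ i p.1) :=
      fun i => (hm i).comp _root_.measurable_fst
    have h2 : ∀ i, Measurable fun p : Z × (Fin N → S) => g (p.1, p.2 i) := fun i => by fun_prop
    exact (hW.comp _root_.measurable_fst).mul (((Finset.measurable_fun_sum _ fun i _ =>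
      (h2 i).sub (h1 i)).const_mul _).abs.pow_const r).ennreal_ofReal
  rw [h.lintegral_eq hF, ← lintegral_const_mul _ (show Measurable fun ω => W (z ω) from
    hW.comp h.measurable_fst)]
  refine lintegral_mono fun ω => ?_
  simp only
  rw [lintegral_const_mul _ (hmean ω).ennreal_ofReal, mul_comm]
  gcongr
  exact lintegral_rpow_mean_pi_le hN (fun i => κ i (z ω)) (by fun_prop : Measurable fun x =>
    g (z ω, x)) hC0 (hC ω) hr

theorem HasCondLaw.integral_eq (h : HasCondLaw Pr z ξ κ) {g : Z × S → ℝ}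
    (hg : Measurable g) {C : ℝ} (hC : ∀ ω y, |g (z ω, y)| ≤ C) (i : Fin N) :
    ∫ ω, g (z ω, ξ ω i) ∂Pr = ∫ ω, ∫ x, g (z ω, x) ∂(κ i (z ω)) ∂Pr := by
  have h1 := h.measurable_fst
  have h2 := h.measurable_snd
  have hF : Measurable fun p : Z × (Fin N → S) => g (p.1, p.2 i) := by fun_prop
  have hint : Integrable (fun p : Z × (Fin N → S) => g (p.1, p.2 i))
      (Pr.map fun ω => (z ω, ξ ω)) := by
    refine (integrable_map_measure hF.aestronglyMeasurable (by fun_prop)).2 ?_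
    exact Integrable.of_bound (hF.comp (h1.prodMk h2)).aestronglyMeasurable C
      (Filter.Eventually.of_forall fun ω => hC ω _)
  have hm : StronglyMeasurable fun z => ∫ y, g (z, y i) ∂(piKernel κ z) :=
    StronglyMeasurable.integral_kernel_prod_right' hF.stronglyMeasurable
  have h3 := integral_map (μ := Pr) (φ := fun ω => (z ω, ξ ω)) (by fun_prop)
    hF.aestronglyMeasurable
  rw [← h3, h.map_eq, Measure.integral_compProd (by rwa [← h.map_eq]),
    integral_map h1.aemeasurable hm.aestronglyMeasurable]
  refine integral_congr_ae (Filter.Eventually.of_forall fun ω => ?_)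
  have hgω : Measurable fun x => g (z ω, x) := by fun_prop
  have hmap := (measurePreserving_eval (fun i => κ i (z ω)) i).map_eq
  change _ = ∫ x, g (z ω, x) ∂(κ i (z ω))
  rw [← hmap, integral_map (measurable_pi_apply i).aemeasurable hgω.aestronglyMeasurable]
  rfl

end MeanError

/-! ### Integrals of bounded measurable functions -/

section BoundedMeasurable

variable {S X : Type*} [MeasurableSpace S] [MeasurableSpace X]

/-- Bounded measurable functions. -/
def IsBddMeas (f : S → ℝ) : Prop := Measurable f ∧ ∃ C, ∀ x, |f x| ≤ C

theorem IsBddMeas.integrable {f : S → ℝ} (hf : IsBddMeas f) (ν : Measure S)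
    [IsFiniteMeasure ν] : Integrable f ν :=
  let ⟨C, hC⟩ := hf.2
  Integrable.of_bound hf.1.aestronglyMeasurable C (Filter.Eventually.of_forall hC)

theorem isBddMeas_const (a : ℝ) : IsBddMeas fun _ : S => a :=
  ⟨measurable_const, |a|, fun _ => le_rfl⟩

theorem IsBddMeas.sub {f g : S → ℝ} (hf : IsBddMeas f) (hg : IsBddMeas g) :
    IsBddMeas fun x => f x - g x := by
  obtain ⟨hf, C, hC⟩ := hf
  obtain ⟨hg, D, hD⟩ := hg
  exact ⟨hf.sub hg, C + D, fun x => (abs_sub _ _).trans (add_le_add (hC x) (hD x))⟩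

theorem IsBddMeas.mul {f g : S → ℝ} (hf : IsBddMeas f) (hg : IsBddMeas g) :
    IsBddMeas fun x => f x * g x := by
  obtain ⟨hf, C, hC⟩ := hf
  obtain ⟨hg, D, hD⟩ := hg
  refine ⟨hf.mul hg, C * D, fun x => ?_⟩
  rw [abs_mul]
  exact mul_le_mul (hC x) (hD x) (abs_nonneg _) ((abs_nonneg _).trans (hC x))

theorem IsOscOne.isBddMeas {f : S → ℝ} (hf : IsOscOne f) : IsBddMeas f := by
  refine ⟨hf.1, ?_⟩
  rcases isEmpty_or_nonempty S with h | ⟨⟨x₀⟩⟩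
  · exact ⟨0, fun x => (h.false x).elim⟩
  · refine ⟨1 + |f x₀|, fun x => ?_⟩
    calc |f x| = |f x - f x₀ + f x₀| := by ring_nf
      _ ≤ |f x - f x₀| + |f x₀| := abs_add_le _ _
      _ ≤ _ := by linarith [hf.2 x x₀]

theorem IsBddMeas.integral_kernel {f : S → ℝ} (hf : IsBddMeas f) (κ : Kernel X S)
    [IsFiniteKernel κ] : IsBddMeas fun x => ∫ y, f y ∂(κ x) := by
  obtain ⟨hf, C, hC⟩ := hf
  refine ⟨(StronglyMeasurable.integral_kernel hf.stronglyMeasurable).measurable,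
    |C| * κ.bound.toReal, fun x => ?_⟩
  have h := norm_integral_le_of_norm_le_const (μ := κ x) (f := f) (C := |C|)
    (Filter.Eventually.of_forall fun y => (hC y).trans (le_abs_self C))
  rw [Real.norm_eq_abs] at h
  refine h.trans ?_
  gcongr
  exact ENNReal.toReal_mono κ.bound_lt_top.ne (κ.measure_le_bound x _)

theorem IsBddMeas.integral_bind {f : S → ℝ} (hf : IsBddMeas f) (ν : Measure X)
    [IsFiniteMeasure ν] (κ : Kernel X S) [IsFiniteKernel κ] :
    ∫ y, f y ∂(ν.bind κ) = ∫ x, ∫ y, f y ∂(κ x) ∂ν := by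
  have : IsFiniteMeasure (κ ∘ₘ ν) := inferInstance
  have h := hf.integrable (κ ∘ₘ ν)
  rw [Measure.comp_eq_comp_const_apply] at h ⊢
  simpa using Kernel.integral_comp h

end BoundedMeasurable

namespace Model

variable {E : ℕ → Type u} [∀ n, MeasurableSpace (E n)] (𝓜 : Model E)

/-! ### Bounds of the potential functions -/

/-- The supremum and infimum over a state space are meaningful: `μ 0 ≠ 0` forces `E 0` to be
nonempty, and the Markov transitions propagate this to all times. -/
theorem nonempty (𝓜 : Model E) (n : ℕ) : Nonempty (E n) := by
  induction n with
  | zero =>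
    by_contra h
    rw [not_nonempty_iff] at h
    exact 𝓜.μ_zero_ne (Measure.eq_zero_of_isEmpty _)
  | succ n ih => exact ih.elim fun x => nonempty_of_isProbabilityMeasure (𝓜.M n x)

theorem G_pos (n : ℕ) (x : E n) : 0 < 𝓜.G n x := by
  obtain ⟨a, b, ha, h⟩ := 𝓜.bounds_G n
  exact ha.trans_le (h x).1

theorem isBddMeas_G (n : ℕ) : IsBddMeas (𝓜.G n) := by
  obtain ⟨a, b, ha, h⟩ := 𝓜.bounds_G n
  exact ⟨𝓜.measurable_G n, b, fun x => (abs_of_pos (𝓜.G_pos n x)).trans_le (h x).2⟩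

theorem bddAbove_G (n : ℕ) : BddAbove (Set.range (𝓜.G n)) := by
  obtain ⟨a, b, ha, h⟩ := 𝓜.bounds_G n
  exact ⟨b, Set.forall_mem_range.2 fun x => (h x).2⟩

theorem bddBelow_G (n : ℕ) : BddBelow (Set.range (𝓜.G n)) :=
  ⟨0, Set.forall_mem_range.2 fun x => (𝓜.G_pos n x).le⟩

theorem iInf_G_pos (n : ℕ) : 0 < ⨅ x, 𝓜.G n x := by
  obtain ⟨a, b, ha, h⟩ := 𝓜.bounds_G n
  have := 𝓜.nonempty n
  exact ha.trans_le (le_ciInf fun x => (h x).1)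

theorem Qstep_apply (n : ℕ) (x : E n) :
    𝓜.Qstep n x = ENNReal.ofReal (𝓜.G n x) • 𝓜.M n x := rfl

instance (n : ℕ) : IsFiniteKernel (𝓜.Qstep n) := by
  obtain ⟨a, b, ha, h⟩ := 𝓜.bounds_G n
  refine ⟨⟨ENNReal.ofReal b, ENNReal.ofReal_lt_top, fun x => ?_⟩⟩
  rw [Qstep_apply, Measure.smul_apply, measure_univ, smul_eq_mul, mul_one]
  exact ENNReal.ofReal_le_ofReal (h x).2

theorem integral_Qstep (n : ℕ) (x : E n) (f : E (n + 1) → ℝ) :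
    ∫ y, f y ∂(𝓜.Qstep n x) = 𝓜.G n x * ∫ y, f y ∂(𝓜.M n x) := by
  rw [Qstep_apply, integral_smul_measure, ENNReal.toReal_ofReal (𝓜.G_pos n x).le, smul_eq_mul]

/-! ### The semigroup with two time indices -/

/-- The identity kernel between state spaces with equal time indices. -/
def idKernel {p n : ℕ} (h : p = n) : Kernel (E p) (E n) := h ▸ Kernel.id

/-- The semigroup `Q_{p,n}`, indexed by the initial and by the terminal time; it is zero when
`n < p`. -/
def T (p : ℕ) : ∀ n, Kernel (E p) (E n)
  | 0 => if h : p = 0 then idKernel h else 0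
  | n + 1 => if h : p = n + 1 then idKernel h else 𝓜.Qstep n ∘ₖ T p n

theorem T_self (p : ℕ) : 𝓜.T p p = Kernel.id := by
  cases p <;> exact dif_pos rfl

theorem T_succ {p n : ℕ} (h : p ≤ n) : 𝓜.T p (n + 1) = 𝓜.Qstep n ∘ₖ 𝓜.T p n :=
  dif_neg (by omega)

theorem T_add (p k : ℕ) : 𝓜.T p (p + k) = 𝓜.Q p k := by
  induction k with
  | zero => exact 𝓜.T_self p
  | succ k ih => exact (𝓜.T_succ (Nat.le_add_right p k)).trans (by rw [ih]; rfl)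

instance isFiniteKernel_T (p n : ℕ) : IsFiniteKernel (𝓜.T p n) := by
  induction n with
  | zero =>
    rcases eq_or_ne p 0 with rfl | h
    · rw [T_self]; infer_instance
    · rw [T, dif_neg h]; infer_instance
  | succ n ih =>
    rcases eq_or_ne p (n + 1) with rfl | h
    · rw [T_self]; infer_instance
    · rw [T, dif_neg h]; infer_instance

theorem T_comp {p q n : ℕ} (hpq : p ≤ q) (hqn : q ≤ n) :
    𝓜.T p n = 𝓜.T q n ∘ₖ 𝓜.T p q := by
  induction n, hqn using Nat.le_induction with
  | base => rw [T_self, Kernel.id_comp]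
  | succ n hqn ih => rw [T_succ _ (hpq.trans hqn), T_succ _ hqn, ih, Kernel.comp_assoc]

theorem T_eq_comp_Qstep {p n : ℕ} (h : p < n) : 𝓜.T p n = 𝓜.T (p + 1) n ∘ₖ 𝓜.Qstep p := by
  rw [𝓜.T_comp (Nat.le_succ p) h, T_succ _ le_rfl, T_self, Kernel.comp_id]

/-- The function `Q_{p,n}(f)`. -/
def act (p n : ℕ) (f : E n → ℝ) (x : E p) : ℝ := ∫ y, f y ∂(𝓜.T p n x)

/-- The function `Q_{p,n}(1)`. -/
def tot (p n : ℕ) (x : E p) : ℝ := (𝓜.T p n x).real Set.univ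

theorem act_one (p n : ℕ) : 𝓜.act p n (fun _ => 1) = 𝓜.tot p n := by
  ext x; simp [act, tot]

theorem isBddMeas_act (p n : ℕ) {f : E n → ℝ} (hf : IsBddMeas f) : IsBddMeas (𝓜.act p n f) :=
  hf.integral_kernel (𝓜.T p n)

theorem isBddMeas_tot (p n : ℕ) : IsBddMeas (𝓜.tot p n) := by
  rw [← act_one]; exact 𝓜.isBddMeas_act p n (isBddMeas_const 1)

theorem act_self (n : ℕ) {f : E n → ℝ} (hf : IsBddMeas f) : 𝓜.act n n f = f := by
  ext x
  rw [act, T_self, Kernel.id_apply, integral_dirac' _ _ hf.1.stronglyMeasurable]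

theorem tot_self (n : ℕ) (x : E n) : 𝓜.tot n n x = 1 := by
  simp [tot, T_self, Kernel.id_apply]

theorem act_comp {p q n : ℕ} (hpq : p ≤ q) (hqn : q ≤ n) {f : E n → ℝ} (hf : IsBddMeas f) :
    𝓜.act p n f = 𝓜.act p q (𝓜.act q n f) := by
  ext x
  rw [act, 𝓜.T_comp hpq hqn]
  exact Kernel.integral_comp (hf.integrable _)

theorem tot_comp {p q n : ℕ} (hpq : p ≤ q) (hqn : q ≤ n) :
    𝓜.tot p n = 𝓜.act p q (𝓜.tot q n) := by
  rw [← act_one, ← act_one, 𝓜.act_comp hpq hqn (isBddMeas_const 1)]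

theorem act_succ {p n : ℕ} (h : p ≤ n) {f : E (n + 1) → ℝ} (hf : IsBddMeas f) :
    𝓜.act p (n + 1) f = 𝓜.act p n fun x => 𝓜.G n x * ∫ y, f y ∂(𝓜.M n x) := by
  rw [𝓜.act_comp h (Nat.le_succ n) hf]
  congr 1
  ext x
  rw [act, T_succ _ le_rfl, T_self, Kernel.comp_id, integral_Qstep]

theorem tot_succ {p n : ℕ} (h : p ≤ n) : 𝓜.tot p (n + 1) = 𝓜.act p n (𝓜.G n) := by
  rw [← act_one, 𝓜.act_succ h (isBddMeas_const 1)]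
  simp

theorem act_mono (p n : ℕ) {f g : E n → ℝ} (hf : IsBddMeas f) (hg : IsBddMeas g)
    (h : ∀ x, f x ≤ g x) (x : E p) : 𝓜.act p n f x ≤ 𝓜.act p n g x :=
  integral_mono (hf.integrable _) (hg.integrable _) h

theorem act_const_mul (p n : ℕ) (a : ℝ) (f : E n → ℝ) (x : E p) :
    𝓜.act p n (fun y => a * f y) x = a * 𝓜.act p n f x :=
  integral_const_mul _ _

theorem act_sub (p n : ℕ) {f g : E n → ℝ} (hf : IsBddMeas f) (hg : IsBddMeas g) (x : E p) :
    𝓜.act p n (fun y => f y - g y) x = 𝓜.act p n f x - 𝓜.act p n g x :=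
  integral_sub (hf.integrable _) (hg.integrable _)

theorem abs_act_le (p n : ℕ) {f g : E n → ℝ} (hg : IsBddMeas g)
    (h : ∀ x, |f x| ≤ g x) (x : E p) : |𝓜.act p n f x| ≤ 𝓜.act p n g x :=
  norm_integral_le_of_norm_le (f := f) (hg.integrable (𝓜.T p n x)) (Filter.Eventually.of_forall h)

theorem act_const (p n : ℕ) (a : ℝ) (x : E p) :
    𝓜.act p n (fun _ => a) x = a * 𝓜.tot p n x := by
  simp [act, tot, mul_comm]

theorem exists_tot_bounds {p n : ℕ} (h : p ≤ n) :
    ∃ a b : ℝ, 0 < a ∧ ∀ x, a ≤ 𝓜.tot p n x ∧ 𝓜.tot p n x ≤ b := by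
  induction n, h using Nat.le_induction with
  | base => exact ⟨1, 1, one_pos, fun x => by simp [tot_self]⟩
  | succ n h ih =>
    obtain ⟨a, b, ha, hab⟩ := ih
    obtain ⟨a', b', ha', hab'⟩ := 𝓜.bounds_G n
    have hb' : 0 ≤ b' := by
      obtain ⟨x⟩ := 𝓜.nonempty n
      linarith [hab' x]
    refine ⟨a' * a, b' * b, by positivity, fun x => ?_⟩
    rw [𝓜.tot_succ h]
    constructor
    · calc a' * a ≤ a' * 𝓜.tot p n x := by gcongr; exact (hab x).1
        _ = 𝓜.act p n (fun _ => a') x := (𝓜.act_const p n a' x).symm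
        _ ≤ _ := 𝓜.act_mono p n (isBddMeas_const _) (𝓜.isBddMeas_G n) (fun y => (hab' y).1) x
    · calc _ ≤ 𝓜.act p n (fun _ => b') x :=
            𝓜.act_mono p n (𝓜.isBddMeas_G n) (isBddMeas_const _) (fun y => (hab' y).2) x
        _ = b' * 𝓜.tot p n x := 𝓜.act_const p n b' x
        _ ≤ _ := by gcongr; exact (hab x).2

theorem tot_pos {p n : ℕ} (h : p ≤ n) (x : E p) : 0 < 𝓜.tot p n x :=
  let ⟨_, _, ha, hab⟩ := 𝓜.exists_tot_bounds h
  ha.trans_le (hab x).1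

/-- The infimum of the function `Q_{p,n}(1)`. -/
def lowQ (p n : ℕ) : ℝ := ⨅ x, 𝓜.tot p n x

theorem lowQ_pos {p n : ℕ} (h : p ≤ n) : 0 < 𝓜.lowQ p n := by
  obtain ⟨a, b, ha, hab⟩ := 𝓜.exists_tot_bounds h
  have := 𝓜.nonempty p
  exact ha.trans_le (le_ciInf fun x => (hab x).1)

theorem lowQ_le {p n : ℕ} (x : E p) : 𝓜.lowQ p n ≤ 𝓜.tot p n x :=
  ciInf_le ⟨0, Set.forall_mem_range.2 fun _ => measureReal_nonneg⟩ x

theorem Qone_add (p k : ℕ) : 𝓜.Qone p k = 𝓜.tot p (p + k) := by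
  ext x; rw [tot, T_add, Qone]

theorem Qone_sub {p n : ℕ} (h : p ≤ n) : 𝓜.Qone p (n - p) = 𝓜.tot p n := by
  obtain ⟨k, rfl⟩ := Nat.exists_eq_add_of_le h
  rw [Nat.add_sub_cancel_left, Qone_add]

theorem normQ_eq {p n : ℕ} (h : p ≤ n) : 𝓜.normQ p n = ⨆ x, 𝓜.tot p n x := by
  rw [normQ, 𝓜.Qone_sub h]

theorem tot_le_normQ {p n : ℕ} (h : p ≤ n) (x : E p) : 𝓜.tot p n x ≤ 𝓜.normQ p n := by
  rw [𝓜.normQ_eq h]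
  obtain ⟨a, b, ha, hab⟩ := 𝓜.exists_tot_bounds h
  exact le_ciSup (f := 𝓜.tot p n) ⟨b, Set.forall_mem_range.2 fun x => (hab x).2⟩ x

theorem normQ_pos {p n : ℕ} (h : p ≤ n) : 0 < 𝓜.normQ p n :=
  (𝓜.nonempty p).elim fun x => (𝓜.tot_pos h x).trans_le (𝓜.tot_le_normQ h x)

theorem c_eq {p n : ℕ} (h : p ≤ n) : 𝓜.c p n = ∫ x, 𝓜.tot p n x ∂(𝓜.μ p) := by
  rw [c, 𝓜.Qone_sub h]

theorem c_nonneg {p n : ℕ} (h : p ≤ n) : 0 ≤ 𝓜.c p n := by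
  rw [𝓜.c_eq h]; exact integral_nonneg fun x => (𝓜.tot_pos h x).le

/-! ### The evolution of the total masses -/

theorem isFiniteMeasure_γ (n : ℕ) : IsFiniteMeasure (𝓜.γ n) := by
  induction n with
  | zero => rw [γ_zero]; infer_instance
  | succ n ih =>
    rw [γ_succ]
    have : IsFiniteMeasure (𝓜.Qstep n ∘ₘ 𝓜.γ n) := inferInstance
    infer_instance

instance (n : ℕ) : IsFiniteMeasure (𝓜.γ n) := 𝓜.isFiniteMeasure_γ n

/-- One step of the evolution of the intensity measures, tested against a bounded function. -/
theorem integral_bind_Qstep_add (n : ℕ) (γ : Measure (E n)) [IsFiniteMeasure γ]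
    {f : E (n + 1) → ℝ} (hf : IsBddMeas f) :
    ∫ y, f y ∂(γ.bind (𝓜.Qstep n) + 𝓜.μ (n + 1)) =
      ∫ x, 𝓜.G n x * ∫ y, f y ∂(𝓜.M n x) ∂γ + ∫ y, f y ∂(𝓜.μ (n + 1)) := by
  have : IsFiniteMeasure (𝓜.Qstep n ∘ₘ γ) := inferInstance
  rw [integral_add_measure (hf.integrable _) (hf.integrable _), hf.integral_bind]
  simp only [integral_Qstep]

theorem mass_zero : 𝓜.mass 0 = (𝓜.μ 0).real Set.univ := by rw [mass, γ_zero]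

theorem mass_succ (n : ℕ) :
    𝓜.mass (n + 1) = ∫ x, 𝓜.G n x ∂(𝓜.γ n) + (𝓜.μ (n + 1)).real Set.univ := by
  have h := 𝓜.integral_bind_Qstep_add n (𝓜.γ n) (isBddMeas_const 1)
  rw [← γ_succ] at h
  simpa [mass] using h

theorem mu_zero_real_pos : 0 < (𝓜.μ 0).real Set.univ := by
  have := 𝓜.μ_zero_ne
  rw [measureReal_def, ENNReal.toReal_pos_iff]
  exact ⟨by simpa [pos_iff_ne_zero] using this, measure_lt_top _ _⟩

/-- A supersolution of the recursion `m (p + 1) = g * m p + μ_{p+1}(1)` dominates the solution,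
which is `∑ μ_p(1) g ^ (n - p)`. -/
theorem gSum_le_of_recursion {m : ℕ → ℝ} {n : ℕ} {g : ℝ} (hg : 0 ≤ g)
    (h0 : (𝓜.μ 0).real Set.univ ≤ m 0)
    (h : ∀ p < n, g * m p + (𝓜.μ (p + 1)).real Set.univ ≤ m (p + 1)) :
    ∑ p ∈ Finset.range (n + 1), (𝓜.μ p).real Set.univ * g ^ (n - p) ≤ m n := by
  induction n with
  | zero => simpa using h0
  | succ n ih =>
    have ih := ih fun p hp => h p (by omega)
    rw [Finset.sum_range_succ]
    have h1 : ∑ p ∈ Finset.range (n + 1), (𝓜.μ p).real Set.univ * g ^ (n + 1 - p) =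
        g * ∑ p ∈ Finset.range (n + 1), (𝓜.μ p).real Set.univ * g ^ (n - p) := by
      rw [Finset.mul_sum]
      refine Finset.sum_congr rfl fun p hp => ?_
      rw [Nat.sub_add_comm (Finset.mem_range_succ_iff.1 hp), pow_succ]
      ring
    rw [h1]
    have := mul_le_mul_of_nonneg_left ih hg
    simp only [Nat.sub_self, pow_zero, mul_one]
    linarith [h n (Nat.lt_succ_self n)]

/-- A subsolution of the recursion `m (p + 1) = g * m p + μ_{p+1}(1)` is dominated by the solution.
-/
theorem le_gSum_of_recursion {m : ℕ → ℝ} {n : ℕ} {g : ℝ} (hg : 0 ≤ g)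
    (h0 : m 0 ≤ (𝓜.μ 0).real Set.univ)
    (h : ∀ p < n, m (p + 1) ≤ g * m p + (𝓜.μ (p + 1)).real Set.univ) :
    m n ≤ ∑ p ∈ Finset.range (n + 1), (𝓜.μ p).real Set.univ * g ^ (n - p) := by
  induction n with
  | zero => simpa using h0
  | succ n ih =>
    have ih := ih fun p hp => h p (by omega)
    rw [Finset.sum_range_succ]
    have h1 : ∑ p ∈ Finset.range (n + 1), (𝓜.μ p).real Set.univ * g ^ (n + 1 - p) =
        g * ∑ p ∈ Finset.range (n + 1), (𝓜.μ p).real Set.univ * g ^ (n - p) := by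
      rw [Finset.mul_sum]
      refine Finset.sum_congr rfl fun p hp => ?_
      rw [Nat.sub_add_comm (Finset.mem_range_succ_iff.1 hp), pow_succ]
      ring
    rw [h1]
    have := mul_le_mul_of_nonneg_left ih hg
    simp only [Nat.sub_self, pow_zero, mul_one]
    linarith [h n (Nat.lt_succ_self n)]

theorem gMinus_nonneg (n : ℕ) : 0 ≤ 𝓜.gMinus n :=
  Real.iInf_nonneg fun p => (𝓜.iInf_G_pos p).le

theorem gPlus_nonneg (n : ℕ) : 0 ≤ 𝓜.gPlus n :=
  Real.iSup_nonneg fun p => Real.iSup_nonneg fun x => (𝓜.G_pos p x).le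

theorem gMinus_le {p n : ℕ} (h : p < n) (x : E p) : 𝓜.gMinus n ≤ 𝓜.G p x :=
  (ciInf_le (Finite.bddBelow_range fun p : Fin n => ⨅ x, 𝓜.G p x) ⟨p, h⟩).trans
    (ciInf_le (𝓜.bddBelow_G p) x)

theorem le_gPlus {p n : ℕ} (h : p < n) (x : E p) : 𝓜.G p x ≤ 𝓜.gPlus n :=
  (le_ciSup (𝓜.bddAbove_G p) x).trans
    (le_ciSup (Finite.bddAbove_range fun p : Fin n => ⨆ x, 𝓜.G p x) ⟨p, h⟩)

/-- A solution of the recursion of the total masses, driven by any probability measures `ν p`,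
stays in the interval `I_n`. -/
theorem mem_Icc_of_recursion {m : ℕ → ℝ} (ν : ∀ p, Measure (E p))
    [∀ p, IsProbabilityMeasure (ν p)] (h0 : m 0 = (𝓜.μ 0).real Set.univ)
    (h : ∀ p, m (p + 1) = m p * ∫ x, 𝓜.G p x ∂(ν p) + (𝓜.μ (p + 1)).real Set.univ) (n : ℕ) :
    0 < m n ∧ m n ∈ Set.Icc (𝓜.mMinus n) (𝓜.mPlus n) := by
  have hG : ∀ p, 0 < ∫ x, 𝓜.G p x ∂(ν p) := fun p => by
    have := integral_mono (μ := ν p) (integrable_const _) ((𝓜.isBddMeas_G p).integrable _)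
      fun x => ciInf_le (𝓜.bddBelow_G p) x
    simp only [integral_const, probReal_univ, one_smul] at this
    exact (𝓜.iInf_G_pos p).trans_le this
  have hpos : ∀ p, 0 < m p := by
    intro p
    induction p with
    | zero => rw [h0]; exact 𝓜.mu_zero_real_pos
    | succ p ih =>
      rw [h]
      have := mul_pos ih (hG p)
      have : 0 ≤ (𝓜.μ (p + 1)).real Set.univ := measureReal_nonneg
      linarith
  refine ⟨hpos n, 𝓜.gSum_le_of_recursion (𝓜.gMinus_nonneg n) h0.ge fun p hp => ?_,
    𝓜.le_gSum_of_recursion (𝓜.gPlus_nonneg n) h0.le fun p hp => ?_⟩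
  · have := integral_mono (μ := ν p) (integrable_const _) ((𝓜.isBddMeas_G p).integrable _)
      fun x => 𝓜.gMinus_le hp x
    simp only [integral_const, probReal_univ, one_smul] at this
    rw [h, mul_comm]
    have := mul_le_mul_of_nonneg_left this (hpos p).le
    linarith
  · have := integral_mono (μ := ν p) ((𝓜.isBddMeas_G p).integrable _) (integrable_const _)
      fun x => 𝓜.le_gPlus hp x
    simp only [integral_const, probReal_univ, one_smul] at this
    rw [h, mul_comm (𝓜.gPlus n)]
    have := mul_le_mul_of_nonneg_left this (hpos p).le
    linarith

theorem γ_ne_zero (n : ℕ) : 𝓜.γ n ≠ 0 := by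
  induction n with
  | zero => rw [γ_zero]; exact 𝓜.μ_zero_ne
  | succ n ih =>
    intro h
    have h1 : 𝓜.mass (n + 1) = 0 := by simp [mass, h]
    rw [mass_succ] at h1
    have h2 := integral_mono (μ := 𝓜.γ n) (integrable_const _) ((𝓜.isBddMeas_G n).integrable _)
      fun x => ciInf_le (𝓜.bddBelow_G n) x
    have h3 : 0 < (𝓜.γ n).real Set.univ := by
      rw [measureReal_def, ENNReal.toReal_pos_iff]
      exact ⟨by simpa [pos_iff_ne_zero] using ih, measure_lt_top _ _⟩
    simp only [integral_const, smul_eq_mul] at h2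
    have h4 := mul_pos h3 (𝓜.iInf_G_pos n)
    have : 0 ≤ (𝓜.μ (n + 1)).real Set.univ := measureReal_nonneg
    linarith

instance isProbabilityMeasure_η (n : ℕ) : IsProbabilityMeasure (𝓜.η n) :=
  (normalize_eq_zero_or (𝓜.γ n)).resolve_left (𝓜.γ_ne_zero n)

theorem integral_γ (n : ℕ) (f : E n → ℝ) :
    ∫ x, f x ∂(𝓜.γ n) = 𝓜.mass n * ∫ x, f x ∂(𝓜.η n) := by
  conv_lhs => rw [← measure_univ_smul_normalize (𝓜.γ n)]
  rw [integral_smul_measure]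
  rfl

theorem mass_mem (n : ℕ) : 0 < 𝓜.mass n ∧ 𝓜.mass n ∈ Set.Icc (𝓜.mMinus n) (𝓜.mPlus n) :=
  𝓜.mem_Icc_of_recursion 𝓜.η 𝓜.mass_zero (fun p => by rw [mass_succ, integral_γ]) n

theorem mMinus_nonneg (n : ℕ) : 0 ≤ 𝓜.mMinus n :=
  Finset.sum_nonneg fun _ _ => mul_nonneg measureReal_nonneg (pow_nonneg (𝓜.gMinus_nonneg n) _)

theorem mPlus_pos (n : ℕ) : 0 < 𝓜.mPlus n :=
  (𝓜.mass_mem n).1.trans_le (𝓜.mass_mem n).2.2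

/-! ### The flow of the intensity measures -/

/-- The mean of the sum of `f` over the targets at time `n`, when the intensity measure at time `p` is `γ`:
`γ Q_{p,n}(f) + ∑_{p < q ≤ n} μ_q Q_{q,n}(f)`. -/
def flow (p n : ℕ) (γ : Measure (E p)) (f : E n → ℝ) : ℝ :=
  ∫ x, 𝓜.act p n f x ∂γ + ∑ q ∈ Finset.Ioc p n, ∫ x, 𝓜.act q n f x ∂(𝓜.μ q)

theorem flow_self (n : ℕ) (γ : Measure (E n)) {f : E n → ℝ} (hf : IsBddMeas f) :
    𝓜.flow n n γ f = ∫ x, f x ∂γ := by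
  simp [flow, 𝓜.act_self n hf]

/-- The flow is a semigroup: its value at time `n` does not change when the intensity measure
evolves by one step. -/
theorem flow_step {p n : ℕ} (h : p < n) (γ : Measure (E p)) [IsFiniteMeasure γ] {f : E n → ℝ}
    (hf : IsBddMeas f) :
    𝓜.flow (p + 1) n (γ.bind (𝓜.Qstep p) + 𝓜.μ (p + 1)) f = 𝓜.flow p n γ f := by
  rw [flow, flow, 𝓜.integral_bind_Qstep_add p γ (𝓜.isBddMeas_act _ _ hf)]
  have h1 : Finset.Ioc p n = insert (p + 1) (Finset.Ioc (p + 1) n) := by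
    ext q; simp only [Finset.mem_Ioc, Finset.mem_insert]; omega
  rw [h1, Finset.sum_insert (by simp), ← add_assoc]
  congr 2
  refine integral_congr_ae (Filter.Eventually.of_forall fun x => ?_)
  simp only [act, 𝓜.T_eq_comp_Qstep h]
  rw [Kernel.integral_comp (hf.integrable _), integral_Qstep]

/-- The flow property of the intensity measures `γ n`. -/
theorem flow_γ {p n : ℕ} (h : p ≤ n) {f : E n → ℝ} (hf : IsBddMeas f) :
    𝓜.flow p n (𝓜.γ p) f = ∫ x, f x ∂(𝓜.γ n) := by
  induction h using Nat.decreasingInduction with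
  | self => exact 𝓜.flow_self n _ hf
  | of_succ p hp ih => rw [← ih, γ_succ, 𝓜.flow_step hp _ hf]

theorem flow_one {p n : ℕ} (γ : Measure (E p)) :
    𝓜.flow p n γ (fun _ => 1) =
      ∫ x, 𝓜.tot p n x ∂γ + ∑ q ∈ Finset.Ioc p n, 𝓜.c q n := by
  rw [flow, act_one]
  congr 1
  refine Finset.sum_congr rfl fun q hq => ?_
  rw [act_one, 𝓜.c_eq (Finset.mem_Ioc.1 hq).2]

end Model

/-! ### Total variation distance and oscillations -/

section TotalVariation

variable {S : Type*} [MeasurableSpace S]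

theorem isOscOne_zero : IsOscOne fun _ : S => (0 : ℝ) := ⟨measurable_const, by simp⟩

instance : Nonempty {f : S → ℝ // IsOscOne f} := ⟨⟨_, isOscOne_zero⟩⟩

theorem abs_integral_sub_integral_le_one (ν ν' : Measure S) [IsProbabilityMeasure ν]
    [IsProbabilityMeasure ν'] {f : S → ℝ} (hf : IsOscOne f) :
    |∫ x, f x ∂ν - ∫ x, f x ∂ν'| ≤ 1 := by
  have hi := hf.isBddMeas.integrable ν
  have hi' := hf.isBddMeas.integrable ν'
  have h1 : ∀ y, |∫ x, f x ∂ν - f y| ≤ 1 := by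
    intro y
    have : ∫ x, f x ∂ν - f y = ∫ x, (f x - f y) ∂ν := by
      rw [integral_sub hi (integrable_const _)]; simp
    rw [this]
    have h := norm_integral_le_of_norm_le_const (μ := ν) (f := fun x => f x - f y) (C := 1)
      (Filter.Eventually.of_forall fun x => hf.2 x y)
    simpa using h
  have : ∫ x, f x ∂ν - ∫ x, f x ∂ν' = ∫ y, (∫ x, f x ∂ν - f y) ∂ν' := by
    rw [integral_sub (integrable_const _) hi']; simp
  rw [this]
  have h := norm_integral_le_of_norm_le_const (μ := ν') (f := fun y => ∫ x, f x ∂ν - f y) (C := 1)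
    (Filter.Eventually.of_forall h1)
  simpa using h

theorem abs_integral_sub_integral_le_tvDist (ν ν' : Measure S) [IsProbabilityMeasure ν]
    [IsProbabilityMeasure ν'] {f : S → ℝ} (hf : IsOscOne f) :
    |∫ x, f x ∂ν - ∫ x, f x ∂ν'| ≤ tvDist ν ν' :=
  le_ciSup (f := fun f : {f : S → ℝ // IsOscOne f} => |∫ x, f.1 x ∂ν - ∫ x, f.1 x ∂ν'|)
    ⟨1, Set.forall_mem_range.2 fun f => abs_integral_sub_integral_le_one ν ν' f.2⟩ ⟨f, hf⟩

theorem tvDist_nonneg (ν ν' : Measure S) : 0 ≤ tvDist ν ν' :=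
  Real.iSup_nonneg fun _ => abs_nonneg _

theorem tvDist_le_one (ν ν' : Measure S) [IsProbabilityMeasure ν] [IsProbabilityMeasure ν'] :
    tvDist ν ν' ≤ 1 :=
  ciSup_le fun f => abs_integral_sub_integral_le_one ν ν' f.2

theorem integral_normalize (ν : Measure S) (f : S → ℝ) :
    ∫ x, f x ∂(normalize ν) = (∫ x, f x ∂ν) / ν.real Set.univ := by
  rw [normalize, integral_smul_measure, ENNReal.toReal_inv, smul_eq_mul, measureReal_def,
    inv_mul_eq_div]

end TotalVariation

namespace Model

variable {E : ℕ → Type u} [∀ n, MeasurableSpace (E n)] (𝓜 : Model E)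

/-! ### The Dobrushin coefficients and the constants of the error bounds -/

theorem isProbabilityMeasure_normalize_T {p n : ℕ} (h : p ≤ n) (x : E p) :
    IsProbabilityMeasure (normalize (𝓜.T p n x)) := by
  refine (normalize_eq_zero_or (𝓜.T p n x)).resolve_left fun h0 => ?_
  have := 𝓜.tot_pos h x
  simp [tot, h0] at this

theorem β_eq {p n : ℕ} (h : p ≤ n) :
    𝓜.β p n = ⨆ x, ⨆ y, tvDist (normalize (𝓜.T p n x)) (normalize (𝓜.T p n y)) := by
  obtain ⟨k, rfl⟩ := Nat.exists_eq_add_of_le h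
  rw [β, Nat.add_sub_cancel_left]
  simp only [P, T_add]

/-- The mean of `f` with respect to the probability measure `P_{p,n}(x, ·)`. -/
def avg (p n : ℕ) (f : E n → ℝ) (x : E p) : ℝ := 𝓜.act p n f x / 𝓜.tot p n x

theorem act_eq_avg_mul {p n : ℕ} (h : p ≤ n) (f : E n → ℝ) (x : E p) :
    𝓜.act p n f x = 𝓜.avg p n f x * 𝓜.tot p n x :=
  (div_mul_cancel₀ _ (𝓜.tot_pos h x).ne').symm

theorem integral_normalize_T (p n : ℕ) (f : E n → ℝ) (x : E p) :
    ∫ y, f y ∂(normalize (𝓜.T p n x)) = 𝓜.avg p n f x :=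
  integral_normalize _ _

theorem abs_avg_sub_avg_le_β {p n : ℕ} (h : p ≤ n) {f : E n → ℝ} (hf : IsOscOne f) (x y : E p) :
    |𝓜.avg p n f x - 𝓜.avg p n f y| ≤ 𝓜.β p n := by
  have hP := fun x => 𝓜.isProbabilityMeasure_normalize_T h x
  have := 𝓜.nonempty p
  rw [𝓜.β_eq h, ← integral_normalize_T, ← integral_normalize_T]
  have h1 : ∀ x, BddAbove (Set.range fun y =>
      tvDist (normalize (𝓜.T p n x)) (normalize (𝓜.T p n y))) :=
    fun x => ⟨1, Set.forall_mem_range.2 fun y => tvDist_le_one _ _⟩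
  refine (abs_integral_sub_integral_le_tvDist _ _ hf).trans ((le_ciSup (h1 x) y).trans ?_)
  exact le_ciSup (f := fun x => ⨆ y, tvDist (normalize (𝓜.T p n x)) (normalize (𝓜.T p n y)))
    ⟨1, Set.forall_mem_range.2 fun x => ciSup_le fun y => tvDist_le_one _ _⟩ x

theorem β_le_of_forall {p n : ℕ} (h : p ≤ n) {b : ℝ}
    (hb : ∀ f : E n → ℝ, IsOscOne f → ∀ x y, 𝓜.avg p n f x - 𝓜.avg p n f y ≤ b) :
    𝓜.β p n ≤ b := by
  have := 𝓜.nonempty p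
  rw [𝓜.β_eq h]
  refine ciSup_le fun x => ciSup_le fun y => ciSup_le fun f => ?_
  rw [integral_normalize_T, integral_normalize_T]
  exact abs_sub_le_iff.2 ⟨hb f.1 f.2 x y, hb f.1 f.2 y x⟩

theorem β_nonneg {p n : ℕ} (h : p ≤ n) : 0 ≤ 𝓜.β p n := by
  rw [𝓜.β_eq h]
  exact Real.iSup_nonneg fun x => Real.iSup_nonneg fun y => tvDist_nonneg _ _

theorem tot_le_q_mul {p n : ℕ} (h : p ≤ n) (x y : E p) :
    𝓜.tot p n x ≤ 𝓜.q p n * 𝓜.tot p n y := by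
  have := 𝓜.nonempty p
  obtain ⟨a, b, ha, hab⟩ := 𝓜.exists_tot_bounds h
  have hb : ∀ x y, 𝓜.tot p n x / 𝓜.tot p n y ≤ b / a := fun x y => by
    have := hab x
    exact div_le_div₀ (by linarith) (hab x).2 ha (hab y).1
  have h1 : 𝓜.q p n = ⨆ x, ⨆ y, 𝓜.tot p n x / 𝓜.tot p n y := by rw [q, 𝓜.Qone_sub h]
  rw [h1, ← div_le_iff₀ (𝓜.tot_pos h y)]
  refine (le_ciSup (f := fun y => 𝓜.tot p n x / 𝓜.tot p n y)
    ⟨_, Set.forall_mem_range.2 (hb x)⟩ y).trans ?_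
  exact le_ciSup (f := fun x => ⨆ y, 𝓜.tot p n x / 𝓜.tot p n y)
    ⟨_, Set.forall_mem_range.2 fun x => ciSup_le (hb x)⟩ x

theorem one_le_q {p n : ℕ} (h : p ≤ n) : 1 ≤ 𝓜.q p n := by
  obtain ⟨x⟩ := 𝓜.nonempty p
  have := 𝓜.tot_le_q_mul h x x
  have h0 := 𝓜.tot_pos h x
  by_contra hq
  nlinarith

theorem normQ_le_of_forall {p n : ℕ} (h : p ≤ n) {a : ℝ} (ha : 0 < a)
    (hq : ∀ x y, 𝓜.tot p n x ≤ a * 𝓜.tot p n y) : 𝓜.normQ p n ≤ a * 𝓜.lowQ p n := by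
  have := 𝓜.nonempty p
  rw [𝓜.normQ_eq h]
  refine ciSup_le fun x => ?_
  rw [← div_le_iff₀' ha]
  exact le_ciInf fun y => (div_le_iff₀' ha).2 (hq x y)

theorem normQ_le_q_mul_lowQ {p n : ℕ} (h : p ≤ n) : 𝓜.normQ p n ≤ 𝓜.q p n * 𝓜.lowQ p n :=
  𝓜.normQ_le_of_forall h (one_pos.trans_le (𝓜.one_le_q h)) (𝓜.tot_le_q_mul h)

/-! ### The contribution of a local sampling error -/

/-- The total mass at time `n` which is due to the spontaneous births after time `p`. -/
def births (p n : ℕ) : ℝ := ∑ q ∈ Finset.Ioc p n, 𝓜.c q n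

theorem births_nonneg (p n : ℕ) : 0 ≤ 𝓜.births p n :=
  Finset.sum_nonneg fun _ hq => 𝓜.c_nonneg (Finset.mem_Ioc.1 hq).2

/-- The weighted sum of the Dobrushin coefficients of the spontaneous births. -/
def birthsβ (p n : ℕ) : ℝ := ∑ q ∈ Finset.Ioc p n, 𝓜.c q n * 𝓜.β q n

theorem birthsβ_nonneg (p n : ℕ) : 0 ≤ 𝓜.birthsβ p n :=
  Finset.sum_nonneg fun _ hq => mul_nonneg (𝓜.c_nonneg (Finset.mem_Ioc.1 hq).2)
    (𝓜.β_nonneg (Finset.mem_Ioc.1 hq).2)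

theorem birthsβ_eq_zero {p n : ℕ} (h : 𝓜.births p n = 0) : 𝓜.birthsβ p n = 0 := by
  refine Finset.sum_eq_zero fun q hq => ?_
  rw [births, Finset.sum_eq_zero_iff_of_nonneg
    fun _ hq => 𝓜.c_nonneg (Finset.mem_Ioc.1 hq).2] at h
  rw [h q hq, zero_mul]

/-- An upper bound of `m ‖Q_{p,n}(1)‖ / (m ν Q_{p,n}(1) + ∑_{p < q ≤ n} c_{q,n})`,
for a mass `m ≤ m_+(p)` and a probability measure `ν`. -/
def gain (p n : ℕ) : ℝ :=
  𝓜.normQ p n * 𝓜.mPlus p / (𝓜.mPlus p * 𝓜.lowQ p n + 𝓜.births p n)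

/-- A bound of the oscillations of the centred functions which carry the local errors. -/
def spread (p n : ℕ) : ℝ :=
  𝓜.β p n + 𝓜.birthsβ p n / (𝓜.mMinus p * 𝓜.lowQ p n + 𝓜.births p n)

/-- The contribution of the local sampling error at time `p` to the error at time `n`. It is
smaller than `bConst p n`: the masses of the initial targets and of the later births are kept
together in the denominators. Without this, the sum over `p` would grow like `log n` when
`G = 1`. -/
def localConst (p n : ℕ) : ℝ := 2 * 𝓜.gain p n * 𝓜.spread p n

theorem spread_nonneg {p n : ℕ} (h : p ≤ n) : 0 ≤ 𝓜.spread p n :=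
  add_nonneg (𝓜.β_nonneg h) (div_nonneg (𝓜.birthsβ_nonneg p n)
    (add_nonneg (mul_nonneg (𝓜.mMinus_nonneg p) (𝓜.lowQ_pos h).le) (𝓜.births_nonneg p n)))

theorem gain_nonneg {p n : ℕ} (h : p ≤ n) : 0 ≤ 𝓜.gain p n :=
  div_nonneg (mul_nonneg (𝓜.normQ_pos h).le (𝓜.mPlus_pos p).le)
    (add_nonneg (mul_nonneg (𝓜.mPlus_pos p).le (𝓜.lowQ_pos h).le) (𝓜.births_nonneg p n))

theorem localConst_nonneg {p n : ℕ} (h : p ≤ n) : 0 ≤ 𝓜.localConst p n :=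
  mul_nonneg (mul_nonneg two_pos.le (𝓜.gain_nonneg h)) (𝓜.spread_nonneg h)

theorem gain_le_of_normQ_le {p n : ℕ} (h : p ≤ n) {a : ℝ} (ha : 0 ≤ a)
    (hq : 𝓜.normQ p n ≤ a * 𝓜.lowQ p n) : 𝓜.gain p n ≤ a := by
  have hm := 𝓜.mPlus_pos p
  have hl := 𝓜.lowQ_pos h
  have hb := 𝓜.births_nonneg p n
  rw [gain, div_le_iff₀ (by positivity)]
  calc _ ≤ a * 𝓜.lowQ p n * 𝓜.mPlus p := by gcongr
    _ = a * (𝓜.mPlus p * 𝓜.lowQ p n) := by ring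
    _ ≤ _ := by gcongr; linarith

theorem gain_le_div_births {p n : ℕ} (h : p ≤ n) (hb : 0 < 𝓜.births p n) :
    𝓜.gain p n ≤ 𝓜.mPlus p * 𝓜.normQ p n / 𝓜.births p n := by
  have hm := 𝓜.mPlus_pos p
  have hl := 𝓜.lowQ_pos h
  have hn := 𝓜.normQ_pos h
  rw [gain, mul_comm (𝓜.normQ p n)]
  gcongr
  nlinarith [mul_pos hm hl]

theorem birthsβ_div_le {p n : ℕ} (h : p ≤ n) :
    𝓜.birthsβ p n / (𝓜.mMinus p * 𝓜.lowQ p n + 𝓜.births p n) ≤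
      𝓜.birthsβ p n / 𝓜.births p n := by
  rcases (𝓜.births_nonneg p n).eq_or_lt with hb | hb
  · simp [𝓜.birthsβ_eq_zero hb.symm]
  · have := 𝓜.birthsβ_nonneg p n
    gcongr
    have := mul_nonneg (𝓜.mMinus_nonneg p) (𝓜.lowQ_pos h).le
    linarith

/-- Dropping one of the two terms in the denominators of `gain` and `spread` yields `bConst`. -/
theorem localConst_le_bConst {p n : ℕ} (h : p ≤ n) : 𝓜.localConst p n ≤ 𝓜.bConst p n := by
  have hq := 𝓜.one_le_q h
  have hgain : 𝓜.gain p n ≤ (min 1 (𝓜.mRatio p n)).toReal * 𝓜.q p n := by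
    have hnum : 0 < 𝓜.mPlus p * 𝓜.normQ p n := mul_pos (𝓜.mPlus_pos p) (𝓜.normQ_pos h)
    have h1 := 𝓜.gain_le_of_normQ_le h (by linarith) (𝓜.normQ_le_q_mul_lowQ h)
    rcases (𝓜.births_nonneg p n).eq_or_lt with hb | hb
    · have : 𝓜.mRatio p n = ⊤ := by
        change _ / ENNReal.ofReal (𝓜.births p n) = _
        rw [← hb, ENNReal.ofReal_zero, ENNReal.div_zero]
        simpa using hnum
      simpa [this] using h1
    · have h2 : 𝓜.mRatio p n = ENNReal.ofReal (𝓜.mPlus p * 𝓜.normQ p n / 𝓜.births p n) :=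
        (ENNReal.ofReal_div_of_pos hb).symm
      rw [h2, ← ENNReal.ofReal_one, ← ENNReal.ofReal_min, ENNReal.toReal_ofReal (by positivity)]
      have h3 := 𝓜.gain_le_div_births h hb
      rcases min_choice 1 (𝓜.mPlus p * 𝓜.normQ p n / 𝓜.births p n) with he | he <;> rw [he]
      · linarith
      · exact h3.trans (le_mul_of_one_le_right (by positivity) hq)
  have hspread : 𝓜.spread p n ≤ 𝓜.q p n * 𝓜.β p n + ∑ q ∈ Finset.Ioc p n,
      𝓜.c q n / (∑ r ∈ Finset.Ioc p n, 𝓜.c r n) * 𝓜.β q n := by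
    refine add_le_add (le_mul_of_one_le_left (𝓜.β_nonneg h) hq)
      ((𝓜.birthsβ_div_le h).trans_eq ?_)
    rw [birthsβ, Finset.sum_div]
    exact Finset.sum_congr rfl fun q _ => by rw [births]; ring
  rw [localConst, bConst, mul_assoc 2 (ENNReal.toReal _)]
  have := 𝓜.spread_nonneg h
  gcongr

theorem sum_localConst_mem (n : ℕ) :
    0 ≤ ∑ p ∈ Finset.range (n + 1), 𝓜.localConst p n ∧
      ∑ p ∈ Finset.range (n + 1), 𝓜.localConst p n ≤
        ∑ p ∈ Finset.range (n + 1), 𝓜.bConst p n :=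
  ⟨Finset.sum_nonneg fun _ hp => 𝓜.localConst_nonneg (Finset.mem_range_succ_iff.1 hp),
    Finset.sum_le_sum fun _ hp => 𝓜.localConst_le_bConst (Finset.mem_range_succ_iff.1 hp)⟩

/-! ### Stability of the normalized flow -/

/-- The mean of `f` under `P_{q,n}(z, ·)` is within `β(P_{q,n})` of its mean under `P_{p,n}(x, ·)`,
which is a mixture of the measures `P_{q,n}(w, ·)`. -/
theorem abs_act_sub_avg_mul_le {p q n : ℕ} (hpq : p ≤ q) (hqn : q ≤ n) {f : E n → ℝ}
    (hf : IsOscOne f) (x : E p) (z : E q) :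
    |𝓜.act q n f z - 𝓜.avg p n f x * 𝓜.tot q n z| ≤ 𝓜.β q n * 𝓜.tot q n z := by
  have hb := hf.isBddMeas
  have hz := 𝓜.tot_pos hqn z
  have hx := 𝓜.tot_pos (hpq.trans hqn) x
  have h1 : |𝓜.act p n f x - 𝓜.avg q n f z * 𝓜.tot p n x| ≤ 𝓜.β q n * 𝓜.tot p n x := by
    rw [𝓜.act_comp hpq hqn hb, 𝓜.tot_comp hpq hqn, ← act_const_mul, ← act_sub _ _ _
      (𝓜.isBddMeas_act q n hb) ((isBddMeas_const _).mul (𝓜.isBddMeas_tot q n)), ← act_const_mul]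
    refine 𝓜.abs_act_le p q ((isBddMeas_const _).mul (𝓜.isBddMeas_tot q n)) (fun w => ?_) x
    have hw := 𝓜.tot_pos hqn w
    rw [𝓜.act_eq_avg_mul hqn, ← sub_mul, abs_mul, abs_of_pos hw]
    gcongr
    exact 𝓜.abs_avg_sub_avg_le_β hqn hf w z
  rw [𝓜.act_eq_avg_mul (hpq.trans hqn), ← sub_mul, abs_mul, abs_of_pos hx] at h1
  rw [𝓜.act_eq_avg_mul hqn, ← sub_mul, abs_mul, abs_of_pos hz, abs_sub_comm]
  have := le_of_mul_le_mul_right h1 hx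
  gcongr

/-- A lower bound of the total mass at time `n`, used for the denominators of the normalized flow.
-/
theorem flow_one_ge {p : ℕ} (n : ℕ) (γ : Measure (E p)) [IsFiniteMeasure γ] :
    γ.real Set.univ * 𝓜.lowQ p n + 𝓜.births p n ≤ 𝓜.flow p n γ fun _ => 1 := by
  rw [flow_one]
  have := integral_mono (μ := γ) (integrable_const _) ((𝓜.isBddMeas_tot p n).integrable _)
    fun x => 𝓜.lowQ_le (n := n) x
  rw [integral_const, smul_eq_mul] at this
  rw [births]
  gcongr

theorem flow_one_pos {p n : ℕ} (h : p ≤ n) (γ : Measure (E p)) [IsFiniteMeasure γ]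
    (hγ : 0 < γ.real Set.univ) : 0 < 𝓜.flow p n γ fun _ => 1 := by
  have h1 := 𝓜.flow_one_ge n γ
  have h2 := mul_pos hγ (𝓜.lowQ_pos h)
  have h3 := 𝓜.births_nonneg p n
  linarith

/-- The normalized flow: the mean of `f` at time `n` with respect to the normalized intensity
measure, when the intensity measure at time `p` is `γ`. -/
def nflow (p n : ℕ) (γ : Measure (E p)) (f : E n → ℝ) : ℝ :=
  𝓜.flow p n γ f / 𝓜.flow p n γ fun _ => 1

/-- The function `Q_{p,n}(f - Φ_{p,n}(γ)(f))`, where `Φ` is the normalized flow. -/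
def centred (p n : ℕ) (γ : Measure (E p)) (f : E n → ℝ) (x : E p) : ℝ :=
  𝓜.act p n f x - 𝓜.nflow p n γ f * 𝓜.tot p n x

theorem isBddMeas_centred (p n : ℕ) (γ : Measure (E p)) {f : E n → ℝ} (hf : IsBddMeas f) :
    IsBddMeas (𝓜.centred p n γ f) :=
  (𝓜.isBddMeas_act p n hf).sub ((isBddMeas_const _).mul (𝓜.isBddMeas_tot p n))

/-- The normalized flow is a mixture of the probability measures `P_{p,n}(y, ·)` and `P_{q,n}(z, ·)`
with `p < q ≤ n`; its distance to `P_{p,n}(x, ·)` is measured by the Dobrushin coefficients. -/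
theorem abs_centred_le {p n : ℕ} (h : p ≤ n) (γ : Measure (E p)) [IsFiniteMeasure γ]
    (hγ0 : 0 < γ.real Set.univ) (hγ : 𝓜.mMinus p ≤ γ.real Set.univ) {f : E n → ℝ}
    (hf : IsOscOne f) (x : E p) :
    |𝓜.centred p n γ f x| ≤ 𝓜.normQ p n * 𝓜.spread p n := by
  have hb := hf.isBddMeas
  have hF := 𝓜.flow_one_pos h γ hγ0
  have hx := 𝓜.tot_pos h x
  have hlow := 𝓜.lowQ_pos h
  have hbirths := 𝓜.births_nonneg p n
  have hI : 0 ≤ ∫ y, 𝓜.tot p n y ∂γ := integral_nonneg fun y => (𝓜.tot_pos h y).le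
  have hterm : ∀ {q : ℕ} (_ : p ≤ q) (_ : q ≤ n) (ν : Measure (E q)) [IsFiniteMeasure ν],
      |∫ y, 𝓜.act q n f y ∂ν - 𝓜.avg p n f x * ∫ y, 𝓜.tot q n y ∂ν| ≤
        𝓜.β q n * ∫ y, 𝓜.tot q n y ∂ν := by
    intro q hpq hqn ν _
    have hi := (𝓜.isBddMeas_tot q n).integrable ν
    rw [← integral_const_mul, ← integral_const_mul, ← integral_sub
      ((𝓜.isBddMeas_act q n hb).integrable ν) (hi.const_mul _)]
    exact norm_integral_le_of_norm_le
      (f := fun y => 𝓜.act q n f y - 𝓜.avg p n f x * 𝓜.tot q n y) (hi.const_mul _)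
      (Filter.Eventually.of_forall fun z => 𝓜.abs_act_sub_avg_mul_le hpq hqn hf x z)
  have h1 : |𝓜.flow p n γ f - 𝓜.avg p n f x * 𝓜.flow p n γ fun _ => 1| ≤
      𝓜.β p n * ∫ y, 𝓜.tot p n y ∂γ + 𝓜.birthsβ p n := by
    have he : 𝓜.flow p n γ f - 𝓜.avg p n f x * 𝓜.flow p n γ (fun _ => 1) =
        (∫ y, 𝓜.act p n f y ∂γ - 𝓜.avg p n f x * ∫ y, 𝓜.tot p n y ∂γ) +
          ∑ q ∈ Finset.Ioc p n, (∫ y, 𝓜.act q n f y ∂(𝓜.μ q) - 𝓜.avg p n f x * 𝓜.c q n) := by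
      rw [flow_one, flow, Finset.sum_sub_distrib, ← Finset.mul_sum]
      ring
    rw [he]
    refine (abs_add_le _ _).trans (add_le_add (hterm le_rfl h γ)
      ((Finset.abs_sum_le_sum_abs _ _).trans (Finset.sum_le_sum fun q hq => ?_)))
    have hq := Finset.mem_Ioc.1 hq
    rw [𝓜.c_eq hq.2, mul_comm _ (𝓜.β q n)]
    exact hterm hq.1.le hq.2 _
  have h2 : |𝓜.nflow p n γ f - 𝓜.avg p n f x| ≤ 𝓜.spread p n := by
    have he : 𝓜.nflow p n γ f - 𝓜.avg p n f x =
        (𝓜.flow p n γ f - 𝓜.avg p n f x * 𝓜.flow p n γ fun _ => 1) /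
          𝓜.flow p n γ fun _ => 1 := by
      rw [nflow]; field_simp
    rw [he, abs_div, abs_of_pos hF]
    refine (div_le_div_of_nonneg_right h1 hF.le).trans ?_
    rw [add_div, spread]
    refine add_le_add ?_ ?_
    · rw [div_le_iff₀ hF]
      gcongr
      · exact 𝓜.β_nonneg h
      · rw [flow_one]
        exact le_add_of_nonneg_right hbirths
    · rcases (add_nonneg (mul_nonneg (𝓜.mMinus_nonneg p) hlow.le) hbirths).eq_or_lt with h0 | h0
      · have hz : 𝓜.births p n = 0 := by
          have := mul_nonneg (𝓜.mMinus_nonneg p) hlow.le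
          linarith
        simp [𝓜.birthsβ_eq_zero hz]
      · refine div_le_div_of_nonneg_left (𝓜.birthsβ_nonneg p n) h0 (le_trans ?_ (𝓜.flow_one_ge n γ))
        gcongr
  rw [centred, 𝓜.act_eq_avg_mul h, ← sub_mul, abs_mul, abs_of_pos hx, abs_sub_comm, mul_comm]
  exact mul_le_mul (𝓜.tot_le_normQ h x) h2 (abs_nonneg _) (𝓜.normQ_pos h).le

/-- The difference of two quotients of affine functionals: the births after time `p` contribute
equally to both flows and cancel. -/
theorem nflow_sub_nflow {p n : ℕ} (h : p ≤ n) (γ γ' : Measure (E p)) [IsFiniteMeasure γ]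
    [IsFiniteMeasure γ'] (hγ : 0 < γ.real Set.univ) (hγ' : 0 < γ'.real Set.univ) {f : E n → ℝ}
    (hf : IsBddMeas f) :
    𝓜.nflow p n γ f - 𝓜.nflow p n γ' f =
      (∫ x, 𝓜.centred p n γ' f x ∂γ - ∫ x, 𝓜.centred p n γ' f x ∂γ') /
        𝓜.flow p n γ fun _ => 1 := by
  have hF := 𝓜.flow_one_pos h γ hγ
  have hF' := 𝓜.flow_one_pos h γ' hγ'
  have hc : ∀ (ν : Measure (E p)) [IsFiniteMeasure ν], ∫ x, 𝓜.centred p n γ' f x ∂ν =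
      𝓜.flow p n ν f - 𝓜.nflow p n γ' f * 𝓜.flow p n ν (fun _ => 1) -
        (∑ q ∈ Finset.Ioc p n, ∫ x, 𝓜.act q n f x ∂(𝓜.μ q) -
          𝓜.nflow p n γ' f * 𝓜.births p n) := by
    intro ν _
    simp only [centred]
    rw [integral_sub ((𝓜.isBddMeas_act p n hf).integrable ν)
      (((𝓜.isBddMeas_tot p n).integrable ν).const_mul _), integral_const_mul, flow_one, flow,
      births]
    ring
  have h0 : 𝓜.nflow p n γ' f * 𝓜.flow p n γ' (fun _ => 1) = 𝓜.flow p n γ' f :=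
    div_mul_cancel₀ _ hF'.ne'
  rw [eq_div_iff hF.ne', hc γ, hc γ', h0, sub_mul]
  conv_lhs => rw [nflow, div_mul_cancel₀ _ hF.ne']
  ring

/-- The Lipschitz estimate for two normalized flows which start from the same total mass
`m ≤ m_+(p)`, with normalized intensity measures `ν` and `ν'`. -/
theorem abs_nflow_sub_nflow_le {p n : ℕ} (h : p ≤ n) (ν ν' : Measure (E p))
    [IsProbabilityMeasure ν] [IsProbabilityMeasure ν'] {m : ℝ} (hm0 : 0 < m)
    (hm : m ≤ 𝓜.mPlus p) {f : E n → ℝ} (hf : IsBddMeas f) :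
    |𝓜.nflow p n (ENNReal.ofReal m • ν) f - 𝓜.nflow p n (ENNReal.ofReal m • ν') f| ≤
      𝓜.gain p n / 𝓜.normQ p n *
        |∫ x, 𝓜.centred p n (ENNReal.ofReal m • ν') f x ∂ν -
          ∫ x, 𝓜.centred p n (ENNReal.ofReal m • ν') f x ∂ν'| := by
  have hr : ∀ (ν : Measure (E p)) [IsProbabilityMeasure ν],
      (ENNReal.ofReal m • ν).real Set.univ = m := by
    intro ν _
    simp [measureReal_def, ENNReal.toReal_ofReal hm0.le]
  have hfin : ∀ (ν : Measure (E p)) [IsProbabilityMeasure ν],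
      IsFiniteMeasure (ENNReal.ofReal m • ν) := fun ν _ => ν.smul_finite ENNReal.ofReal_ne_top
  have := hfin ν
  have := hfin ν'
  have hlow := 𝓜.lowQ_pos h
  have hnorm := 𝓜.normQ_pos h
  have hbirths := 𝓜.births_nonneg p n
  rw [𝓜.nflow_sub_nflow h _ _ (by rwa [hr]) (by rwa [hr]) hf, integral_smul_measure,
    integral_smul_measure, ENNReal.toReal_ofReal hm0.le, smul_eq_mul, smul_eq_mul, ← mul_sub,
    abs_div, abs_mul, abs_of_pos hm0, abs_of_pos (𝓜.flow_one_pos h _ (by rwa [hr])),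
    mul_div_right_comm]
  refine mul_le_mul_of_nonneg_right ?_ (abs_nonneg _)
  have hge := 𝓜.flow_one_ge n (ENNReal.ofReal m • ν)
  rw [hr] at hge
  have hM := 𝓜.mPlus_pos p
  calc _ ≤ m / (m * 𝓜.lowQ p n + 𝓜.births p n) := by gcongr
    _ ≤ 𝓜.mPlus p / (𝓜.mPlus p * 𝓜.lowQ p n + 𝓜.births p n) := by
      rw [div_le_div_iff₀ (by positivity) (by positivity)]
      nlinarith
    _ = _ := by rw [gain, mul_div_assoc, mul_div_cancel_left₀ _ hnorm.ne']

end Model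

/-! ### Occupation measures and conditional laws -/

section Empirical

variable {S : Type*} [MeasurableSpace S] {N : ℕ}

theorem isProbabilityMeasure_empirical (hN : 1 ≤ N) (x : Fin N → S) :
    IsProbabilityMeasure (empirical x) := by
  refine ⟨?_⟩
  have h0 : (N : ℝ≥0∞) ≠ 0 := by simpa using (by omega : N ≠ 0)
  simp only [empirical, Measure.smul_apply, Measure.coe_finsetSum, Finset.sum_apply, measure_univ,
    Finset.sum_const, Finset.card_univ, Fintype.card_fin, nsmul_eq_mul, mul_one, smul_eq_mul]
  exact ENNReal.inv_mul_cancel h0 (ENNReal.natCast_ne_top N)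

theorem integral_empirical (x : Fin N → S) {f : S → ℝ} (hf : Measurable f) :
    ∫ y, f y ∂(empirical x) = (N : ℝ)⁻¹ * ∑ i, f (x i) := by
  rw [empirical, integral_smul_measure, integral_finsetSum_measure fun i _ =>
    integrable_dirac' hf.stronglyMeasurable (by simp)]
  simp [integral_dirac' _ _ hf.stronglyMeasurable]

end Empirical

/-- If the conditional law of `ξ` given a σ-algebra `ℱ` is a function of an `ℱ`-measurable variable
`z`, then it is also the conditional law given `z`. -/
theorem HasCondLaw.of_condExp {Ω S Z : Type*} [MeasurableSpace S] [MeasurableSpace Z] {N : ℕ}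
    {ℱ mΩ : MeasurableSpace Ω} {Pr : Measure Ω} [IsProbabilityMeasure Pr] (hle : ℱ ≤ mΩ)
    {z : Ω → Z} {ξ : Ω → Fin N → S} {κ : Fin N → Kernel Z S} [∀ i, IsMarkovKernel (κ i)]
    (hzF : Measurable[ℱ] z) (hξ : Measurable ξ)
    (h : ∀ A, MeasurableSet A → Pr⟦ξ ⁻¹' A | ℱ⟧ =ᵐ[Pr] fun ω => (piKernel κ (z ω)).real A) :
    HasCondLaw Pr z ξ κ := by
  have hz : Measurable z := hzF.mono hle le_rfl
  refine ⟨hz, hξ, Measure.ext_prod fun {s t} hs ht => ?_⟩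
  have ht' : MeasurableSet (ξ ⁻¹' t) := hξ ht
  have hs' : MeasurableSet (z ⁻¹' s) := hz hs
  have hκ : Measurable fun w => piKernel κ w t := Kernel.measurable_coe _ ht
  have h1 : ∫ ω in z ⁻¹' s, (piKernel κ (z ω)).real t ∂Pr = Pr.real (z ⁻¹' s ∩ ξ ⁻¹' t) := by
    have h2 : ∫ ω in z ⁻¹' s, (Pr⟦ξ ⁻¹' t | ℱ⟧) ω ∂Pr =
        ∫ ω in z ⁻¹' s, (ξ ⁻¹' t).indicator (fun _ => (1 : ℝ)) ω ∂Pr :=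
      setIntegral_condExp hle ((integrable_const _).indicator ht') (hzF hs)
    rw [integral_indicator_const _ ht', measureReal_restrict_apply ht', smul_eq_mul, mul_one,
      Set.inter_comm] at h2
    rw [← h2]
    refine setIntegral_congr_ae hs' ?_
    filter_upwards [h t ht] with ω hω _
    exact hω.symm
  rw [Measure.map_apply (hz.prodMk hξ) (hs.prod ht), Measure.compProd_apply_prod hs ht,
    setLIntegral_map hs hκ hz]
  have h3 : (fun ω => (z ω, ξ ω)) ⁻¹' (s ×ˢ t) = z ⁻¹' s ∩ ξ ⁻¹' t := rfl
  rw [h3, ← ofReal_measureReal, ← h1, ofReal_integral_eq_lintegral_ofReal]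
  · exact lintegral_congr fun ω => ofReal_measureReal (measure_ne_top (piKernel κ (z ω)) t)
  · refine Integrable.of_bound (hκ.comp hz).ennreal_toReal.aestronglyMeasurable 1
      (Filter.Eventually.of_forall fun ω => ?_)
    rw [Real.norm_of_nonneg measureReal_nonneg]
    exact measureReal_le_one
  · exact Filter.Eventually.of_forall fun ω => measureReal_nonneg

namespace Model

variable {E : ℕ → Type u} [∀ n, MeasurableSpace (E n)] (𝓜 : Model E)

/-! ### The evolution map of the particle model -/

theorem lintegral_boltzmannGibbs (n : ℕ) (η : Measure (E n)) (g : E n → ℝ≥0∞)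
    (hg : Measurable g) :
    ∫⁻ x, g x ∂(boltzmannGibbs (𝓜.G n) η) =
      (∫⁻ x, ENNReal.ofReal (𝓜.G n x) ∂η)⁻¹ * ∫⁻ x, ENNReal.ofReal (𝓜.G n x) * g x ∂η := by
  have hG := (𝓜.measurable_G n).ennreal_ofReal
  rw [boltzmannGibbs, lintegral_smul_measure, lintegral_withDensity_eq_lintegral_mul _ hG hg,
    smul_eq_mul]
  rfl

/-- The unnormalized form of the evolution map: the total mass times `Γ₂` depends linearly on the
intensity measure `m • η`. -/
theorem smul_Γ₂ (n : ℕ) (m : ℝ≥0) (η : Measure (E n)) [IsProbabilityMeasure η] (hm : 0 < m) :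
    ENNReal.ofReal (m * ∫ x, 𝓜.G n x ∂η + (𝓜.μ (n + 1)).real Set.univ) • 𝓜.Γ₂ n m η =
      ((m : ℝ≥0∞) • η).bind (𝓜.Qstep n) + 𝓜.μ (n + 1) := by
  have hGm := (𝓜.measurable_G n).ennreal_ofReal
  have hGi := (𝓜.isBddMeas_G n).integrable η
  have hG0 : 0 < ∫ x, 𝓜.G n x ∂η := by
    have h := integral_mono (μ := η) (integrable_const _) hGi
      fun x => ciInf_le (𝓜.bddBelow_G n) x
    simp only [integral_const, probReal_univ, one_smul] at h
    exact (𝓜.iInf_G_pos n).trans_le h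
  have hlint : ∫⁻ x, ENNReal.ofReal (𝓜.G n x) ∂η = ENNReal.ofReal (∫ x, 𝓜.G n x ∂η) :=
    (ofReal_integral_eq_lintegral_ofReal hGi
      (Filter.Eventually.of_forall fun x => (𝓜.G_pos n x).le)).symm
  set a := ∫ x, 𝓜.G n x ∂η with ha
  set b := (𝓜.μ (n + 1)).real Set.univ with hb
  have hb0 : 0 ≤ b := measureReal_nonneg
  have hm' : (0 : ℝ) < m := by exact_mod_cast hm
  have hs : 0 < m * a + b := by positivity
  have hα : 𝓜.α n m η = m * a / (m * a + b) := rfl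
  have h1 : ENNReal.ofReal (m * a + b) * ENNReal.ofReal (𝓜.α n m η) =
      m * ENNReal.ofReal a := by
    rw [← ENNReal.ofReal_mul hs.le, hα, mul_div_cancel₀ _ hs.ne', ENNReal.ofReal_mul hm'.le,
      ENNReal.ofReal_coe_nnreal]
  have h2 : ENNReal.ofReal (m * a + b) * ENNReal.ofReal (1 - 𝓜.α n m η) =
      (𝓜.μ (n + 1)) Set.univ := by
    rw [← ENNReal.ofReal_mul hs.le, hα, mul_sub, mul_div_cancel₀ _ hs.ne', mul_one,
      add_sub_cancel_left, hb, ofReal_measureReal]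
  refine Measure.ext_of_lintegral _ fun g hg => ?_
  have hMg : Measurable fun x => ∫⁻ y, g y ∂(𝓜.M n x) := hg.lintegral_kernel
  have hker : Measurable fun x => ENNReal.ofReal (𝓜.α n m η) • 𝓜.M n x +
      ENNReal.ofReal (1 - 𝓜.α n m η) • normalize (𝓜.μ (n + 1)) := by
    refine Measure.measurable_of_measurable_coe _ fun s hs => ?_
    simp only [Measure.add_apply, Measure.smul_apply, smul_eq_mul]
    exact ((Kernel.measurable_coe _ hs).const_mul _).add_const _
  have hI : ∀ x, ∫⁻ y, g y ∂(ENNReal.ofReal (𝓜.α n m η) • 𝓜.M n x +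
      ENNReal.ofReal (1 - 𝓜.α n m η) • normalize (𝓜.μ (n + 1))) =
      ENNReal.ofReal (𝓜.α n m η) * ∫⁻ y, g y ∂(𝓜.M n x) +
      ENNReal.ofReal (1 - 𝓜.α n m η) * ∫⁻ y, g y ∂(normalize (𝓜.μ (n + 1))) := by
    intro x
    rw [lintegral_add_measure, lintegral_smul_measure, lintegral_smul_measure, smul_eq_mul,
      smul_eq_mul]
  have ha1 : (ENNReal.ofReal a)⁻¹ * ENNReal.ofReal a = 1 :=
    ENNReal.inv_mul_cancel (by simpa using hG0) ENNReal.ofReal_ne_top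
  rw [lintegral_smul_measure, Γ₂, Measure.lintegral_bind hker.aemeasurable hg.aemeasurable,
    lintegral_add_measure, Measure.lintegral_bind (Kernel.measurable _).aemeasurable
      hg.aemeasurable, lintegral_smul_measure]
  simp only [hI, Qstep_apply, lintegral_smul_measure, smul_eq_mul]
  rw [lintegral_add_right _ measurable_const, lintegral_const_mul _ hMg,
    𝓜.lintegral_boltzmannGibbs n η _ hMg, lintegral_const, hlint,
    ← lintegral_one, 𝓜.lintegral_boltzmannGibbs n η _ measurable_const, hlint]
  simp only [mul_one, hlint]
  rw [ha1, mul_one, mul_add]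
  congr 1
  · rw [← mul_assoc, h1, mul_assoc, ← mul_assoc (ENNReal.ofReal a), mul_comm (ENNReal.ofReal a),
      ha1, one_mul]
  · rw [← mul_assoc, h2, ← smul_eq_mul, ← lintegral_smul_measure, measure_univ_smul_normalize]

variable {N : ℕ}

/-- The unnormalized particle measures `γ^N_n`. -/
def gammaN (x : ∀ n, Fin N → E n) (n : ℕ) : Measure (E n) :=
  ENNReal.ofReal (𝓜.particleMass x n) • empirical (x n)

/-- The one-step predictions of the unnormalized particle measures `γ^N_n`. -/
def gammaHat (x : ∀ n, Fin N → E n) : ∀ n, Measure (E n)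
  | 0 => 𝓜.μ 0
  | n + 1 => (𝓜.gammaN x n).bind (𝓜.Qstep n) + 𝓜.μ (n + 1)

/-- The one-step predictions of the occupation measures `η^N_n`. -/
def etaHat (x : ∀ n, Fin N → E n) : ∀ n, Measure (E n)
  | 0 => 𝓜.η 0
  | n + 1 => 𝓜.Γ₂ n (𝓜.particleMass x n).toNNReal (empirical (x n))

theorem particleMass_mem (hN : 1 ≤ N) (x : ∀ n, Fin N → E n) (n : ℕ) :
    0 < 𝓜.particleMass x n ∧
      𝓜.particleMass x n ∈ Set.Icc (𝓜.mMinus n) (𝓜.mPlus n) := by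
  have := fun p => isProbabilityMeasure_empirical hN (x p)
  exact 𝓜.mem_Icc_of_recursion (fun p => empirical (x p)) rfl (fun p => rfl) n

theorem isFiniteMeasure_gammaN (hN : 1 ≤ N) (x : ∀ n, Fin N → E n) (n : ℕ) :
    IsFiniteMeasure (𝓜.gammaN x n) := by
  have := isProbabilityMeasure_empirical hN (x n)
  exact Measure.smul_finite _ ENNReal.ofReal_ne_top

/-- The particle mass at time `n + 1` is already known at time `n`, so the prediction and the
particle measure have the same total mass; the sampling only affects the normalized parts. -/
theorem gammaHat_eq (hN : 1 ≤ N) (x : ∀ n, Fin N → E n) (n : ℕ) :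
    𝓜.gammaHat x n = ENNReal.ofReal (𝓜.particleMass x n) • 𝓜.etaHat x n := by
  cases n with
  | zero =>
    change 𝓜.μ 0 = ENNReal.ofReal ((𝓜.μ 0).real Set.univ) • normalize (𝓜.γ 0)
    rw [γ_zero, ofReal_measureReal, measure_univ_smul_normalize]
  | succ n =>
    have := isProbabilityMeasure_empirical hN (x n)
    have hm := (𝓜.particleMass_mem hN x n).1
    have h := 𝓜.smul_Γ₂ n (𝓜.particleMass x n).toNNReal (empirical (x n)) (by simpa using hm)
    rw [Real.coe_toNNReal _ hm.le] at h
    exact h.symm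

theorem isProbabilityMeasure_etaHat (𝓚 : 𝓜.McKean) (hN : 1 ≤ N) (x : ∀ n, Fin N → E n) (n : ℕ) :
    IsProbabilityMeasure (𝓜.etaHat x n) := by
  cases n with
  | zero => exact 𝓜.isProbabilityMeasure_η 0
  | succ n =>
    have h1 := isProbabilityMeasure_empirical hN (x n)
    rw [etaHat, ← 𝓚.transport n _ _ (by simpa using (𝓜.particleMass_mem hN x n).1) h1]
    have h2 := 𝓚.markov n (𝓜.particleMass x n).toNNReal _ h1
    have : IsProbabilityMeasure (𝓚.K n (𝓜.particleMass x n).toNNReal (empirical (x n)) ∘ₘ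
      empirical (x n)) := inferInstance
    exact this

theorem integral_gammaN (hN : 1 ≤ N) (x : ∀ n, Fin N → E n) (n : ℕ) (f : E n → ℝ) :
    ∫ y, f y ∂(𝓜.gammaN x n) = 𝓜.particleMass x n * ∫ y, f y ∂(empirical (x n)) := by
  rw [gammaN, integral_smul_measure, ENNReal.toReal_ofReal (𝓜.particleMass_mem hN x n).1.le,
    smul_eq_mul]

theorem integral_gammaHat (hN : 1 ≤ N) (x : ∀ n, Fin N → E n) (n : ℕ) (f : E n → ℝ) :
    ∫ y, f y ∂(𝓜.gammaHat x n) = 𝓜.particleMass x n * ∫ y, f y ∂(𝓜.etaHat x n) := by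
  rw [gammaHat_eq _ hN, integral_smul_measure,
    ENNReal.toReal_ofReal (𝓜.particleMass_mem hN x n).1.le, smul_eq_mul]

theorem flow_gammaHat_zero (x : ∀ n, Fin N → E n) (n : ℕ) {f : E n → ℝ} (hf : IsBddMeas f) :
    𝓜.flow 0 n (𝓜.gammaHat x 0) f = ∫ y, f y ∂(𝓜.γ n) := by
  rw [gammaHat, ← γ_zero, 𝓜.flow_γ (Nat.zero_le n) hf]

theorem flow_gammaHat_succ (hN : 1 ≤ N) (x : ∀ n, Fin N → E n) {p n : ℕ} (h : p < n) {f : E n → ℝ}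
    (hf : IsBddMeas f) :
    𝓜.flow (p + 1) n (𝓜.gammaHat x (p + 1)) f = 𝓜.flow p n (𝓜.gammaN x p) f := by
  have := 𝓜.isFiniteMeasure_gammaN hN x p
  exact 𝓜.flow_step h _ hf

theorem flow_gammaN_sub (hN : 1 ≤ N) (x : ∀ n, Fin N → E n) (p n : ℕ) (f : E n → ℝ) :
    𝓜.flow p n (𝓜.gammaN x p) f - 𝓜.flow p n (𝓜.gammaHat x p) f =
      𝓜.particleMass x p *
        (∫ y, 𝓜.act p n f y ∂(empirical (x p)) - ∫ y, 𝓜.act p n f y ∂(𝓜.etaHat x p)) := by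
  rw [flow, flow, integral_gammaN _ hN, integral_gammaHat _ hN]
  ring

theorem flow_gammaHat_self (𝓚 : 𝓜.McKean) (hN : 1 ≤ N) (x : ∀ n, Fin N → E n) (n : ℕ) :
    (𝓜.flow n n (𝓜.gammaHat x n) fun _ => 1) = 𝓜.particleMass x n := by
  have := 𝓜.isProbabilityMeasure_etaHat 𝓚 hN x n
  rw [𝓜.flow_self n _ (isBddMeas_const 1), integral_gammaHat _ hN]
  simp

theorem measurable_flow_empirical (p n : ℕ) {f : E n → ℝ} (hf : IsBddMeas f) :
    Measurable fun z : ℝ≥0 × (Fin N → E p) => 𝓜.flow p n ((z.1 : ℝ≥0∞) • empirical z.2) f := by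
  have h := (𝓜.isBddMeas_act p n hf).1
  simp only [flow, integral_smul_measure, integral_empirical _ h, ENNReal.coe_toReal, smul_eq_mul]
  have h2 : ∀ i, Measurable fun z : ℝ≥0 × (Fin N → E p) => 𝓜.act p n f (z.2 i) := fun i =>
    h.comp ((measurable_pi_apply i).comp measurable_snd)
  fun_prop

/-! ### The conditional laws of the particles -/

variable {Ω : Type v}

theorem measurable_particleMass [MeasurableSpace Ω] {ξ : ∀ n, Ω → Fin N → E n} {n : ℕ}
    (h : ∀ p < n, Measurable (ξ p)) :
    Measurable fun ω => 𝓜.particleMass (fun k => ξ k ω) n := by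
  induction n with
  | zero => exact measurable_const
  | succ n ih =>
    simp only [particleMass, integral_empirical _ (𝓜.measurable_G n)]
    have h1 := ih fun p hp => h p (by omega)
    have h2 : ∀ i, Measurable fun ω => 𝓜.G n (ξ n ω i) := fun i =>
      (𝓜.measurable_G n).comp ((measurable_pi_apply i).comp (h n (Nat.lt_succ_self n)))
    fun_prop

variable {𝓜} in
/-- The transition of the `i`-th particle, as a kernel from the pairs (mass, configuration). -/
def McKean.kernel (𝓚 : 𝓜.McKean) (n : ℕ) (i : Fin N) :
    Kernel (ℝ≥0 × (Fin N → E n)) (E (n + 1)) where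
  toFun z := 𝓚.K n z.1 (empirical z.2) (z.2 i)
  measurable' := Measure.measurable_of_measurable_coe _ fun A hA => 𝓚.measurable n N i A hA

variable {𝓜} in
theorem McKean.isMarkovKernel_kernel (𝓚 : 𝓜.McKean) (hN : 1 ≤ N) (n : ℕ) (i : Fin N) :
    IsMarkovKernel (𝓚.kernel n i) := by
  refine ⟨fun z => ?_⟩
  have := 𝓚.markov n z.1 _ (isProbabilityMeasure_empirical hN z.2)
  exact this.isProbabilityMeasure (z.2 i)

variable {𝓜} [MeasurableSpace Ω] {Pr : Measure Ω} [IsProbabilityMeasure Pr]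
  {ξ : ∀ n, Ω → Fin N → E n} {𝓚 : 𝓜.McKean}

/-- The particles at time `n + 1` depend on the past only through the particle mass and the
configuration at time `n`. -/
theorem IsParticleModel.hasCondLaw_succ (hξ : 𝓜.IsParticleModel 𝓚 N Pr ξ)
    [∀ n (i : Fin N), IsMarkovKernel (𝓚.kernel n i)] (n : ℕ) :
    HasCondLaw Pr (fun ω => ((𝓜.particleMass (fun k => ξ k ω) n).toNNReal, ξ n ω)) (ξ (n + 1))
      (𝓚.kernel n) := by
  have hz : ∀ m : MeasurableSpace Ω, (∀ p < n + 1, Measurable[m] (ξ p)) →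
      Measurable[m] fun ω => ((𝓜.particleMass (fun k => ξ k ω) n).toNNReal, ξ n ω) := fun m hm =>
    (𝓜.measurable_particleMass fun p hp => hm p (by omega)).real_toNNReal.prodMk (hm n (by omega))
  refine HasCondLaw.of_condExp
    (iSup_le fun p : Fin (n + 1) => (hξ.measurable (p : ℕ)).comap_le) (hz _ fun p hp => ?_)
    (hξ.measurable (n + 1)) (hξ.step n)
  exact measurable_iff_comap_le.2 (le_iSup (fun p : Fin (n + 1) =>
    MeasurableSpace.comap (ξ p) inferInstance) ⟨p, hp⟩)

/-- The particles at each time `p` (the initial time included) are conditionally independent given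
some variable `z`, of which the predicted measures at time `p` are functions. -/
theorem IsParticleModel.exists_hasCondLaw (hξ : 𝓜.IsParticleModel 𝓚 N Pr ξ) (hN : 1 ≤ N)
    (p : ℕ) :
    ∃ (Z : Type u) (_ : MeasurableSpace Z) (z : Ω → Z) (κ : Fin N → Kernel Z (E p))
      (_ : ∀ i, IsMarkovKernel (κ i)), HasCondLaw Pr z (ξ p) κ ∧
      (∀ f : E p → ℝ, IsBddMeas f → ∀ ω,
        (N : ℝ)⁻¹ * ∑ i, ∫ y, f y ∂(κ i (z ω)) = ∫ y, f y ∂(𝓜.etaHat (fun k => ξ k ω) p)) ∧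
      ∀ (n : ℕ) (f : E n → ℝ), p ≤ n → IsBddMeas f → ∃ F : Z → ℝ, Measurable F ∧
        ∀ ω, F (z ω) = 𝓜.flow p n (𝓜.gammaHat (fun k => ξ k ω) p) f := by
  cases p with
  | zero =>
    refine ⟨PUnit, inferInstance, fun _ => PUnit.unit, fun _ => Kernel.const _ (𝓜.η 0),
      fun _ => inferInstance, ⟨measurable_const, hξ.measurable 0, ?_⟩, fun f hf ω => ?_,
      fun n f hn hf => ⟨fun _ => 𝓜.flow 0 n (𝓜.μ 0) f, measurable_const, fun ω => rfl⟩⟩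
    · refine Measure.ext_of_lintegral _ fun F hF => ?_
      rw [lintegral_map hF (measurable_const.prodMk (hξ.measurable 0)),
        Measure.lintegral_compProd hF,
        lintegral_map (Measurable.lintegral_kernel_prod_right' hF) measurable_const]
      have h := lintegral_map (μ := Pr) (f := fun y => F (PUnit.unit, y)) (g := ξ 0) (by fun_prop)
        (hξ.measurable 0)
      rw [← h, hξ.init]
      simp only [lintegral_const, measure_univ, mul_one]
      rfl
    · have hN0 : (N : ℝ) ≠ 0 := by exact_mod_cast (by omega : N ≠ 0)
      simp [etaHat, hN0]
  | succ p =>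
    have := fun n (i : Fin N) => 𝓚.isMarkovKernel_kernel hN n i
    refine ⟨ℝ≥0 × (Fin N → E p), inferInstance, _, 𝓚.kernel p, inferInstance,
      hξ.hasCondLaw_succ p, fun f hf ω => ?_, fun n f hn hf => ⟨_,
        𝓜.measurable_flow_empirical p n hf, fun ω => ?_⟩⟩
    · have h1 := isProbabilityMeasure_empirical hN (ξ p ω)
      have h2 := 𝓚.markov p (𝓜.particleMass (fun k => ξ k ω) p).toNNReal _ h1
      rw [etaHat, ← 𝓚.transport p _ _ (by simpa using (𝓜.particleMass_mem hN _ p).1) h1,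
        hf.integral_bind, integral_empirical _ (hf.integral_kernel _).1]
      rfl
    · exact (𝓜.flow_gammaHat_succ hN _ hn hf).symm

end Model

/-! ### Moment inequalities -/

theorem IsBddMeas.integral_add_sq {Ω : Type*} [MeasurableSpace Ω] {Pr : Measure Ω}
    [IsFiniteMeasure Pr] {A D : Ω → ℝ} (hA : IsBddMeas A) (hD : IsBddMeas D) :
    ∫ ω, (A ω + D ω) ^ 2 ∂Pr =
      ∫ ω, A ω ^ 2 ∂Pr + 2 * ∫ ω, A ω * D ω ∂Pr + ∫ ω, D ω ^ 2 ∂Pr := by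
  have h1 := (hA.mul hA).integrable Pr
  have h2 := ((hA.mul hD).integrable Pr).const_mul 2
  have h3 := (hD.mul hD).integrable Pr
  have h12 : Integrable (fun ω => A ω * A ω + 2 * (A ω * D ω)) Pr := h1.add h2
  simp only [sq]
  rw [← integral_const_mul, ← integral_add h1 h2, ← integral_add h12 h3]
  congr 1
  ext ω
  ring

/-- Minkowski's inequality, for the `r`-th moments. -/
theorem rpow_integral_sum_le {Ω ι : Type*} [MeasurableSpace Ω] {Pr : Measure Ω}
    {s : Finset ι} {X : ι → Ω → ℝ} (hX : ∀ i ∈ s, Measurable (X i)) {C : ι → ℝ}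
    (hC0 : ∀ i ∈ s, 0 ≤ C i) {r : ℝ} (hr : 1 ≤ r)
    (hC : ∀ i ∈ s, ∫⁻ ω, ENNReal.ofReal (|X i ω| ^ r) ∂Pr ≤ ENNReal.ofReal (C i ^ r)) :
    (∫ ω, |∑ i ∈ s, X i ω| ^ r ∂Pr) ^ (1 / r) ≤ ∑ i ∈ s, C i := by
  have hr0 : 0 < r := by linarith
  have hp0 : ENNReal.ofReal r ≠ 0 := by simpa using hr0
  have hp1 : (1 : ℝ≥0∞) ≤ ENNReal.ofReal r := by simpa using hr
  have hnorm : ∀ Y : Ω → ℝ, eLpNorm Y (ENNReal.ofReal r) Pr =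
      (∫⁻ ω, ENNReal.ofReal (|Y ω| ^ r) ∂Pr) ^ (1 / r) := by
    intro Y
    rw [eLpNorm_eq_lintegral_rpow_enorm_toReal hp0 ENNReal.ofReal_ne_top,
      ENNReal.toReal_ofReal hr0.le]
    congr 1
    refine lintegral_congr fun ω => ?_
    rw [Real.enorm_eq_ofReal_abs, ENNReal.ofReal_rpow_of_nonneg (abs_nonneg _) hr0.le]
  have hsum : eLpNorm (∑ i ∈ s, X i) (ENNReal.ofReal r) Pr ≤ ENNReal.ofReal (∑ i ∈ s, C i) := by
    refine (eLpNorm_sum_le (fun i hi => (hX i hi).aestronglyMeasurable) hp1).trans ?_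
    rw [ENNReal.ofReal_sum_of_nonneg hC0]
    refine Finset.sum_le_sum fun i hi => ?_
    rw [hnorm]
    refine (ENNReal.rpow_le_rpow (hC i hi) (by positivity)).trans_eq ?_
    rw [← ENNReal.ofReal_rpow_of_nonneg (hC0 i hi) hr0.le, ← ENNReal.rpow_mul,
      mul_one_div_cancel hr0.ne', ENNReal.rpow_one]
  rw [hnorm] at hsum
  have h := ENNReal.toReal_mono ENNReal.ofReal_ne_top hsum
  rw [ENNReal.toReal_ofReal (Finset.sum_nonneg hC0), ← ENNReal.toReal_rpow] at h
  rw [integral_eq_lintegral_of_nonneg_ae (Filter.Eventually.of_forall fun ω => by positivity)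
    ((Finset.measurable_fun_sum _ hX).abs.pow_const r).aestronglyMeasurable]
  simpa only [Finset.sum_apply] using h

namespace Model

variable {E : ℕ → Type u} [∀ n, MeasurableSpace (E n)] {𝓜 : Model E} {N : ℕ}
  {Ω : Type v} [MeasurableSpace Ω] {Pr : Measure Ω}
  {ξ : ∀ n, Ω → Fin N → E n} {𝓚 : 𝓜.McKean}

/-! ### Local errors -/

theorem IsParticleModel.measurable_particleMass (hξ : 𝓜.IsParticleModel 𝓚 N Pr ξ) (n : ℕ) :
    Measurable fun ω => 𝓜.particleMass (fun k => ξ k ω) n :=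
  𝓜.measurable_particleMass fun p _ => hξ.measurable p

theorem IsParticleModel.measurable_flow_gammaN (hξ : 𝓜.IsParticleModel 𝓚 N Pr ξ) (p n : ℕ)
    {f : E n → ℝ} (hf : IsBddMeas f) :
    Measurable fun ω => 𝓜.flow p n (𝓜.gammaN (fun k => ξ k ω) p) f :=
  (𝓜.measurable_flow_empirical p n hf).comp
    ((hξ.measurable_particleMass p).real_toNNReal.prodMk (hξ.measurable p))

theorem IsParticleModel.measurable_flow_gammaHat (hξ : 𝓜.IsParticleModel 𝓚 N Pr ξ) (hN : 1 ≤ N)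
    {p n : ℕ} (h : p ≤ n) {f : E n → ℝ} (hf : IsBddMeas f) :
    Measurable fun ω => 𝓜.flow p n (𝓜.gammaHat (fun k => ξ k ω) p) f := by
  cases p with
  | zero => simp only [gammaHat]; exact measurable_const
  | succ p =>
    have := fun ω => 𝓜.flow_gammaHat_succ hN (fun k => ξ k ω) h hf
    simp only [this]
    exact hξ.measurable_flow_gammaN p n hf

theorem measureReal_gammaN (hN : 1 ≤ N) (x : ∀ n, Fin N → E n) (n : ℕ) :
    (𝓜.gammaN x n).real Set.univ = 𝓜.particleMass x n := by
  have := isProbabilityMeasure_empirical hN (x n)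
  have h := 𝓜.integral_gammaN hN x n fun _ => 1
  simpa using h

theorem measureReal_gammaHat (𝓚 : 𝓜.McKean) (hN : 1 ≤ N) (x : ∀ n, Fin N → E n) (n : ℕ) :
    (𝓜.gammaHat x n).real Set.univ = 𝓜.particleMass x n := by
  have := 𝓜.isProbabilityMeasure_etaHat 𝓚 hN x n
  have h := 𝓜.integral_gammaHat hN x n fun _ => 1
  simpa using h

theorem isFiniteMeasure_gammaHat (𝓚 : 𝓜.McKean) (hN : 1 ≤ N) (x : ∀ n, Fin N → E n) (n : ℕ) :
    IsFiniteMeasure (𝓜.gammaHat x n) := by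
  have := 𝓜.isProbabilityMeasure_etaHat 𝓚 hN x n
  rw [𝓜.gammaHat_eq hN]
  exact Measure.smul_finite _ ENNReal.ofReal_ne_top

theorem exists_abs_flow_le (𝓜 : Model E) (p n : ℕ) {f : E n → ℝ} (hf : IsBddMeas f) :
    ∃ C, ∀ γ : Measure (E p), IsFiniteMeasure γ → γ.real Set.univ ≤ 𝓜.mPlus p →
      |𝓜.flow p n γ f| ≤ C := by
  obtain ⟨-, C, hC⟩ := 𝓜.isBddMeas_act p n hf
  have hC0 : 0 ≤ C := (𝓜.nonempty p).elim fun x => (abs_nonneg _).trans (hC x)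
  refine ⟨C * 𝓜.mPlus p + |∑ q ∈ Finset.Ioc p n, ∫ x, 𝓜.act q n f x ∂(𝓜.μ q)|,
    fun γ _ hγ => (abs_add_le _ _).trans ?_⟩
  gcongr
  have h := norm_integral_le_of_norm_le_const (μ := γ) (f := 𝓜.act p n f) (C := C)
    (Filter.Eventually.of_forall hC)
  exact h.trans (by gcongr)

theorem IsParticleModel.isBddMeas_flow_gammaN (hξ : 𝓜.IsParticleModel 𝓚 N Pr ξ)
    (hN : 1 ≤ N) (p n : ℕ) {f : E n → ℝ} (hf : IsBddMeas f) :
    IsBddMeas fun ω => 𝓜.flow p n (𝓜.gammaN (fun k => ξ k ω) p) f := by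
  refine ⟨hξ.measurable_flow_gammaN p n hf, ?_⟩
  obtain ⟨C, hC⟩ := 𝓜.exists_abs_flow_le p n hf
  exact ⟨C, fun ω => hC _ (𝓜.isFiniteMeasure_gammaN hN _ p)
    ((measureReal_gammaN hN _ p).trans_le (𝓜.particleMass_mem hN _ p).2.2)⟩

theorem IsParticleModel.isBddMeas_flow_gammaHat (hξ : 𝓜.IsParticleModel 𝓚 N Pr ξ)
    (hN : 1 ≤ N) {p n : ℕ} (h : p ≤ n) {f : E n → ℝ} (hf : IsBddMeas f) :
    IsBddMeas fun ω => 𝓜.flow p n (𝓜.gammaHat (fun k => ξ k ω) p) f := by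
  refine ⟨hξ.measurable_flow_gammaHat hN h hf, ?_⟩
  obtain ⟨C, hC⟩ := 𝓜.exists_abs_flow_le p n hf
  exact ⟨C, fun ω => hC _ (isFiniteMeasure_gammaHat 𝓚 hN _ p)
    ((measureReal_gammaHat 𝓚 hN _ p).trans_le (𝓜.particleMass_mem hN _ p).2.2)⟩

variable [IsProbabilityMeasure Pr]

/-- The local sampling error at time `p`, propagated by the normalized flow to the time `n`, has the
order `N ^ (-1/2)`. -/
theorem IsParticleModel.lintegral_local_error_le (hξ : 𝓜.IsParticleModel 𝓚 N Pr ξ) (hN : 1 ≤ N)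
    {p n : ℕ} (h : p ≤ n) {f : E n → ℝ} (hf : IsOscOne f) {r : ℝ} (hr : 1 ≤ r) :
    ∫⁻ ω, ENNReal.ofReal (|𝓜.nflow p n (𝓜.gammaN (fun k => ξ k ω) p) f -
      𝓜.nflow p n (𝓜.gammaHat (fun k => ξ k ω) p) f| ^ r) ∂Pr ≤
      ENNReal.ofReal ((2 * r * 𝓜.localConst p n / √N) ^ r) := by
  have hb := hf.isBddMeas
  have hr0 : 0 < r := by linarith
  obtain ⟨Z, _, z, κ, _, hz, hmean, hF⟩ := hξ.exists_hasCondLaw hN p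
  obtain ⟨F, hFm, hF'⟩ := hF n f h hb
  obtain ⟨F₁, hFm₁, hF₁'⟩ := hF n _ h (isBddMeas_const 1)
  have hact := 𝓜.isBddMeas_act p n hb
  have htot := 𝓜.isBddMeas_tot p n
  set g : Z × E p → ℝ := fun w => 𝓜.act p n f w.2 - F w.1 / F₁ w.1 * 𝓜.tot p n w.2 with hg
  have hgm : Measurable g := (hact.1.comp measurable_snd).sub
    (((hFm.comp measurable_fst).div (hFm₁.comp measurable_fst)).mul (htot.1.comp measurable_snd))
  have hgz : ∀ ω, (fun y => g (z ω, y)) =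
      𝓜.centred p n (𝓜.gammaHat (fun k => ξ k ω) p) f := by
    intro ω
    ext y
    simp only [hg, hF', hF₁', centred, nflow]
  have hC : ∀ ω y, |g (z ω, y)| ≤ 𝓜.normQ p n * 𝓜.spread p n := by
    intro ω y
    have h1 := congrFun (hgz ω) y
    have := isFiniteMeasure_gammaHat 𝓚 hN (fun k => ξ k ω) p
    have hm := 𝓜.particleMass_mem hN (fun k => ξ k ω) p
    rw [h1]
    refine 𝓜.abs_centred_le h _ ?_ ?_ hf y
    · rw [measureReal_gammaHat 𝓚 hN]; exact hm.1
    · rw [measureReal_gammaHat 𝓚 hN]; exact hm.2.1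
  have hnorm := 𝓜.normQ_pos h
  have hgain := 𝓜.gain_nonneg h
  have hspread := 𝓜.spread_nonneg h
  have key := hz.lintegral_rpow_mean_le hN hgm (mul_nonneg hnorm.le hspread) hC hr
    (W := fun _ => 1) measurable_const
  simp only [one_mul, lintegral_const, measure_univ, mul_one] at key
  have hpt : ∀ ω, ENNReal.ofReal (|𝓜.nflow p n (𝓜.gammaN (fun k => ξ k ω) p) f -
      𝓜.nflow p n (𝓜.gammaHat (fun k => ξ k ω) p) f| ^ r) ≤
      ENNReal.ofReal ((𝓜.gain p n / 𝓜.normQ p n) ^ r) *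
        ENNReal.ofReal (|(N : ℝ)⁻¹ * ∑ i, (g (z ω, ξ p ω i) -
          ∫ x, g (z ω, x) ∂(κ i (z ω)))| ^ r) := by
    intro ω
    have h1 := isProbabilityMeasure_empirical hN (ξ p ω)
    have h2 := 𝓜.isProbabilityMeasure_etaHat 𝓚 hN (fun k => ξ k ω) p
    have hm := 𝓜.particleMass_mem hN (fun k => ξ k ω) p
    have h3 := 𝓜.abs_nflow_sub_nflow_le h (empirical (ξ p ω)) (𝓜.etaHat (fun k => ξ k ω) p)
      hm.1 hm.2.2 hb
    rw [← 𝓜.gammaHat_eq hN, ← hgz] at h3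
    have hgω : IsBddMeas fun y => g (z ω, y) := by
      rw [hgz]; exact 𝓜.isBddMeas_centred p n _ hb
    rw [integral_empirical _ hgω.1, ← hmean _ hgω, ← mul_sub, ← Finset.sum_sub_distrib] at h3
    rw [← ENNReal.ofReal_mul (by positivity), ← Real.mul_rpow (by positivity) (abs_nonneg _)]
    exact ENNReal.ofReal_le_ofReal (Real.rpow_le_rpow (abs_nonneg _) h3 hr0.le)
  refine (lintegral_mono hpt).trans ?_
  rw [lintegral_const_mul' _ _ ENNReal.ofReal_ne_top]
  refine (mul_le_mul_right key _).trans_eq ?_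
  rw [← ENNReal.ofReal_mul (by positivity), ← Real.mul_rpow (by positivity) (by positivity),
    localConst]
  congr 2
  field_simp
  ring

/-- The particle measures have no bias with respect to their one-step predictions, even after
multiplication by a function of the predicted mass. -/
theorem IsParticleModel.integral_mul_flow_sub (hξ : 𝓜.IsParticleModel 𝓚 N Pr ξ) (hN : 1 ≤ N)
    {p n : ℕ} (h : p ≤ n) {f : E n → ℝ} (hf : IsBddMeas f) {φ : ℝ → ℝ} (hφ : Measurable φ)
    {C : ℝ} (hC : ∀ ω, |φ (𝓜.flow p n (𝓜.gammaHat (fun k => ξ k ω) p) fun _ => 1)| ≤ C) :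
    ∫ ω, φ (𝓜.flow p n (𝓜.gammaHat (fun k => ξ k ω) p) fun _ => 1) *
      (𝓜.flow p n (𝓜.gammaN (fun k => ξ k ω) p) f -
        𝓜.flow p n (𝓜.gammaHat (fun k => ξ k ω) p) f) ∂Pr = 0 := by
  obtain ⟨Z, _, z, κ, _, hz, hmean, hF⟩ := hξ.exists_hasCondLaw hN p
  obtain ⟨F₁, hFm₁, hF₁'⟩ := hF n _ h (isBddMeas_const 1)
  obtain ⟨F₀, hFm₀, hF₀'⟩ := hF p _ le_rfl (isBddMeas_const 1)
  simp only [𝓜.flow_gammaHat_self 𝓚 hN] at hF₀'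
  obtain ⟨hactm, D, hD⟩ := 𝓜.isBddMeas_act p n hf
  have hzm := hz.measurable_fst
  have hξm := hξ.measurable p
  set g : Z × E p → ℝ := fun w => φ (F₁ w.1) * F₀ w.1 * 𝓜.act p n f w.2 with hg
  have hgm : Measurable g := ((hφ.comp (hFm₁.comp measurable_fst)).mul
    (hFm₀.comp measurable_fst)).mul (hactm.comp measurable_snd)
  have hgC : ∀ ω y, |g (z ω, y)| ≤ C * 𝓜.mPlus p * D := by
    intro ω y
    have hm := 𝓜.particleMass_mem hN (fun k => ξ k ω) p
    simp only [hg, abs_mul, hF₁', hF₀', abs_of_pos hm.1]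
    have hC0 := (abs_nonneg _).trans (hC ω)
    have hP := (𝓜.mPlus_pos p).le
    gcongr
    · exact hm.1.le
    · exact hC ω
    · exact hm.2.2
    · exact hD y
  have he : ∀ ω, φ (𝓜.flow p n (𝓜.gammaHat (fun k => ξ k ω) p) fun _ => 1) *
      (𝓜.flow p n (𝓜.gammaN (fun k => ξ k ω) p) f -
        𝓜.flow p n (𝓜.gammaHat (fun k => ξ k ω) p) f) =
      (N : ℝ)⁻¹ * ∑ i, (g (z ω, ξ p ω i) - ∫ y, g (z ω, y) ∂(κ i (z ω))) := by
    intro ω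
    rw [𝓜.flow_gammaN_sub hN, integral_empirical _ hactm, ← hmean _ ⟨hactm, D, hD⟩]
    simp only [hg, hF₁', hF₀', integral_const_mul, Finset.sum_sub_distrib, ← Finset.mul_sum]
    ring
  have hgi : ∀ i, Integrable (fun ω => g (z ω, ξ p ω i)) Pr := fun i =>
    Integrable.of_bound (hgm.comp (hzm.prodMk ((measurable_pi_apply i).comp
      hξm))).aestronglyMeasurable _ (Filter.Eventually.of_forall fun ω => hgC ω _)
  have hκi : ∀ i, Integrable (fun ω => ∫ y, g (z ω, y) ∂(κ i (z ω))) Pr := fun i => by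
    have hm : Measurable fun w => ∫ y, g (w, y) ∂(κ i w) :=
      (StronglyMeasurable.integral_kernel_prod_right' hgm.stronglyMeasurable).measurable
    refine Integrable.of_bound (hm.comp hzm).aestronglyMeasurable (C * 𝓜.mPlus p * D)
      (Filter.Eventually.of_forall fun ω => ?_)
    have := norm_integral_le_of_norm_le_const (μ := κ i (z ω)) (f := fun y => g (z ω, y))
      (Filter.Eventually.of_forall (hgC ω))
    simpa using this
  simp only [he]
  have hgκ : ∀ i, Integrable (fun ω => g (z ω, ξ p ω i) - ∫ y, g (z ω, y) ∂(κ i (z ω))) Pr :=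
    fun i => (hgi i).sub (hκi i)
  rw [integral_const_mul, integral_finsetSum _ fun i _ => hgκ i]
  simp only [integral_sub (hgi _) (hκi _), hz.integral_eq hgm hgC, sub_self, Finset.sum_const_zero,
    mul_zero]

/-- The variance of a martingale increment, from the moment bound with `r = 2` and with the square
of the random mass as a weight. -/
theorem IsParticleModel.integral_sq_flow_sub_le (hξ : 𝓜.IsParticleModel 𝓚 N Pr ξ) (hN : 1 ≤ N)
    {p n : ℕ} (h : p ≤ n) :
    ∫ ω, ((𝓜.flow p n (𝓜.gammaN (fun k => ξ k ω) p) fun _ => 1) -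
        𝓜.flow p n (𝓜.gammaHat (fun k => ξ k ω) p) fun _ => 1) ^ 2 ∂Pr ≤
      64 * 𝓜.normQ p n ^ 2 / N * ∫ ω, 𝓜.particleMass (fun k => ξ k ω) p ^ 2 ∂Pr := by
  obtain ⟨Z, _, z, κ, _, hz, hmean, hF⟩ := hξ.exists_hasCondLaw hN p
  obtain ⟨F₀, hFm₀, hF₀'⟩ := hF p _ le_rfl (isBddMeas_const 1)
  simp only [𝓜.flow_gammaHat_self 𝓚 hN] at hF₀'
  have htot := 𝓜.isBddMeas_tot p n
  have hN0 : (0 : ℝ) < N := by exact_mod_cast hN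
  have hnorm := 𝓜.normQ_pos h
  have key := hz.lintegral_rpow_mean_le hN (g := fun w => 𝓜.tot p n w.2)
    (htot.1.comp measurable_snd) hnorm.le
    (fun ω y => (abs_of_pos (𝓜.tot_pos h y)).trans_le (𝓜.tot_le_normQ h y)) one_le_two
    (W := fun w => ENNReal.ofReal (F₀ w ^ 2)) (hFm₀.pow_const 2).ennreal_ofReal
  have he : ∀ ω, ENNReal.ofReal (((𝓜.flow p n (𝓜.gammaN (fun k => ξ k ω) p) fun _ => 1) -
        𝓜.flow p n (𝓜.gammaHat (fun k => ξ k ω) p) fun _ => 1) ^ 2) =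
      ENNReal.ofReal (F₀ (z ω) ^ 2) * ENNReal.ofReal (|(N : ℝ)⁻¹ * ∑ i, (𝓜.tot p n (ξ p ω i) -
      ∫ x, 𝓜.tot p n x ∂(κ i (z ω)))| ^ (2 : ℝ)) := by
    intro ω
    rw [𝓜.flow_gammaN_sub hN, act_one, integral_empirical _ htot.1, ← hmean _ htot, hF₀',
      Real.rpow_two, sq_abs, ← ENNReal.ofReal_mul (sq_nonneg _), ← mul_pow, ← mul_sub,
      Finset.sum_sub_distrib]
  have hc : (4 * 2 * 𝓜.normQ p n / √N) ^ (2 : ℝ) = 64 * 𝓜.normQ p n ^ 2 / N := by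
    rw [Real.rpow_two, div_pow, Real.sq_sqrt hN0.le]
    ring
  rw [hc] at key
  simp only [← he] at key
  simp only [hF₀'] at key
  have hi1 := ((hξ.isBddMeas_flow_gammaN hN p n (isBddMeas_const 1)).sub
    (hξ.isBddMeas_flow_gammaHat hN h (isBddMeas_const 1)))
  have hi1 := (hi1.mul hi1).integrable Pr
  have hi2 := hξ.isBddMeas_flow_gammaHat hN (le_refl p) (isBddMeas_const 1)
  simp only [𝓜.flow_gammaHat_self 𝓚 hN] at hi2
  have hi2 := (hi2.mul hi2).integrable Pr
  simp only [← sq] at hi1 hi2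
  rw [← ofReal_integral_eq_lintegral_ofReal hi1 (Filter.Eventually.of_forall fun ω => sq_nonneg _),
    ← ofReal_integral_eq_lintegral_ofReal hi2 (Filter.Eventually.of_forall fun ω => sq_nonneg _),
    ← ENNReal.ofReal_mul (by positivity)] at key
  exact (ENNReal.ofReal_le_ofReal_iff (mul_nonneg (by positivity)
    (integral_nonneg fun ω => sq_nonneg _))).1 key

/-! ### Global errors -/

theorem nflow_self (hN : 1 ≤ N) (x : ∀ n, Fin N → E n) (n : ℕ) {f : E n → ℝ} (hf : IsBddMeas f) :
    𝓜.nflow n n (𝓜.gammaN x n) f = ∫ y, f y ∂(empirical (x n)) := by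
  have := isProbabilityMeasure_empirical hN (x n)
  rw [nflow, 𝓜.flow_self n _ hf, 𝓜.flow_self n _ (isBddMeas_const 1), 𝓜.integral_gammaN hN,
    𝓜.integral_gammaN hN]
  simp [(𝓜.particleMass_mem hN x n).1.ne']

theorem nflow_gammaHat_zero (x : ∀ n, Fin N → E n) (n : ℕ) {f : E n → ℝ} (hf : IsBddMeas f) :
    𝓜.nflow 0 n (𝓜.gammaHat x 0) f = ∫ y, f y ∂(𝓜.η n) := by
  rw [nflow, 𝓜.flow_gammaHat_zero x n hf, 𝓜.flow_gammaHat_zero x n (isBddMeas_const 1),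
    integral_γ, integral_γ]
  simp [(𝓜.mass_mem n).1.ne']

/-- The error at time `n` is the sum of the propagated local errors. -/
theorem sum_nflow_sub (hN : 1 ≤ N) (x : ∀ n, Fin N → E n) (n : ℕ) {f : E n → ℝ}
    (hf : IsBddMeas f) :
    ∑ p ∈ Finset.range (n + 1), (𝓜.nflow p n (𝓜.gammaN x p) f - 𝓜.nflow p n (𝓜.gammaHat x p) f) =
      ∫ y, f y ∂(empirical (x n)) - ∫ y, f y ∂(𝓜.η n) := by
  have h : ∀ k ≤ n, ∑ p ∈ Finset.range (k + 1),
      (𝓜.nflow p n (𝓜.gammaN x p) f - 𝓜.nflow p n (𝓜.gammaHat x p) f) =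
      𝓜.nflow k n (𝓜.gammaN x k) f - ∫ y, f y ∂(𝓜.η n) := by
    intro k
    induction k with
    | zero => intro _; simp [nflow_gammaHat_zero x n hf]
    | succ k ih =>
      intro hk
      rw [Finset.sum_range_succ, ih (by omega)]
      have : 𝓜.nflow (k + 1) n (𝓜.gammaHat x (k + 1)) f = 𝓜.nflow k n (𝓜.gammaN x k) f := by
        rw [nflow, nflow, 𝓜.flow_gammaHat_succ hN x hk hf,
          𝓜.flow_gammaHat_succ hN x hk (isBddMeas_const 1)]
      rw [this]
      ring
  rw [h n le_rfl, nflow_self hN x n hf]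

/-- The mean error bound, from the telescoping sum, Minkowski's inequality and the bounds of the
local errors. -/
theorem meanErrorBound_localConst (𝓜 : Model E) :
    MeanErrorBound.{u, v} 𝓜 (fun r => 2 * |r|)
      fun n => ∑ p ∈ Finset.range (n + 1), 𝓜.localConst p n := by
  intro 𝓚 N hN Ω _ Pr _ ξ hξ n r hr f hf
  have hb := hf.isBddMeas
  have hN0 : (0 : ℝ) < N := by exact_mod_cast hN
  have hsN : 0 < √(N : ℝ) := Real.sqrt_pos.2 hN0
  have h := rpow_integral_sum_le (Pr := Pr) (s := Finset.range (n + 1))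
    (X := fun p ω => 𝓜.nflow p n (𝓜.gammaN (fun k => ξ k ω) p) f -
      𝓜.nflow p n (𝓜.gammaHat (fun k => ξ k ω) p) f)
    (C := fun p => 2 * r * 𝓜.localConst p n / √N) (fun p hp => ?_) (fun p hp => ?_) hr
    fun p hp => hξ.lintegral_local_error_le hN (Finset.mem_range_succ_iff.1 hp) hf hr
  · simp only [sum_nflow_sub hN _ n hb] at h
    calc _ ≤ √N * ∑ p ∈ Finset.range (n + 1), 2 * r * 𝓜.localConst p n / √N := by gcongr
      _ = 2 * |r| * ∑ p ∈ Finset.range (n + 1), 𝓜.localConst p n := by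
        rw [abs_of_pos (by linarith), Finset.mul_sum, Finset.mul_sum]
        refine Finset.sum_congr rfl fun p _ => ?_
        field_simp
  · have hp := Finset.mem_range_succ_iff.1 hp
    exact ((hξ.measurable_flow_gammaN p n hb).div
      (hξ.measurable_flow_gammaN p n (isBddMeas_const 1))).sub
      ((hξ.measurable_flow_gammaHat hN hp hb).div
        (hξ.measurable_flow_gammaHat hN hp (isBddMeas_const 1)))
  · have := 𝓜.localConst_nonneg (Finset.mem_range_succ_iff.1 hp)
    positivity

theorem IsParticleModel.integral_flow_gammaN (hξ : 𝓜.IsParticleModel 𝓚 N Pr ξ) (hN : 1 ≤ N)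
    {p n : ℕ} (h : p ≤ n) {f : E n → ℝ} (hf : IsBddMeas f) :
    ∫ ω, 𝓜.flow p n (𝓜.gammaN (fun k => ξ k ω) p) f ∂Pr = ∫ y, f y ∂(𝓜.γ n) := by
  have hstep : ∀ q ≤ n, ∫ ω, 𝓜.flow q n (𝓜.gammaN (fun k => ξ k ω) q) f ∂Pr =
      ∫ ω, 𝓜.flow q n (𝓜.gammaHat (fun k => ξ k ω) q) f ∂Pr := by
    intro q hq
    have h1 := hξ.integral_mul_flow_sub hN hq hf (φ := fun _ => 1) measurable_const (C := 1)
      (fun ω => by simp)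
    simp only [one_mul] at h1
    rwa [integral_sub ((hξ.isBddMeas_flow_gammaN hN q n hf).integrable Pr)
      ((hξ.isBddMeas_flow_gammaHat hN hq hf).integrable Pr), sub_eq_zero] at h1
  induction p with
  | zero => rw [hstep 0 h]; simp [𝓜.flow_gammaHat_zero _ n hf]
  | succ p ih =>
    rw [hstep _ h]
    simp only [𝓜.flow_gammaHat_succ hN _ h hf]
    exact ih (by omega)

/-- The particle measures `γ^N_n` are unbiased. -/
theorem IsParticleModel.integral_particleMass_mul (hξ : 𝓜.IsParticleModel 𝓚 N Pr ξ) (hN : 1 ≤ N)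
    (n : ℕ) {f : E n → ℝ} (hf : IsBddMeas f) :
    Integrable (fun ω => 𝓜.particleMass (fun k => ξ k ω) n * ∫ x, f x ∂(empirical (ξ n ω))) Pr ∧
    ∫ ω, 𝓜.particleMass (fun k => ξ k ω) n * (∫ x, f x ∂(empirical (ξ n ω))) ∂Pr =
      ∫ x, f x ∂(𝓜.γ n) := by
  have h1 := hξ.isBddMeas_flow_gammaN hN n n hf
  have h2 := hξ.integral_flow_gammaN hN le_rfl hf
  simp only [𝓜.flow_self n _ hf, 𝓜.integral_gammaN hN] at h1 h2
  exact ⟨h1.integrable Pr, h2⟩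

/-- The variance of the particle mass: the increments of the martingale
`p ↦ γ^N_p Q_{p,n}(1) + ∑_{p < q ≤ n} μ_q Q_{q,n}(1)` are orthogonal. -/
theorem IsParticleModel.integral_sq_particleMass_sub_le (hξ : 𝓜.IsParticleModel 𝓚 N Pr ξ)
    (hN : 1 ≤ N) (n : ℕ) :
    ∫ ω, (𝓜.particleMass (fun k => ξ k ω) n - 𝓜.mass n) ^ 2 ∂Pr ≤
      ∑ p ∈ Finset.range n, 64 * 𝓜.normQ p n ^ 2 / N *
        ∫ ω, 𝓜.particleMass (fun k => ξ k ω) p ^ 2 ∂Pr := by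
  have h1 := isBddMeas_const (S := E n) 1
  have key : ∀ k ≤ n,
      ∫ ω, ((𝓜.flow k n (𝓜.gammaHat (fun k => ξ k ω) k) fun _ => 1) - 𝓜.mass n) ^ 2 ∂Pr ≤
      ∑ p ∈ Finset.range k, 64 * 𝓜.normQ p n ^ 2 / N *
        ∫ ω, 𝓜.particleMass (fun k => ξ k ω) p ^ 2 ∂Pr := by
    intro k
    induction k with
    | zero => intro _; simp [𝓜.flow_gammaHat_zero _ n h1, mass]
    | succ k ih =>
      intro hk
      have hk' : k ≤ n := by omega
      rw [Finset.sum_range_succ]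
      simp only [𝓜.flow_gammaHat_succ hN _ hk h1]
      have hM := hξ.isBddMeas_flow_gammaN hN k n h1
      have hM' := hξ.isBddMeas_flow_gammaHat hN hk' h1
      have hD := hM.sub hM'
      have hc := hM'.sub (isBddMeas_const (S := Ω) (𝓜.mass n))
      obtain ⟨C, hC⟩ := hc.2
      have hortho := hξ.integral_mul_flow_sub hN hk' h1 (φ := fun x => x - 𝓜.mass n)
        (by fun_prop) hC
      have hsq := hξ.integral_sq_flow_sub_le hN hk'
      have he : ∀ ω, (𝓜.flow k n (𝓜.gammaN (fun k => ξ k ω) k) fun _ => 1) - 𝓜.mass n =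
          ((𝓜.flow k n (𝓜.gammaHat (fun k => ξ k ω) k) fun _ => 1) - 𝓜.mass n) +
          ((𝓜.flow k n (𝓜.gammaN (fun k => ξ k ω) k) fun _ => 1) -
            𝓜.flow k n (𝓜.gammaHat (fun k => ξ k ω) k) fun _ => 1) := fun ω => by ring
      simp only [he]
      rw [hc.integral_add_sq hD, hortho, mul_zero, add_zero]
      exact add_le_add (ih hk') hsq
  have := key n le_rfl
  simpa only [𝓜.flow_gammaHat_self 𝓚 hN] using this

end Model

/-! ### Elementary sums -/

theorem sum_Ioc_sub {p n : ℕ} (φ : ℕ → ℝ) :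
    ∑ q ∈ Finset.Ioc p n, φ (n - q) = ∑ j ∈ Finset.range (n - p), φ j := by
  refine Finset.sum_nbij' (fun q => n - q) (fun j => n - j) (fun q hq => ?_) (fun j hj => ?_)
    (fun q hq => ?_) (fun j hj => ?_) fun _ _ => rfl <;>
    simp only [Finset.mem_Ioc, Finset.mem_range] at * <;> omega

theorem sum_range_pow_div_le {θ : ℝ} (h0 : 0 ≤ θ) (h1 : θ < 1) {k : ℕ} (hk : 1 ≤ k) (J : ℕ) :
    ∑ j ∈ Finset.range J, θ ^ (j / k) ≤ k / (1 - θ) := by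
  have hshift : ∑ j ∈ Finset.range (k + J), θ ^ (j / k) =
      k + θ * ∑ j ∈ Finset.range J, θ ^ (j / k) := by
    rw [Finset.sum_range_add, Finset.mul_sum]
    congr 1
    · rw [Finset.sum_congr rfl fun j hj => by rw [Nat.div_eq_of_lt (Finset.mem_range.1 hj)]]
      simp
    · refine Finset.sum_congr rfl fun j _ => ?_
      rw [Nat.add_div_left _ (by omega), pow_succ, mul_comm]
  have hmono : ∑ j ∈ Finset.range J, θ ^ (j / k) ≤ ∑ j ∈ Finset.range (k + J), θ ^ (j / k) :=
    Finset.sum_le_sum_of_subset_of_nonneg (Finset.range_mono (by omega))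
      fun _ _ _ => by positivity
  rw [le_div_iff₀ (by linarith)]
  linarith

theorem sum_range_pow_le {ρ : ℝ} (h0 : 0 ≤ ρ) (h1 : ρ < 1) (J : ℕ) :
    ∑ j ∈ Finset.range J, ρ ^ j ≤ 1 / (1 - ρ) := by
  simpa using sum_range_pow_div_le h0 h1 le_rfl J

/-- The discounted sums `v` of a summable sequence `t` are again summable. -/
theorem sum_range_le_of_recursion {ρ B : ℝ} (h0 : 0 ≤ ρ) (h1 : ρ < 1) {t v : ℕ → ℝ}
    (ht : ∀ J, ∑ j ∈ Finset.range J, t j ≤ B) (hv0 : v 0 = 0)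
    (hv : ∀ j, v (j + 1) = ρ * v j + t j) (J : ℕ) :
    ∑ j ∈ Finset.range J, v j ≤ B / (1 - ρ) := by
  have hB : 0 ≤ B := by simpa using ht 0
  rw [le_div_iff₀ (by linarith)]
  induction J with
  | zero => simpa using hB
  | succ J ih =>
    rw [Finset.sum_range_succ', hv0, Finset.sum_congr rfl fun j _ => hv j, Finset.sum_add_distrib,
      ← Finset.mul_sum]
    have := ht J
    have h2 := mul_le_mul_of_nonneg_left ih h0
    nlinarith

/-- If `u` grows at least like `ρ⁻ʲ`, then the weights `u j / ∑ u` concentrate on the last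
indices, and the weighted means of `t` are bounded by its discounted sums `v`. -/
theorem sum_mul_le_of_growth {ρ : ℝ} (h0 : 0 ≤ ρ) {u t v : ℕ → ℝ} (hu : ∀ j, 0 ≤ u j)
    (hgrowth : ∀ j, u j ≤ ρ * u (j + 1)) (ht : ∀ j, 0 ≤ t j) (hv0 : v 0 = 0)
    (hv : ∀ j, v (j + 1) = ρ * v j + t j) (L : ℕ) :
    0 ≤ v L ∧ ∑ j ∈ Finset.range L, u j * t j ≤ v L * ∑ j ∈ Finset.range L, u j := by
  induction L with
  | zero => simp [hv0]
  | succ L ih =>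
    have hU : ∑ j ∈ Finset.range L, u j ≤ ρ * ∑ j ∈ Finset.range (L + 1), u j := by
      rw [Finset.sum_range_succ', mul_add, Finset.mul_sum]
      have := mul_nonneg h0 (hu 0)
      linarith [Finset.sum_le_sum (s := Finset.range L) fun j _ => hgrowth j]
    have hL : u L ≤ ∑ j ∈ Finset.range (L + 1), u j :=
      Finset.single_le_sum (fun j _ => hu j) (Finset.self_mem_range_succ L)
    rw [hv]
    refine ⟨add_nonneg (mul_nonneg h0 ih.1) (ht L), ?_⟩
    rw [Finset.sum_range_succ]
    have h1 := mul_le_mul_of_nonneg_left hU ih.1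
    have h2 := mul_le_mul_of_nonneg_right hL (ht L)
    nlinarith [ih.2]

/-- A discrete Gronwall inequality. -/
theorem le_of_le_mul_sum {δ : ℕ → ℝ} {e : ℝ} (he : 0 ≤ e)
    (h : ∀ n, δ n ≤ e * ∑ p ∈ Finset.range n, (1 + δ p)) (n : ℕ) :
    δ (n + 1) ≤ e * ((n + 1) * (1 + e) ^ n) := by
  refine (h (n + 1)).trans (mul_le_mul_of_nonneg_left ?_ he)
  induction n with
  | zero => simpa using h 0
  | succ n ih =>
    rw [Finset.sum_range_succ]
    have h1 := (h (n + 1)).trans (mul_le_mul_of_nonneg_left ih he)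
    have h2 : (1 : ℝ) ≤ (1 + e) ^ (n + 1) := one_le_pow₀ (by linarith)
    have h3 : (1 + e) * ((n + 1) * (1 + e) ^ n) = (n + 1) * (1 + e) ^ (n + 1) := by ring
    push_cast
    nlinarith

namespace Model

variable {S : Type u} [MeasurableSpace S] (𝓜 : Model fun _ : ℕ => S)

/-! ### Time homogeneous models -/

/-- The Markov transition of a time homogeneous model. -/
def trans : Kernel S S := 𝓜.M 0

instance : IsMarkovKernel 𝓜.trans := 𝓜.markov_M 0

instance isMarkovKernel_trans_pow (k : ℕ) : IsMarkovKernel (𝓜.trans ^ k) := by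
  induction k with
  | zero => exact inferInstanceAs (IsMarkovKernel (Kernel.id : Kernel S S))
  | succ k ih => rw [pow_succ']; exact Kernel.IsMarkovKernel.comp 𝓜.trans (𝓜.trans ^ k)

theorem integral_trans_pow_succ (k : ℕ) {f : S → ℝ} (hf : IsBddMeas f) (x : S) :
    ∫ y, f y ∂((𝓜.trans ^ (k + 1)) x) = ∫ z, ∫ y, f y ∂(𝓜.trans z) ∂((𝓜.trans ^ k) x) := by
  rw [pow_succ']
  exact Kernel.integral_comp (κ := 𝓜.trans ^ k) (η := 𝓜.trans) (hf.integrable _)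

/-- The infimum of the potential function of a time homogeneous model. -/
def gLow : ℝ := ⨅ x, 𝓜.G 0 x

/-- The supremum of the potential function of a time homogeneous model. -/
def gHigh : ℝ := ⨆ x, 𝓜.G 0 x

theorem gLow_pos : 0 < 𝓜.gLow := 𝓜.iInf_G_pos 0

theorem gLow_le (x : S) : 𝓜.gLow ≤ 𝓜.G 0 x := ciInf_le (𝓜.bddBelow_G 0) x

theorem le_gHigh (x : S) : 𝓜.G 0 x ≤ 𝓜.gHigh := le_ciSup (𝓜.bddAbove_G 0) x

theorem gLow_le_gHigh : 𝓜.gLow ≤ 𝓜.gHigh :=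
  (𝓜.nonempty 0).elim fun x => (𝓜.gLow_le x).trans (𝓜.le_gHigh x)

theorem gHigh_pos : 0 < 𝓜.gHigh := 𝓜.gLow_pos.trans_le 𝓜.gLow_le_gHigh

variable {𝓜}

/-- `Q_{p,p+j}` is comparable with `M ^ j`, up to the powers of the extreme values of `G`. -/
theorem IsHomogeneous.act_bounds (h : 𝓜.IsHomogeneous) (p j : ℕ) {f : S → ℝ} (hf : IsBddMeas f)
    (hf0 : ∀ x, 0 ≤ f x) (x : S) :
    𝓜.gLow ^ j * ∫ y, f y ∂((𝓜.trans ^ j) x) ≤ 𝓜.act p (p + j) f x ∧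
      𝓜.act p (p + j) f x ≤ 𝓜.gHigh ^ j * ∫ y, f y ∂((𝓜.trans ^ j) x) := by
  induction j generalizing f with
  | zero =>
    have h1 : ∫ y, f y ∂((𝓜.trans ^ 0) x) = f x := by
      rw [pow_zero]
      exact integral_dirac' _ _ hf.1.stronglyMeasurable
    have h2 : 𝓜.act p (p + 0) f x = f x := congrFun (𝓜.act_self p hf) x
    rw [h1, h2]
    simp
  | succ j ih =>
    have hMf : IsBddMeas fun z => ∫ y, f y ∂(𝓜.trans z) := hf.integral_kernel _
    have hMf0 : ∀ z, 0 ≤ ∫ y, f y ∂(𝓜.trans z) := fun z => integral_nonneg hf0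
    have h1 : 𝓜.act p (p + (j + 1)) f =
        𝓜.act p (p + j) fun z => 𝓜.G 0 z * ∫ y, f y ∂(𝓜.trans z) := by
      have := 𝓜.act_succ (Nat.le_add_right p j) hf
      rw [(h (p + j)).1, (h (p + j)).2.1] at this
      exact this
    have hGf : IsBddMeas fun z => 𝓜.G 0 z * ∫ y, f y ∂(𝓜.trans z) := (𝓜.isBddMeas_G 0).mul hMf
    rw [h1, 𝓜.integral_trans_pow_succ j hf]
    constructor
    · calc _ = 𝓜.gLow * (𝓜.gLow ^ j * ∫ z, ∫ y, f y ∂(𝓜.trans z) ∂((𝓜.trans ^ j) x)) := by ring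
        _ ≤ 𝓜.gLow * 𝓜.act p (p + j) (fun z => ∫ y, f y ∂(𝓜.trans z)) x :=
          mul_le_mul_of_nonneg_left (ih hMf hMf0).1 𝓜.gLow_pos.le
        _ = 𝓜.act p (p + j) (fun z => 𝓜.gLow * ∫ y, f y ∂(𝓜.trans z)) x :=
          (𝓜.act_const_mul p (p + j) _ _ x).symm
        _ ≤ _ := 𝓜.act_mono p (p + j) ((isBddMeas_const _).mul hMf) hGf
          (fun z => mul_le_mul_of_nonneg_right (𝓜.gLow_le z) (hMf0 z)) x
    · calc _ ≤ 𝓜.act p (p + j) (fun z => 𝓜.gHigh * ∫ y, f y ∂(𝓜.trans z)) x :=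
          𝓜.act_mono p (p + j) hGf ((isBddMeas_const _).mul hMf)
            (fun z => mul_le_mul_of_nonneg_right (𝓜.le_gHigh z) (hMf0 z)) x
        _ = 𝓜.gHigh * 𝓜.act p (p + j) (fun z => ∫ y, f y ∂(𝓜.trans z)) x :=
          𝓜.act_const_mul p (p + j) _ _ x
        _ ≤ 𝓜.gHigh * (𝓜.gHigh ^ j * ∫ z, ∫ y, f y ∂(𝓜.trans z) ∂((𝓜.trans ^ j) x)) :=
          mul_le_mul_of_nonneg_left (ih hMf hMf0).2 𝓜.gHigh_pos.le
        _ = _ := by ring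

theorem IsHomogeneous.tot_bounds (h : 𝓜.IsHomogeneous) (p j : ℕ) (x : S) :
    𝓜.gLow ^ j ≤ 𝓜.tot p (p + j) x ∧ 𝓜.tot p (p + j) x ≤ 𝓜.gHigh ^ j := by
  have := h.act_bounds p j (isBddMeas_const 1) (fun _ => zero_le_one) x
  rw [act_one] at this
  simpa using this

/-- A lower bound, uniform in time, of the ratios between the values of `Q_{p,n}(1)`, and of the
ratios between the measures `Q_{p,n}(x, ·)` for `n ≥ p + k`. -/
structure IsMixingRate (𝓜 : Model fun _ : ℕ => S) (k : ℕ) (ε : ℝ) : Prop where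
  one_le : 1 ≤ k
  pos : 0 < ε
  le_one : ε ≤ 1
  act_le : ∀ (p : ℕ) (f : S → ℝ), IsBddMeas f → (∀ x, 0 ≤ f x) → ∀ x y : S,
    ε * 𝓜.act p (p + k) f y ≤ 𝓜.act p (p + k) f x
  tot_le : ∀ (p n : ℕ), p ≤ n → ∀ x y : S, ε * 𝓜.tot p n y ≤ 𝓜.tot p n x

/-- For `n ≥ p + k`, the mixing condition compares the initial states through the first `k` steps;
for `n < p + k`, the bounds of `G` alone suffice. -/
theorem IsHomogeneous.exists_isMixingRate (h : 𝓜.IsHomogeneous) (hmix : 𝓜.IsMixing) :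
    ∃ k ε, IsMixingRate 𝓜 k ε := by
  obtain ⟨k, ε, hk, hε, hM⟩ := hmix
  have hM' : ∀ (f : S → ℝ), IsBddMeas f → (∀ x, 0 ≤ f x) → ∀ x y : S,
      ε * ∫ z, f z ∂((𝓜.trans ^ k) y) ≤ ∫ z, f z ∂((𝓜.trans ^ k) x) := by
    intro f hf hf0 x y
    have hle : ε • (𝓜.trans ^ k) y ≤ (𝓜.trans ^ k) x :=
      Measure.le_iff.2 fun A hA => hM x y A hA
    have := integral_mono_measure hle (Filter.Eventually.of_forall hf0) (hf.integrable _)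
    rwa [integral_smul_nnreal_measure] at this
  have hε1 : (ε : ℝ) ≤ 1 := by
    obtain ⟨x⟩ := 𝓜.nonempty 0
    simpa using hM' (fun _ => 1) (isBddMeas_const 1) (fun _ => zero_le_one) x x
  have hl := 𝓜.gLow_pos
  have hh := 𝓜.gHigh_pos
  have hρ1 : 𝓜.gLow / 𝓜.gHigh ≤ 1 := (div_le_one hh).2 𝓜.gLow_le_gHigh
  have hε0 : (0 : ℝ) < ε := by exact_mod_cast hε
  have hact : ∀ (p : ℕ) (f : S → ℝ), IsBddMeas f → (∀ x, 0 ≤ f x) → ∀ x y : S,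
      ε * (𝓜.gLow / 𝓜.gHigh) ^ k * 𝓜.act p (p + k) f y ≤ 𝓜.act p (p + k) f x := by
    intro p f hf hf0 x y
    calc _ ≤ ε * (𝓜.gLow / 𝓜.gHigh) ^ k * (𝓜.gHigh ^ k * ∫ z, f z ∂((𝓜.trans ^ k) y)) := by
          gcongr
          exact (h.act_bounds p k hf hf0 y).2
      _ = 𝓜.gLow ^ k * (ε * ∫ z, f z ∂((𝓜.trans ^ k) y)) := by
          rw [div_pow]; field_simp
      _ ≤ 𝓜.gLow ^ k * ∫ z, f z ∂((𝓜.trans ^ k) x) := by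
          gcongr
          exact hM' f hf hf0 x y
      _ ≤ _ := (h.act_bounds p k hf hf0 x).1
  refine ⟨k, ε * (𝓜.gLow / 𝓜.gHigh) ^ k, hk, by positivity,
    mul_le_one₀ hε1 (by positivity) (pow_le_one₀ (by positivity) hρ1), hact, fun p n hpn x y => ?_⟩
  rcases le_or_gt (p + k) n with hn | hn
  · rw [𝓜.tot_comp (Nat.le_add_right p k) hn]
    exact hact p _ (𝓜.isBddMeas_tot _ _) (fun z => (𝓜.tot_pos hn z).le) x y
  · obtain ⟨j, rfl⟩ := Nat.exists_eq_add_of_le hpn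
    calc _ ≤ 1 * (𝓜.gLow / 𝓜.gHigh) ^ j * 𝓜.gHigh ^ j := by
          have h1 := (h.tot_bounds p j y).2
          have h2 : (𝓜.gLow / 𝓜.gHigh) ^ k ≤ (𝓜.gLow / 𝓜.gHigh) ^ j :=
            pow_le_pow_of_le_one (by positivity) hρ1 (by omega)
          have h3 := (𝓜.tot_pos hpn y).le
          gcongr
      _ = 𝓜.gLow ^ j := by rw [div_pow]; field_simp
      _ ≤ _ := (h.tot_bounds p j x).1

theorem IsMixingRate.normQ_le {k : ℕ} {ε : ℝ} (h : IsMixingRate 𝓜 k ε) {p n : ℕ} (hpn : p ≤ n) :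
    𝓜.normQ p n ≤ ε⁻¹ * 𝓜.lowQ p n :=
  𝓜.normQ_le_of_forall hpn (inv_pos.2 h.pos) fun x y => by
    rw [← div_eq_inv_mul, le_div_iff₀' h.pos]
    exact h.tot_le p n hpn y x

/-- The Markov transition from `p` to `p + k` of the normalized semigroup contracts the
oscillations by the factor `1 - ε²`. -/
theorem IsMixingRate.avg_sub_avg_le {k : ℕ} {ε : ℝ} (h : IsMixingRate 𝓜 k ε) {p n : ℕ}
    (hpn : p + k ≤ n) {f : S → ℝ} (hf : IsBddMeas f) {δ : ℝ}
    (hδ : ∀ z w : S, 𝓜.avg (p + k) n f z - 𝓜.avg (p + k) n f w ≤ δ) (x y : S) :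
    𝓜.avg p n f x - 𝓜.avg p n f y ≤ (1 - ε ^ 2) * δ := by
  have hε := h.pos
  have hpk : p ≤ p + k := Nat.le_add_right p k
  have hpn' : p ≤ n := hpk.trans hpn
  have hactn := 𝓜.isBddMeas_act (p + k) n hf
  have htotn := 𝓜.isBddMeas_tot (p + k) n
  have := 𝓜.nonempty 0
  have hmain : ∀ W : S → ℝ, IsBddMeas W → (∀ z, 0 ≤ W z) →
      ε ^ 2 * (𝓜.act p (p + k) W y / 𝓜.tot p n y) ≤ 𝓜.act p (p + k) W x / 𝓜.tot p n x := by
    intro W hW hW0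
    have h1 := h.act_le p W hW hW0 x y
    have h2 := h.tot_le p n hpn' y x
    have hx := 𝓜.tot_pos hpn' x
    have hy := 𝓜.tot_pos hpn' y
    have hWy : 0 ≤ 𝓜.act p (p + k) W y := integral_nonneg hW0
    rw [← mul_div_assoc, div_le_div_iff₀ hy hx]
    calc ε ^ 2 * 𝓜.act p (p + k) W y * 𝓜.tot p n x
        = (ε * 𝓜.act p (p + k) W y) * (ε * 𝓜.tot p n x) := by ring
      _ ≤ _ := mul_le_mul h1 h2 (mul_nonneg h.pos.le hx.le) ((mul_nonneg h.pos.le hWy).trans h1)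
  -- The comparison is applied to the nonnegative functions `Q(f) - a Q(1)` and
  -- `(a + δ) Q(1) - Q(f)`, where `[a, a + δ]` contains the values of `P(f)`.
  set a := ⨅ z, 𝓜.avg (p + k) n f z with ha
  have hbdd : BddBelow (Set.range fun z : S => 𝓜.avg (p + k) n f z) := by
    obtain ⟨w⟩ := 𝓜.nonempty 0
    exact ⟨𝓜.avg (p + k) n f w - δ, Set.forall_mem_range.2 fun z => by linarith [hδ w z]⟩
  have hlo : ∀ z, a ≤ 𝓜.avg (p + k) n f z := fun z => ciInf_le hbdd z
  have hhi : ∀ z, 𝓜.avg (p + k) n f z ≤ a + δ := fun z => by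
    have : 𝓜.avg (p + k) n f z - δ ≤ a := le_ciInf fun w => by linarith [hδ z w]
    linarith
  have h1 := hmain (fun z => 𝓜.act (p + k) n f z - a * 𝓜.tot (p + k) n z)
    (hactn.sub ((isBddMeas_const a).mul htotn)) fun z => by
      rw [𝓜.act_eq_avg_mul hpn, ← sub_mul]
      exact mul_nonneg (by linarith [hlo z]) (𝓜.tot_pos hpn z).le
  have h2 := hmain (fun z => (a + δ) * 𝓜.tot (p + k) n z - 𝓜.act (p + k) n f z)
    (((isBddMeas_const (a + δ)).mul htotn).sub hactn) fun z => by
      rw [𝓜.act_eq_avg_mul hpn, ← sub_mul]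
      exact mul_nonneg (by linarith [hhi z]) (𝓜.tot_pos hpn z).le
  have e1 : ∀ x, 𝓜.act p (p + k) (fun z => 𝓜.act (p + k) n f z - a * 𝓜.tot (p + k) n z) x /
      𝓜.tot p n x = 𝓜.avg p n f x - a := fun x => by
    rw [𝓜.act_sub _ _ hactn ((isBddMeas_const a).mul htotn), act_const_mul, ← 𝓜.tot_comp hpk hpn,
      ← 𝓜.act_comp hpk hpn hf, sub_div, mul_div_cancel_right₀ _ (𝓜.tot_pos hpn' x).ne', avg]
  have e2 : ∀ x, 𝓜.act p (p + k) (fun z => (a + δ) * 𝓜.tot (p + k) n z - 𝓜.act (p + k) n f z) x /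
      𝓜.tot p n x = a + δ - 𝓜.avg p n f x := fun x => by
    rw [𝓜.act_sub _ _ ((isBddMeas_const (a + δ)).mul htotn) hactn, act_const_mul,
      ← 𝓜.tot_comp hpk hpn, ← 𝓜.act_comp hpk hpn hf, sub_div,
      mul_div_cancel_right₀ _ (𝓜.tot_pos hpn' x).ne', avg]
  rw [e1, e1] at h1
  rw [e2, e2] at h2
  have hy : a ≤ 𝓜.avg p n f y := by
    have := e1 y
    have h3 : 0 ≤ 𝓜.avg p n f y - a := by
      rw [← this]
      refine div_nonneg (integral_nonneg fun z => ?_) (𝓜.tot_pos hpn' y).le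
      change 0 ≤ 𝓜.act (p + k) n f z - a * 𝓜.tot (p + k) n z
      rw [𝓜.act_eq_avg_mul hpn, ← sub_mul]
      exact mul_nonneg (by linarith [hlo z]) (𝓜.tot_pos hpn z).le
    linarith
  have hε2 : ε ^ 2 ≤ 1 := pow_le_one₀ hε.le h.le_one
  nlinarith

theorem IsMixingRate.avg_sub_avg_le_pow {k : ℕ} {ε : ℝ} (h : IsMixingRate 𝓜 k ε) (j : ℕ)
    {p n : ℕ} (hpn : p + j * k ≤ n) {f : S → ℝ} (hf : IsOscOne f) (x y : S) :
    𝓜.avg p n f x - 𝓜.avg p n f y ≤ (1 - ε ^ 2) ^ j := by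
  induction j generalizing p x y with
  | zero =>
    have := 𝓜.isProbabilityMeasure_normalize_T (show p ≤ n by omega) x
    have := 𝓜.isProbabilityMeasure_normalize_T (show p ≤ n by omega) y
    rw [← integral_normalize_T, ← integral_normalize_T, pow_zero]
    exact (le_abs_self _).trans (abs_integral_sub_integral_le_one _ _ hf)
  | succ j ih =>
    rw [pow_succ']
    have hn : p + k + j * k ≤ n := by linarith
    exact h.avg_sub_avg_le (by linarith [Nat.zero_le (j * k)]) hf.isBddMeas (fun z w => ih hn z w)
      x y

/-- The Dobrushin coefficients decrease geometrically. -/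
theorem IsMixingRate.β_le {k : ℕ} {ε : ℝ} (h : IsMixingRate 𝓜 k ε) {p n : ℕ} (hpn : p ≤ n) :
    𝓜.β p n ≤ (1 - ε ^ 2) ^ ((n - p) / k) :=
  𝓜.β_le_of_forall hpn fun f hf x y => h.avg_sub_avg_le_pow _ (by
    have := Nat.div_mul_le_self (n - p) k
    omega) hf x y

/-! ### Uniform estimates for time homogeneous models -/

theorem IsHomogeneous.T_shift (h : 𝓜.IsHomogeneous) {p n : ℕ} (hpn : p ≤ n) :
    𝓜.T (p + 1) (n + 1) = 𝓜.T p n := by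
  induction n, hpn using Nat.le_induction with
  | base => rw [T_self, T_self]
  | succ n hn ih =>
    rw [𝓜.T_succ (Nat.succ_le_succ hn), 𝓜.T_succ hn, ih]
    have hQ : 𝓜.Qstep (n + 1) = 𝓜.Qstep n := by
      ext1 x
      rw [Qstep_apply, Qstep_apply, (h (n + 1)).1, (h n).1, (h (n + 1)).2.1, (h n).2.1]
    rw [hQ]

theorem IsHomogeneous.c_shift (h : 𝓜.IsHomogeneous) (j q : ℕ) :
    𝓜.c (q + 1) (q + 1 + j) = 𝓜.c 1 (1 + j) := by
  induction q with
  | zero => rw [zero_add]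
  | succ q ih =>
    rw [← ih, 𝓜.c_eq (Nat.le_add_right _ _), 𝓜.c_eq (Nat.le_add_right _ _), (h (q + 1)).2.2,
      (h q).2.2]
    have : 𝓜.tot (q + 1 + 1) (q + 1 + 1 + j) = 𝓜.tot (q + 1) (q + 1 + j) := by
      ext x
      rw [tot, tot, show q + 1 + 1 + j = (q + 1 + j) + 1 by ring,
        h.T_shift (Nat.le_add_right _ _)]
    rw [this]

variable (𝓜) in
/-- The mass of the descendants, after `j` steps, of the targets which are born at a given time
`n ≥ 1`. -/
def brood (j : ℕ) : ℝ := 𝓜.c 1 (1 + j)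

theorem IsHomogeneous.c_eq_brood (h : 𝓜.IsHomogeneous) {q n : ℕ} (hq : 1 ≤ q) (hqn : q ≤ n) :
    𝓜.c q n = 𝓜.brood (n - q) := by
  obtain ⟨j, rfl⟩ := Nat.exists_eq_add_of_le hqn
  obtain ⟨q, rfl⟩ := Nat.exists_eq_add_of_le' hq
  rw [Nat.add_sub_cancel_left, brood, h.c_shift]

theorem brood_nonneg (j : ℕ) : 0 ≤ 𝓜.brood j := 𝓜.c_nonneg (Nat.le_add_right _ _)

theorem brood_zero : 𝓜.brood 0 = (𝓜.μ 1).real Set.univ := by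
  rw [brood, add_zero, 𝓜.c_eq le_rfl]
  simp [tot_self]

/-- The broods grow at least like the powers of `inf G`. -/
theorem IsHomogeneous.brood_growth (h : 𝓜.IsHomogeneous) (j : ℕ) :
    𝓜.gLow * 𝓜.brood j ≤ 𝓜.brood (j + 1) := by
  rw [brood, brood, 𝓜.c_eq (Nat.le_add_right _ _), 𝓜.c_eq (Nat.le_add_right _ _),
    ← integral_const_mul]
  refine integral_mono (((isBddMeas_const _).mul (𝓜.isBddMeas_tot _ _)).integrable _)
    ((𝓜.isBddMeas_tot _ _).integrable _) fun x => ?_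
  change _ ≤ 𝓜.tot 1 (1 + j + 1) x
  rw [𝓜.tot_succ (Nat.le_add_right _ _), (h (1 + j)).1, ← act_const]
  exact 𝓜.act_mono _ _ (isBddMeas_const _) (𝓜.isBddMeas_G 0) 𝓜.gLow_le x

theorem IsHomogeneous.births_eq (h : 𝓜.IsHomogeneous) (p n : ℕ) :
    𝓜.births p n = ∑ j ∈ Finset.range (n - p), 𝓜.brood j := by
  rw [births, ← sum_Ioc_sub]
  refine Finset.sum_congr rfl fun q hq => ?_
  have hq := Finset.mem_Ioc.1 hq
  exact h.c_eq_brood (by omega) hq.2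

theorem IsHomogeneous.birthsβ_le (h : 𝓜.IsHomogeneous) {k : ℕ} {ε : ℝ} (hmix : IsMixingRate 𝓜 k ε)
    (p n : ℕ) :
    𝓜.birthsβ p n ≤ ∑ j ∈ Finset.range (n - p), 𝓜.brood j * (1 - ε ^ 2) ^ (j / k) := by
  rw [birthsβ, ← sum_Ioc_sub fun j => 𝓜.brood j * (1 - ε ^ 2) ^ (j / k)]
  refine Finset.sum_le_sum fun q hq => ?_
  have hq := Finset.mem_Ioc.1 hq
  rw [h.c_eq_brood (by omega) hq.2]
  exact mul_le_mul_of_nonneg_left (hmix.β_le hq.2) (brood_nonneg _)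

variable (𝓜) in
/-- The part of the contribution of the time `p` to the error at time `n` which is due to the
spontaneous births after time `p`. -/
def birthError (p n : ℕ) : ℝ :=
  𝓜.gain p n * (𝓜.birthsβ p n / (𝓜.mMinus p * 𝓜.lowQ p n + 𝓜.births p n))

/-- When `G = 1`, the total mass at time `n` is of order `n`, and each time `p ≤ n` contributes an
error of order `1 / n`. -/
theorem IsHomogeneous.sum_birthError_le_of_eq_one (h : 𝓜.IsHomogeneous) {k : ℕ} {ε : ℝ}
    (hmix : IsMixingRate 𝓜 k ε) (hG : ∀ x, 𝓜.G 0 x = 1) :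
    ∃ C, ∀ n, ∑ p ∈ Finset.range (n + 1), 𝓜.birthError p n ≤ C := by
  have hε := hmix.pos
  have hθ0 : 0 ≤ 1 - ε ^ 2 := by nlinarith [hmix.le_one]
  have hθ1 : 1 - ε ^ 2 < 1 := by nlinarith
  have hne := 𝓜.nonempty 0
  set B : ℝ := k / (1 - (1 - ε ^ 2)) with hB
  have hB0 : 0 ≤ B := div_nonneg (Nat.cast_nonneg k) (by linarith)
  set a := (𝓜.μ 0).real Set.univ with ha
  set b := (𝓜.μ 1).real Set.univ with hb
  have ha0 : 0 < a := 𝓜.mu_zero_real_pos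
  have hb0 : 0 ≤ b := measureReal_nonneg
  have hlow : 𝓜.gLow = 1 := by simp [gLow, hG]
  have hhigh : 𝓜.gHigh = 1 := by simp [gHigh, hG]
  have htot : ∀ p j (x : S), 𝓜.tot p (p + j) x = 1 := fun p j x => by
    have := h.tot_bounds p j x
    rw [hlow, hhigh, one_pow] at this
    exact le_antisymm this.2 this.1
  have hbrood : ∀ j, 𝓜.brood j = b := fun j => by
    rw [brood, 𝓜.c_eq (Nat.le_add_right _ _)]
    simp [htot, hb]
  refine ⟨ε⁻¹ * (B * (1 + b / a)), fun n => ?_⟩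
  have hterm : ∀ p ∈ Finset.range (n + 1), 𝓜.birthError p n ≤ ε⁻¹ * (b * B / (a + n * b)) := by
    intro p hp
    have hpn := Finset.mem_range_succ_iff.1 hp
    have hlowQ : 𝓜.lowQ p n = 1 := by
      obtain ⟨j, rfl⟩ := Nat.exists_eq_add_of_le hpn
      simp [lowQ, htot]
    have hbirths : 𝓜.births p n = (n - p) * b := by
      rw [h.births_eq]
      simp [hbrood, Nat.cast_sub hpn]
    have hbβ : 𝓜.birthsβ p n ≤ b * B := by
      refine (h.birthsβ_le hmix p n).trans ?_
      simp only [hbrood, ← Finset.mul_sum]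
      exact mul_le_mul_of_nonneg_left (sum_range_pow_div_le hθ0 hθ1 hmix.one_le _) hb0
    have hm : a + p * b ≤ 𝓜.mMinus p := by
      refine 𝓜.le_gSum_of_recursion (m := fun p => a + p * b) (𝓜.gMinus_nonneg p) (by simp [ha])
        fun q hq => ?_
      have : Nonempty (Fin p) := ⟨⟨q, hq⟩⟩
      have h1 : 1 ≤ 𝓜.gMinus p := le_ciInf fun r => le_ciInf fun x => by rw [(h r).1, hG]
      have h2 : 0 ≤ a + q * b := by positivity
      rw [(h q).2.2, ← hb]
      push_cast
      nlinarith
    refine mul_le_mul (𝓜.gain_le_of_normQ_le hpn (inv_pos.2 hε).le (hmix.normQ_le hpn)) ?_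
      (div_nonneg (𝓜.birthsβ_nonneg p n) (add_nonneg (mul_nonneg (𝓜.mMinus_nonneg p)
        (𝓜.lowQ_pos hpn).le) (𝓜.births_nonneg p n))) (inv_pos.2 hε).le
    rw [hlowQ, hbirths]
    refine div_le_div₀ (by positivity) hbβ (by positivity) ?_
    linarith
  refine (Finset.sum_le_sum hterm).trans ?_
  rw [Finset.sum_const, Finset.card_range, nsmul_eq_mul, mul_left_comm]
  refine mul_le_mul_of_nonneg_left ?_ (inv_pos.2 hε).le
  rw [mul_div_assoc', div_le_iff₀ (by positivity)]
  have h1 : (1 + b / a) * (a + n * b) = (n + 1) * b + a + n * b * (b / a) := by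
    field_simp
    ring
  have h2 : 0 ≤ n * b * (b / a) := by positivity
  push_cast
  calc ((n : ℝ) + 1) * (b * B) = B * ((n + 1) * b) := by ring
    _ ≤ B * ((1 + b / a) * (a + n * b)) := by
      refine mul_le_mul_of_nonneg_left ?_ hB0
      linarith
    _ = _ := by ring

/-- When `inf G > 1`, the descendants of older births exponentially outnumber those of recent
ones, and their laws have already been mixed. -/
theorem IsHomogeneous.sum_birthError_le_of_one_lt (h : 𝓜.IsHomogeneous) {k : ℕ} {ε : ℝ}
    (hmix : IsMixingRate 𝓜 k ε) (hG : 1 < 𝓜.gLow) :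
    ∃ C, ∀ n, ∑ p ∈ Finset.range (n + 1), 𝓜.birthError p n ≤ C := by
  have hε := hmix.pos
  have hθ0 : 0 ≤ 1 - ε ^ 2 := by nlinarith [hmix.le_one]
  have hθ1 : 1 - ε ^ 2 < 1 := by nlinarith
  have hγ0 : 0 ≤ 𝓜.gLow⁻¹ := by positivity
  have hγ1 : 𝓜.gLow⁻¹ < 1 := inv_lt_one_of_one_lt₀ hG
  let v : ℕ → ℝ := fun L => Nat.rec 0 (fun j w => 𝓜.gLow⁻¹ * w + (1 - ε ^ 2) ^ (j / k)) L
  have hv : ∀ j, v (j + 1) = 𝓜.gLow⁻¹ * v j + (1 - ε ^ 2) ^ (j / k) := fun j => rfl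
  have hkey := sum_mul_le_of_growth hγ0 (u := 𝓜.brood) brood_nonneg
    (fun j => by
      rw [← div_eq_inv_mul, le_div_iff₀' 𝓜.gLow_pos]
      exact h.brood_growth j)
    (t := fun j => (1 - ε ^ 2) ^ (j / k)) (fun j => by positivity) (v := v) rfl hv
  refine ⟨ε⁻¹ * (k / (1 - (1 - ε ^ 2)) / (1 - 𝓜.gLow⁻¹)), fun n => ?_⟩
  have hterm : ∀ p ∈ Finset.range (n + 1), 𝓜.birthError p n ≤ ε⁻¹ * v (n + 1 - 1 - p) := by
    intro p hp
    have hpn := Finset.mem_range_succ_iff.1 hp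
    rw [Nat.add_sub_cancel]
    refine mul_le_mul (𝓜.gain_le_of_normQ_le hpn (inv_pos.2 hε).le (hmix.normQ_le hpn))
      ((𝓜.birthsβ_div_le hpn).trans ?_)
      (div_nonneg (𝓜.birthsβ_nonneg p n) (add_nonneg (mul_nonneg (𝓜.mMinus_nonneg p)
        (𝓜.lowQ_pos hpn).le) (𝓜.births_nonneg p n))) (inv_pos.2 hε).le
    refine div_le_of_le_mul₀ (𝓜.births_nonneg p n) (hkey (n - p)).1 ?_
    rw [h.births_eq]
    exact (h.birthsβ_le hmix p n).trans (hkey (n - p)).2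
  refine (Finset.sum_le_sum hterm).trans ?_
  rw [← Finset.mul_sum, Finset.sum_range_reflect]
  exact mul_le_mul_of_nonneg_left (sum_range_le_of_recursion hγ0 hγ1
    (sum_range_pow_div_le hθ0 hθ1 hmix.one_le) rfl hv _) (inv_pos.2 hε).le

/-- When `sup G < 1`, the targets which were present at time `p` are exponentially outnumbered by
the later births. -/
theorem IsHomogeneous.sum_birthError_le_of_lt_one (h : 𝓜.IsHomogeneous) (hG : 𝓜.gHigh < 1) :
    ∃ C, ∀ n, ∑ p ∈ Finset.range (n + 1), 𝓜.birthError p n ≤ C := by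
  set a := (𝓜.μ 0).real Set.univ with ha
  set b := (𝓜.μ 1).real Set.univ with hb
  have ha0 : 0 < a := 𝓜.mu_zero_real_pos
  have hb0 : 0 ≤ b := measureReal_nonneg
  have hne := 𝓜.nonempty 0
  have hh := 𝓜.gHigh_pos
  have hgap : 0 < 1 - 𝓜.gHigh := by linarith
  set m := a + b / (1 - 𝓜.gHigh) with hm
  have hm0 : 0 ≤ m := by positivity
  refine ⟨m / b * (1 / (1 - 𝓜.gHigh)), fun n => ?_⟩
  have hterm : ∀ p ∈ Finset.range (n + 1),
      𝓜.birthError p n ≤ m / b * 𝓜.gHigh ^ (n + 1 - 1 - p) := by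
    intro p hp
    have hpn := Finset.mem_range_succ_iff.1 hp
    rw [Nat.add_sub_cancel]
    rcases (𝓜.births_nonneg p n).eq_or_lt with hz | hpos
    · rw [birthError, 𝓜.birthsβ_eq_zero hz.symm, zero_div, mul_zero]
      positivity
    have hLpos : 0 < n - p := by
      by_contra hL
      rw [h.births_eq, Nat.eq_zero_of_not_pos hL] at hpos
      simp at hpos
    have hge : b ≤ 𝓜.births p n := by
      rw [h.births_eq, hb, ← brood_zero]
      exact Finset.single_le_sum (fun j _ => brood_nonneg j) (Finset.mem_range.2 hLpos)
    have hbpos : 0 < b := by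
      refine hb0.lt_of_ne' fun hb' => ?_
      have hμ : 𝓜.μ 1 = 0 := by
        rw [hb, measureReal_eq_zero_iff] at hb'
        exact Measure.measure_univ_eq_zero.1 hb'
      have : 𝓜.births p n = 0 := by
        rw [h.births_eq]
        refine Finset.sum_eq_zero fun j _ => ?_
        rw [brood, 𝓜.c_eq (Nat.le_add_right _ _), hμ, integral_zero_measure]
      linarith
    have hmP : 𝓜.mPlus p ≤ m := by
      refine 𝓜.gSum_le_of_recursion (m := fun _ => m) (𝓜.gPlus_nonneg p) ?_ fun q hq => ?_
      · rw [hm, ← ha]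
        have : 0 ≤ b / (1 - 𝓜.gHigh) := by positivity
        linarith
      · have : Nonempty (Fin p) := ⟨⟨q, hq⟩⟩
        have h1 : 𝓜.gPlus p ≤ 𝓜.gHigh :=
          ciSup_le fun r => ciSup_le fun x => by rw [(h r).1]; exact 𝓜.le_gHigh x
        have h2 : (1 - 𝓜.gHigh) * m = (1 - 𝓜.gHigh) * a + b := by rw [hm]; field_simp
        rw [(h q).2.2, ← hb]
        nlinarith
    have hnorm : 𝓜.normQ p n ≤ 𝓜.gHigh ^ (n - p) := by
      obtain ⟨j, rfl⟩ := Nat.exists_eq_add_of_le hpn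
      rw [𝓜.normQ_eq hpn, Nat.add_sub_cancel_left]
      exact ciSup_le fun x => (h.tot_bounds p j x).2
    have hratio : 𝓜.birthsβ p n / (𝓜.mMinus p * 𝓜.lowQ p n + 𝓜.births p n) ≤ 1 := by
      refine (𝓜.birthsβ_div_le hpn).trans ((div_le_one hpos).2 (Finset.sum_le_sum fun q hq => ?_))
      have hqn := (Finset.mem_Ioc.1 hq).2
      refine mul_le_of_le_one_right (𝓜.c_nonneg hqn) (𝓜.β_le_of_forall hqn fun f hf x y => ?_)
      have := 𝓜.isProbabilityMeasure_normalize_T hqn x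
      have := 𝓜.isProbabilityMeasure_normalize_T hqn y
      rw [← integral_normalize_T, ← integral_normalize_T]
      exact (le_abs_self _).trans (abs_integral_sub_integral_le_one _ _ hf)
    refine (mul_le_of_le_one_right (𝓜.gain_nonneg hpn) hratio).trans
      ((𝓜.gain_le_div_births hpn hpos).trans ?_)
    rw [div_mul_eq_mul_div]
    have := (𝓜.normQ_pos hpn).le
    gcongr
  refine (Finset.sum_le_sum hterm).trans ?_
  rw [← Finset.mul_sum, Finset.sum_range_reflect]
  exact mul_le_mul_of_nonneg_left (sum_range_pow_le hh.le hG _) (by positivity)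

/-- The error constants are bounded uniformly in time: the part with `β(P_{p,n})` is a geometric
sum, and the part due to the births is treated separately in the three scenarios. -/
theorem IsHomogeneous.bddAbove_sum_localConst (h : 𝓜.IsHomogeneous) (hscen : 𝓜.IsScenario)
    {k : ℕ} {ε : ℝ} (hmix : IsMixingRate 𝓜 k ε) :
    BddAbove (Set.range fun n => ∑ p ∈ Finset.range (n + 1), 𝓜.localConst p n) := by
  have hε := hmix.pos
  have hθ0 : 0 ≤ 1 - ε ^ 2 := by nlinarith [hmix.le_one]
  have hθ1 : 1 - ε ^ 2 < 1 := by nlinarith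
  obtain ⟨C, hC⟩ : ∃ C, ∀ n, ∑ p ∈ Finset.range (n + 1), 𝓜.birthError p n ≤ C := by
    rcases hscen with h1 | h1 | h1
    · exact h.sum_birthError_le_of_eq_one hmix h1
    · exact h.sum_birthError_le_of_lt_one h1
    · exact h.sum_birthError_le_of_one_lt hmix h1
  refine ⟨2 * (ε⁻¹ * (k / (1 - (1 - ε ^ 2))) + C), Set.forall_mem_range.2 fun n => ?_⟩
  have hterm : ∀ p ∈ Finset.range (n + 1), 𝓜.localConst p n ≤
      2 * (ε⁻¹ * (1 - ε ^ 2) ^ ((n + 1 - 1 - p) / k) + 𝓜.birthError p n) := by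
    intro p hp
    have hpn := Finset.mem_range_succ_iff.1 hp
    rw [Nat.add_sub_cancel, localConst, spread, mul_assoc, mul_add, birthError]
    have := mul_le_mul (𝓜.gain_le_of_normQ_le hpn (inv_pos.2 hε).le (hmix.normQ_le hpn))
      (hmix.β_le hpn) (𝓜.β_nonneg hpn) (inv_pos.2 hε).le
    gcongr
  refine (Finset.sum_le_sum hterm).trans ?_
  rw [← Finset.mul_sum, Finset.sum_add_distrib, ← Finset.mul_sum,
    Finset.sum_range_reflect fun j => (1 - ε ^ 2) ^ (j / k)]
  have := sum_range_pow_div_le hθ0 hθ1 hmix.one_le (n + 1)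
  have := hC n
  gcongr

/-- `‖Q_{p,n}(1)‖ γ_p(1)` is of the order of `γ_p Q_{p,n}(1)`, which is a part of the mass
`γ_n(1)`. -/
theorem IsMixingRate.normQ_mul_mass_le {k : ℕ} {ε : ℝ} (h : IsMixingRate 𝓜 k ε) {p n : ℕ}
    (hpn : p ≤ n) : 𝓜.normQ p n * 𝓜.mass p ≤ ε⁻¹ * 𝓜.mass n := by
  have h1 := 𝓜.flow_one_ge (p := p) n (𝓜.γ p)
  rw [𝓜.flow_γ hpn (isBddMeas_const 1)] at h1
  have h2 : ∫ x : S, (1 : ℝ) ∂(𝓜.γ n) = 𝓜.mass n := by simp [mass]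
  have h3 := 𝓜.births_nonneg p n
  have h4 := h.normQ_le hpn
  have h5 := (𝓜.mass_mem p).1
  have h6 := inv_pos.2 h.pos
  change 𝓜.mass p * 𝓜.lowQ p n + 𝓜.births p n ≤ _ at h1
  calc _ ≤ ε⁻¹ * 𝓜.lowQ p n * 𝓜.mass p := by gcongr
    _ = ε⁻¹ * (𝓜.mass p * 𝓜.lowQ p n) := by ring
    _ ≤ _ := by gcongr; linarith

/-- The relative variances `δ n` satisfy `δ n ≤ C / N * ∑_{p < n} (1 + δ p)`, because the second
moment of the relative mass is `1 + δ p`. -/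
theorem IsMixingRate.integral_sq_ratio_le {k : ℕ} {ε : ℝ} (h : IsMixingRate 𝓜 k ε)
    {𝓚 : 𝓜.McKean} {N : ℕ} (hN : 1 < N) {Ω : Type v} [MeasurableSpace Ω] {Pr : Measure Ω}
    [IsProbabilityMeasure Pr] {ξ : ∀ _, Ω → Fin N → S} (hξ : 𝓜.IsParticleModel 𝓚 N Pr ξ)
    {n : ℕ} (hn : 1 ≤ n) :
    ∫ ω, (𝓜.particleMass (fun k => ξ k ω) n / 𝓜.mass n - 1) ^ 2 ∂Pr ≤
      64 * ε⁻¹ ^ 2 * ((n + 1) / (N - 1)) * (1 + 64 * ε⁻¹ ^ 2 / (N - 1)) ^ (n - 1) := by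
  have hN' : 1 ≤ N := hN.le
  have hN1 : (0 : ℝ) < N - 1 := by
    have : (1 : ℝ) < N := by exact_mod_cast hN
    linarith
  have hN0 : (0 : ℝ) < N := by linarith
  have hε := h.pos
  set δ : ℕ → ℝ := fun n => ∫ ω, (𝓜.particleMass (fun k => ξ k ω) n / 𝓜.mass n - 1) ^ 2 ∂Pr
    with hδ
  have hmass := fun n => (𝓜.mass_mem n).1
  have hm : ∀ n, IsBddMeas fun ω => 𝓜.particleMass (fun k => ξ k ω) n := fun n =>
    ⟨hξ.measurable_particleMass n, 𝓜.mPlus n, fun ω => by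
      have := 𝓜.particleMass_mem hN' (fun k => ξ k ω) n
      rw [abs_of_pos this.1]
      exact this.2.2⟩
  have hmean : ∀ n, ∫ ω, 𝓜.particleMass (fun k => ξ k ω) n ∂Pr = 𝓜.mass n := fun n => by
    have h1 := (hξ.integral_particleMass_mul hN' n (isBddMeas_const 1)).2
    have h2 := fun ω => isProbabilityMeasure_empirical hN' (ξ n ω)
    simpa [mass] using h1
  have hδ' : ∀ n, δ n = (∫ ω, (𝓜.particleMass (fun k => ξ k ω) n - 𝓜.mass n) ^ 2 ∂Pr) /
      𝓜.mass n ^ 2 := fun n => by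
    rw [← integral_div]
    refine integral_congr_ae (Filter.Eventually.of_forall fun ω => ?_)
    have := (hmass n).ne'
    field_simp
  have hsq : ∀ n, ∫ ω, 𝓜.particleMass (fun k => ξ k ω) n ^ 2 ∂Pr =
      𝓜.mass n ^ 2 * (1 + δ n) := fun n => by
    have h1 := (hm n).integral_add_sq (isBddMeas_const (S := Ω) (-𝓜.mass n)) (Pr := Pr)
    rw [integral_mul_const, hmean] at h1
    simp only [← sub_eq_add_neg, integral_const, probReal_univ, one_smul] at h1
    rw [mul_add, hδ', h1]
    have := (hmass n).ne'
    field_simp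
    ring
  have hrec : ∀ n, δ n ≤ 64 * ε⁻¹ ^ 2 / (N - 1) * ∑ p ∈ Finset.range n, (1 + δ p) := by
    intro n
    rw [hδ', div_le_iff₀ (pow_pos (hmass n) 2)]
    refine (hξ.integral_sq_particleMass_sub_le hN' n).trans ?_
    rw [Finset.mul_sum, Finset.sum_mul]
    refine Finset.sum_le_sum fun p hp => ?_
    have h1 := h.normQ_mul_mass_le (Finset.mem_range.1 hp).le
    have h2 : 0 ≤ 1 + δ p :=
      add_nonneg zero_le_one (integral_nonneg fun ω => sq_nonneg _)
    have h3 := 𝓜.normQ_pos (Finset.mem_range.1 hp).le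
    have h4 := hmass p
    rw [hsq]
    calc _ = 64 * (𝓜.normQ p n * 𝓜.mass p) ^ 2 / N * (1 + δ p) := by ring
      _ ≤ 64 * (ε⁻¹ * 𝓜.mass n) ^ 2 / (N - 1) * (1 + δ p) := by gcongr; linarith
      _ = _ := by ring
  obtain ⟨n, rfl⟩ := Nat.exists_eq_add_of_le' hn
  refine (le_of_le_mul_sum (by positivity) hrec n).trans ?_
  rw [Nat.add_sub_cancel]
  push_cast
  calc _ = 64 * ε⁻¹ ^ 2 * (((n : ℝ) + 1) / (N - 1)) * (1 + 64 * ε⁻¹ ^ 2 / (N - 1)) ^ n := by ring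
    _ ≤ _ := by gcongr; linarith

end Model

end

end SpatialBranching

theorem mainTheorem2 :
    ∃ a : ℝ → ℝ, (∀ r, 0 ≤ a r) ∧
      (∀ (E : ℕ → Type u) [∀ n, MeasurableSpace (E n)] (𝓜 : SpatialBranching.Model E),
        (∀ n, 𝓜.mass n ∈ Set.Icc (𝓜.mMinus n) (𝓜.mPlus n)) ∧
        (∃ b : ℕ → ℝ,
          (∀ n, 0 ≤ b n ∧ b n ≤ ∑ p ∈ Finset.range (n + 1), 𝓜.bConst p n) ∧
          SpatialBranching.Model.MeanErrorBound.{u, v} 𝓜 a b) ∧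
        (∀ (𝓚 : 𝓜.McKean) (N : ℕ), 1 ≤ N →
          ∀ (Ω : Type v) [MeasurableSpace Ω] (Pr : Measure Ω) [IsProbabilityMeasure Pr]
            (ξ : ∀ n, Ω → Fin N → E n), 𝓜.IsParticleModel 𝓚 N Pr ξ →
          ∀ n : ℕ,
            (∀ ω, 𝓜.particleMass (fun k => ξ k ω) n ∈ Set.Icc (𝓜.mMinus n) (𝓜.mPlus n)) ∧
            ∀ f : E n → ℝ, Measurable f → (∃ C, ∀ x, |f x| ≤ C) →
              Integrable (fun ω => 𝓜.particleMass (fun k => ξ k ω) n *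
                ∫ x, f x ∂(SpatialBranching.empirical (ξ n ω))) Pr ∧
              ∫ ω, 𝓜.particleMass (fun k => ξ k ω) n *
                (∫ x, f x ∂(SpatialBranching.empirical (ξ n ω))) ∂Pr = ∫ x, f x ∂(𝓜.γ n))) ∧
      (∀ (S : Type u) [MeasurableSpace S] (𝓜 : SpatialBranching.Model fun _ : ℕ => S),
        𝓜.IsHomogeneous → 𝓜.IsScenario → 𝓜.IsMixing →
        (∃ b : ℕ → ℝ,
          (∀ n, 0 ≤ b n ∧ b n ≤ ∑ p ∈ Finset.range (n + 1), 𝓜.bConst p n) ∧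
          SpatialBranching.Model.MeanErrorBound.{u, v} 𝓜 a b ∧
          BddAbove (Set.range b)) ∧
        ∃ d : ℝ, 0 ≤ d ∧
          ∀ (𝓚 : 𝓜.McKean) (N : ℕ), 1 < N →
          ∀ (Ω : Type v) [MeasurableSpace Ω] (Pr : Measure Ω) [IsProbabilityMeasure Pr]
            (ξ : ∀ n, Ω → Fin N → S), 𝓜.IsParticleModel 𝓚 N Pr ξ →
          ∀ n : ℕ, 1 ≤ n →
            ∫ ω, (𝓜.particleMass (fun k => ξ k ω) n / 𝓜.mass n - 1) ^ 2 ∂Pr ≤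
              d * ((n + 1) / (N - 1)) * (1 + d / (N - 1)) ^ (n - 1)) := by
  refine ⟨fun r => 2 * |r|, fun r => by positivity, fun E _ 𝓜 => ⟨fun n => (𝓜.mass_mem n).2,
    ⟨fun n => ∑ p ∈ Finset.range (n + 1), 𝓜.localConst p n, 𝓜.sum_localConst_mem,
      SpatialBranching.Model.meanErrorBound_localConst 𝓜⟩,
    fun 𝓚 N hN Ω _ Pr _ ξ hξ n => ⟨fun ω => (𝓜.particleMass_mem hN _ n).2,
      fun f hf hC => hξ.integral_particleMass_mul hN n ⟨hf, hC⟩⟩⟩,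
    fun S _ 𝓜 hhom hscen hmix => ?_⟩
  obtain ⟨k, ε, hrate⟩ := hhom.exists_isMixingRate hmix
  exact ⟨⟨fun n => ∑ p ∈ Finset.range (n + 1), 𝓜.localConst p n, 𝓜.sum_localConst_mem,
      SpatialBranching.Model.meanErrorBound_localConst 𝓜,
      hhom.bddAbove_sum_localConst hscen hrate⟩,
    64 * ε⁻¹ ^ 2, by positivity,
    fun 𝓚 N hN Ω _ Pr _ ξ hξ n hn => hrate.integral_sq_ratio_le hN hξ hn⟩
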